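/- Notation. For $Z=(z_1,z_2),\,W=(w_1,w_2)\in\mathbb C^2$ put $\rho(Z,W)=\overline{z_1}+w_1-\overline{z_2}w_2$, $\rho(Z)=\rho(Z,Z)$, $\mathfrak S_2=\{Z\in\mathbb C^2:\rho(Z)>0\}$ and $dm(Z)=\rho(Z)^{-3}\,dz_1d\overline{z_1}dz_2d\overline{z_2}$ (with $dz\,d\overline z=2\,dx\,dy$). Let $J$ be the $3\times3$ matrix with rows $(0,0,-1),(0,1,0),(-1,0,0)$; the group $SU(2,1)=\{\gamma\in SL(3,\mathbb C):\gamma^*J\gamma=J\}$ acts on $\mathfrak S_2$ by fractional linear transformations. For $\gamma\in SU(2,1)$ with last row $(c_1,c_2,c_3)$ put $j(\gamma,Z)=c_1z_1+c_2z_2+c_3$ and $J(\gamma,Z)=j(\gamma,Z)/|j(\gamma,Z)|$. Let $2k\in\mathbb Z$ and $$\Delta_k=\rho(Z)\Big[(z_1+\overline{z_1})\tfrac{\partial^2}{\partial z_1\partial\overline{z_1}}+\tfrac{\partial^2}{\partial z_2\partial\overline{z_2}}+z_2\tfrac{\partial^2}{\partial\overline{z_1}\partial z_2}+\overline{z_2}\tfrac{\partial^2}{\partial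 z_1\partial\overline{z_2}}-k\Big(\tfrac{\partial}{\partial z_1}-\tfrac{\partial}{\partial\overline{z_1}}\Big)\Big].$$ Let $s\in\mathbb C$ with $2s-1\notin\{0,-1,-2,\dots\}$, $\lambda=s(s-2)$, and $$\varphi_{s,k}(Z',Z)=\frac{\rho(Z',Z)^{2k}}{|\rho(Z',Z)|^{2k}}\,\phi_{s,k}(\sigma),\qquad \sigma=\sigma(Z',Z)=\frac{|\rho(Z',Z)|^2}{\rho(Z')\rho(Z)},$$ $$\phi_{s,k}(\sigma)=\sigma^{-|k|}(1-\sigma)^{|k|-s}F\Big(s-|k|,s-1-|k|;2s-1;-\frac1{\sigma-1}\Big)\qquad(\sigma>1),$$ where $F$ is Gauss's hypergeometric function (continued analytically along the negative real axis) and the power of the negative number $1-\sigma$ has its principal value. Theorem 2.11. (0) For $k=0$ one has, with $u=\sigma(Z',Z)-1$ and a nonzero constant $d$ depending only on $s$, $\varphi_{s,0}(Z',Z)=d\,u^{-s}F(s,s-1;2s-1;-u^{-1})$ for all $Z'\ne Z$ in $\mathfrak S_2$. There is a constant $C=C(s,k)\in\mathbb C$, depending only on $s$ and $k$, which is zero if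 and only if $s-|k|\in\{0,-1,-2,\dots\}$, such that the following hold. (1) For all $g\in C_c^2(\mathfrak S_2)$ and $Z'\in\mathfrak S_2$, $$C\cdot4\pi^2g(Z')=\int_{\mathfrak S_2}\varphi_{s,k}(Z',Z)\,(-\Delta_k+\lambda)g(Z)\,dm(Z),$$ the integral being absolutely convergent. (2) Assume moreover that $\operatorname{Re}s>2$. Let $\Gamma\subset SU(2,1)$ be a subgroup acting properly discontinuously and freely on $\mathfrak S_2$ with compact quotient $\Gamma\backslash\mathfrak S_2$, and let $\mathcal F$ be a (measurable) fundamental domain of $\Gamma$. Then the series $$G_{s,k}(Z',Z)=\sum_{\gamma\in\Gamma}\varphi_{s,k}(Z',\gamma(Z))\,J(\gamma,Z)^{2k}$$ converges absolutely for all $Z',Z\in\mathfrak S_2$ with $Z'\notin\Gamma Z$, and for every $g\in C^2(\mathfrak S_2)$ with $g(\gamma(Z))=J(\gamma,Z)^{2k}g(Z)$ for all $\gamma\in\Gamma$, $Z\in\mathfrak S_2$, and all $Z'\in\mathfrak S_2$, $$C\cdot4\pi^2g(Z')=\int_{\mathcal F}G_{s,k}(Z',Z)\,(-\Delta_k+\lambda)g(Z)\,dm(Z),$$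 the integral being absolutely convergent. -/

import Mathlib

open MeasureTheory Complex
open scoped Matrix ComplexConjugate

/-- `ρ(Z, W) = conj z₁ + w₁ - conj z₂ * w₂`. -/
noncomputable def rho (Z W : ℂ × ℂ) : ℂ := conj Z.1 + W.1 - conj Z.2 * W.2

/-- `ρ(Z) = ρ(Z, Z) = z₁ + conj z₁ - z₂ conj z₂`, which is a real number. -/
noncomputable def rhoDiag (Z : ℂ × ℂ) : ℝ := (rho Z Z).re

/-- The Siegel domain `{(z₁, z₂) ∈ ℂ² : z₁ + conj z₁ - z₂ conj z₂ > 0}`. -/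
def siegelDomain : Set (ℂ × ℂ) := {Z | 0 < rhoDiag Z}

/-- The matrix of the Hermitian form of signature `(2, 1)`. -/
def formJ : Matrix (Fin 3) (Fin 3) ℂ := !![0, 0, -1; 0, 1, 0; -1, 0, 0]

/-- `SU(2,1) = {g ∈ SL(3, ℂ) : g* J g = J}`. -/
def SU21 : Subgroup (Matrix.SpecialLinearGroup (Fin 3) ℂ) where
  carrier := {g | (g : Matrix (Fin 3) (Fin 3) ℂ)ᴴ * formJ * (g : Matrix (Fin 3) (Fin 3) ℂ) = formJ}
  one_mem' := by simp
  mul_mem' := by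
    intro a b ha hb
    simp only [Set.mem_ofPred_eq, Matrix.SpecialLinearGroup.coe_mul,
      Matrix.conjTranspose_mul] at *
    calc _ = (b : Matrix (Fin 3) (Fin 3) ℂ)ᴴ * ((a : Matrix (Fin 3) (Fin 3) ℂ)ᴴ * formJ *
          (a : Matrix (Fin 3) (Fin 3) ℂ)) * (b : Matrix (Fin 3) (Fin 3) ℂ) := by
            simp only [Matrix.mul_assoc]
      _ = _ := by rw [ha, hb]
  inv_mem' := by
    intro a ha
    simp only [Set.mem_ofPred_eq] at *
    have h1 : (a : Matrix (Fin 3) (Fin 3) ℂ) * ((a⁻¹ : Matrix.SpecialLinearGroup (Fin 3) ℂ) :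
        Matrix (Fin 3) (Fin 3) ℂ) = 1 := by
      rw [← Matrix.SpecialLinearGroup.coe_mul]; simp
    have h2 : ((a⁻¹ : Matrix.SpecialLinearGroup (Fin 3) ℂ) :
        Matrix (Fin 3) (Fin 3) ℂ)ᴴ * (a : Matrix (Fin 3) (Fin 3) ℂ)ᴴ = 1 := by
      rw [← Matrix.conjTranspose_mul, h1]; simp
    generalize ((a⁻¹ : Matrix.SpecialLinearGroup (Fin 3) ℂ) : Matrix (Fin 3) (Fin 3) ℂ) = b at *
    generalize (a : Matrix (Fin 3) (Fin 3) ℂ) = c at *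
    calc bᴴ * formJ * b = bᴴ * (cᴴ * formJ * c) * b := by rw [ha]
      _ = (bᴴ * cᴴ) * formJ * (c * b) := by simp only [Matrix.mul_assoc]
      _ = formJ := by rw [h1, h2]; simp

/-- The `i`-th coordinate of the vector `g (z₁, z₂, 1)ᵀ`. -/
def linForm (g : SU21) (i : Fin 3) (Z : ℂ × ℂ) : ℂ := g.1 i 0 * Z.1 + g.1 i 1 * Z.2 + g.1 i 2

/-- The factor `j(g, Z) = c₁ z₁ + c₂ z₂ + c₃`, where `(c₁, c₂, c₃)` is the last row of `g`. -/
def autJ (g : SU21) (Z : ℂ × ℂ) : ℂ := linForm g 2 Z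

/-- `J(g, Z) = j(g, Z) / |j(g, Z)|`. -/
noncomputable def autPhase (g : SU21) (Z : ℂ × ℂ) : ℂ := autJ g Z / (‖autJ g Z‖ : ℂ)

/-- The fractional linear transformation of `ℂ²` defined by `g`. -/
noncomputable def moebius (g : SU21) (Z : ℂ × ℂ) : ℂ × ℂ :=
  (linForm g 0 Z / autJ g Z, linForm g 1 Z / autJ g Z)

theorem linForm_form (g : SU21) (Z W : ℂ × ℂ) :
    conj (linForm g 0 Z) * linForm g 2 W + conj (linForm g 2 Z) * linForm g 0 W
      - conj (linForm g 1 Z) * linForm g 1 W = rho Z W := by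
  have h : (g.1 : Matrix (Fin 3) (Fin 3) ℂ)ᴴ * formJ * (g.1 : Matrix (Fin 3) (Fin 3) ℂ) = formJ :=
    g.2
  have e : ∀ i j : Fin 3, conj (g.1 0 i) * g.1 2 j + conj (g.1 2 i) * g.1 0 j
      - conj (g.1 1 i) * g.1 1 j = - formJ i j := by
    intro i j
    rw [← h]
    simp [Matrix.mul_apply, Fin.sum_univ_three, formJ]
    ring
  have e00 := e 0 0
  have e01 := e 0 1
  have e02 := e 0 2
  have e10 := e 1 0
  have e11 := e 1 1
  have e12 := e 1 2
  have e20 := e 2 0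
  have e21 := e 2 1
  have e22 := e 2 2
  simp only [formJ, Matrix.of_apply, Matrix.cons_val', Matrix.cons_val_zero, Matrix.cons_val_one,
    Matrix.cons_val] at e00 e01 e02 e10 e11 e12 e20 e21 e22
  simp only [linForm, rho, map_add, map_mul]
  linear_combination conj Z.1 * W.1 * e00 + conj Z.1 * W.2 * e01 + conj Z.1 * e02
    + conj Z.2 * W.1 * e10 + conj Z.2 * W.2 * e11 + conj Z.2 * e12
    + W.1 * e20 + W.2 * e21 + e22

theorem autJ_ne_zero (g : SU21) {Z : ℂ × ℂ} (hZ : Z ∈ siegelDomain) : autJ g Z ≠ 0 := by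
  intro h
  have h1 := linForm_form g Z Z
  have h2 : linForm g 2 Z = 0 := h
  rw [h2] at h1
  have h3 := congrArg Complex.re h1
  have hZ' : 0 < (rho Z Z).re := hZ
  rw [← h3] at hZ'
  simp at hZ'
  nlinarith [mul_self_nonneg (linForm g 1 Z).re, mul_self_nonneg (linForm g 1 Z).im]

theorem rho_moebius (g : SU21) {Z W : ℂ × ℂ} (hZ : Z ∈ siegelDomain) (hW : W ∈ siegelDomain) :
    rho (moebius g Z) (moebius g W) = rho Z W / (conj (autJ g Z) * autJ g W) := by
  have hz := autJ_ne_zero g hZ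
  have hw := autJ_ne_zero g hW
  have hz' : conj (autJ g Z) ≠ 0 := by simpa using hz
  rw [eq_div_iff (mul_ne_zero hz' hw), ← linForm_form g Z W]
  simp only [rho, moebius, map_div₀]
  change _ = conj (linForm g 0 Z) * autJ g W + conj (autJ g Z) * linForm g 0 W - _
  field_simp

theorem moebius_mem (g : SU21) {Z : ℂ × ℂ} (hZ : Z ∈ siegelDomain) :
    moebius g Z ∈ siegelDomain := by
  have h := rho_moebius g hZ hZ
  have hz := autJ_ne_zero g hZ
  have h0 : 0 < (rho Z Z).re := hZ
  change 0 < (rho _ _).re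
  rw [h, ← Complex.normSq_eq_conj_mul_self, Complex.div_ofReal_re]
  exact div_pos h0 (Complex.normSq_pos.2 hz)

theorem linForm_mul (g h : SU21) (i : Fin 3) {Z : ℂ × ℂ} (hZ : Z ∈ siegelDomain) :
    linForm (g * h) i Z = linForm g i (moebius h Z) * autJ h Z := by
  have hz := autJ_ne_zero h hZ
  have : linForm g i (moebius h Z) * autJ h Z
      = g.1 i 0 * linForm h 0 Z + g.1 i 1 * linForm h 1 Z + g.1 i 2 * autJ h Z := by
    simp only [moebius, linForm]
    field_simp
  rw [this]
  simp [autJ, linForm, Matrix.mul_apply, Fin.sum_univ_three]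
  ring

/-- The action of `SU(2,1)` on the Siegel domain by fractional linear transformations. -/
noncomputable instance : MulAction SU21 siegelDomain where
  smul g Z := ⟨moebius g Z.1, moebius_mem g Z.2⟩
  one_smul Z := by
    apply Subtype.ext
    change moebius 1 Z.1 = Z.1
    simp [moebius, autJ, linForm]
  mul_smul g h Z := by
    apply Subtype.ext
    change moebius (g * h) Z.1 = moebius g (moebius h Z.1)
    have hz := autJ_ne_zero h Z.2
    have h0 := linForm_mul g h 0 Z.2
    have h1 := linForm_mul g h 1 Z.2
    have h2 : autJ (g * h) Z.1 = autJ g (moebius h Z.1) * autJ h Z.1 := linForm_mul g h 2 Z.2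
    unfold moebius at *
    rw [h0, h1, h2, mul_div_mul_right _ _ hz, mul_div_mul_right _ _ hz]

/-- The invariant measure `dm(Z) = ρ(Z)⁻³ dz₁ dz̄₁ dz₂ dz̄₂` on the Siegel domain, where
`dz dz̄ = 2 dx dy` for `z = x + i y`. -/
noncomputable def siegelMeasure : Measure siegelDomain :=
  (Measure.comap ((↑) : siegelDomain → ℂ × ℂ) volume).withDensity
    (fun Z => ENNReal.ofReal (4 / rhoDiag Z ^ 3))

/-- `∂/∂z₁ = (∂/∂x₁ - i ∂/∂y₁) / 2`. -/
noncomputable def wirt1 (f : ℂ × ℂ → ℂ) (Z : ℂ × ℂ) : ℂ :=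
  (fderiv ℝ f Z (1, 0) - I * fderiv ℝ f Z (I, 0)) / 2

/-- `∂/∂z̄₁ = (∂/∂x₁ + i ∂/∂y₁) / 2`. -/
noncomputable def wirt1bar (f : ℂ × ℂ → ℂ) (Z : ℂ × ℂ) : ℂ :=
  (fderiv ℝ f Z (1, 0) + I * fderiv ℝ f Z (I, 0)) / 2

/-- `∂/∂z₂ = (∂/∂x₂ - i ∂/∂y₂) / 2`. -/
noncomputable def wirt2 (f : ℂ × ℂ → ℂ) (Z : ℂ × ℂ) : ℂ :=
  (fderiv ℝ f Z (0, 1) - I * fderiv ℝ f Z (0, I)) / 2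

/-- `∂/∂z̄₂ = (∂/∂x₂ + i ∂/∂y₂) / 2`. -/
noncomputable def wirt2bar (f : ℂ × ℂ → ℂ) (Z : ℂ × ℂ) : ℂ :=
  (fderiv ℝ f Z (0, 1) + I * fderiv ℝ f Z (0, I)) / 2

/-- The differential operator `Δ_k` of weight `k`. -/
noncomputable def weightLaplacian (k : ℝ) (f : ℂ × ℂ → ℂ) (Z : ℂ × ℂ) : ℂ :=
  (rhoDiag Z : ℂ) *
    ((Z.1 + conj Z.1) * wirt1 (wirt1bar f) Z
      + wirt2 (wirt2bar f) Z
      + Z.2 * wirt2 (wirt1bar f) Z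
      + conj Z.2 * wirt1 (wirt2bar f) Z
      - (k : ℂ) * (wirt1 f Z - wirt1bar f Z))

/-- Gauss's hypergeometric function `F(a, b; c; z)` on the union of the unit disc and the half
plane `Re z < 1/2` (in particular for all real `z < 0`): the sum of the hypergeometric series in
the unit disc, and its analytic continuation to `Re z < 1/2`, given by Pfaff's transformation
`F(a, b; c; z) = (1 - z)^(-b) F(c - a, b; c; z / (z - 1))`, outside the disc. -/
noncomputable def gaussF (a b c z : ℂ) : ℂ :=
  if ‖z‖ < 1 then ₂F₁ a b c z else (1 - z) ^ (-b) * ₂F₁ (c - a) b c (z / (z - 1))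

/-- `σ(Z, W) = |ρ(Z, W)|² / (ρ(Z) ρ(W))`. -/
noncomputable def sigmaInv (Z W : ℂ × ℂ) : ℝ := ‖rho Z W‖ ^ 2 / (rhoDiag Z * rhoDiag W)

/-- `H_k(Z, W) = ρ(Z, W)^(2k) / |ρ(Z, W)|^(2k)`, where `m = 2k`. -/
noncomputable def phaseH (m : ℤ) (Z W : ℂ × ℂ) : ℂ := rho Z W ^ m / (‖rho Z W‖ : ℂ) ^ m

/-- The radial function
`ϕ_{s,k}(σ) = σ^(-|k|) (1 - σ)^(|k| - s) F(s - |k|, s - 1 - |k|; 2s - 1; -1/(σ - 1))`, `σ > 1`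
(principal value of the power of the negative number `1 - σ`). -/
noncomputable def radialKernel (s : ℂ) (k : ℝ) (σ : ℝ) : ℂ :=
  (σ : ℂ) ^ (-(|k| : ℝ) : ℂ) * (1 - (σ : ℂ)) ^ ((|k| : ℝ) - s) *
    gaussF (s - (|k| : ℝ)) (s - 1 - (|k| : ℝ)) (2 * s - 1) (-1 / ((σ : ℂ) - 1))

/-- The kernel `φ_{s,k}(Z, W) = H_k(Z, W) ϕ_{s,k}(σ(Z, W))` with `k = m / 2`. -/
noncomputable def pointPairKernel (s : ℂ) (m : ℤ) (Z W : ℂ × ℂ) : ℂ :=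
  phaseH m Z W * radialKernel s ((m : ℝ) / 2) (sigmaInv Z W)

/-- The term of index `γ` in the series defining the automorphic kernel:
`φ_{s,k}(Z', γ(Z)) J(γ, Z)^(2k)` with `k = m / 2`. -/
noncomputable def autKernelTerm (s : ℂ) (m : ℤ) (Z' Z : siegelDomain) (γ : SU21) : ℂ :=
  pointPairKernel s m Z' (γ • Z : siegelDomain) * autPhase γ Z ^ m

/-- The automorphic kernel `G_{s,k}(Z', Z) = ∑_{γ ∈ Γ} φ_{s,k}(Z', γ(Z)) J(γ, Z)^(2k)`. -/
noncomputable def autKernel (Γ : Subgroup SU21) (s : ℂ) (m : ℤ) (Z' Z : siegelDomain) : ℂ :=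
  ∑' γ : Γ, autKernelTerm s m Z' Z γ

/-- `C_c²` functions on the Siegel domain (extended by zero to `ℂ²`). -/
def IsCc2 (g : ℂ × ℂ → ℂ) : Prop :=
  ContDiff ℝ 2 g ∧ HasCompactSupport g ∧ tsupport g ⊆ siegelDomain

/-- `C²` functions on the Siegel domain with `g(γ(Z)) = J(γ, Z)^(2k) g(Z)` for all `γ ∈ Γ`, where
`m = 2k`. -/
def IsC2Automorphic (Γ : Subgroup SU21) (m : ℤ) (g : ℂ × ℂ → ℂ) : Prop :=
  ContDiffOn ℝ 2 g siegelDomain ∧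
    ∀ γ ∈ Γ, ∀ Z : siegelDomain, g (γ • Z : siegelDomain) = autPhase γ Z ^ m * g Z

open Filter Topology

/-! The kernel is, up to a constant, a Green's function: as a function of `Z` it is killed by the
adjoint of `-Δ_k + λ` away from `Z'`, and its singularity at `Z'` produces a multiple of the point
mass there.

Radial equation. The adjoint of `Δ_k` for `dm` is `Δ_{-k}`. It sends `H_k(Z', Z) Ψ(σ)` to `H_k`
times `σ(σ-1)Ψ'' + (3σ-1)Ψ' + (k²/σ)Ψ` (`adjLaplacian_radial`). For the eigenvalue `s(s-2)` the
solution with exponent `-s` at infinity is `σ^(-s) F(s-|k|, s+|k|; 2s-1; 1/σ)`, and the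
transformations of Pfaff and Euler identify it with `ϕ_{s,k}` up to a nonzero factor
(`radialKernel_eq`). The coefficients of this series tend to `r = Γ(2s-1)/(Γ(s-|k|)Γ(s+|k|))`, so by
Abel's theorem the solution behaves like `r/(σ-1)` at `σ = 1`; no connection formula is needed.
Because `2k` is an integer, `r = 0` exactly when `s-|k|` is a nonpositive integer
(`radialResidue_eq_zero_iff`).

Reproducing formula. Multiplied by a cutoff living on `1+δ ≤ σ ≤ 1+2R`, the kernel is C² with
compact support, and Green's formula (`integral_mul_weightLaplacian`) applies. Only the commutator
of the radial operator with the cutoff survives, on the two shells where `σ-1` lies in `[δ, 2δ]` or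
`[R, 2R]`. By homogeneity and the Cayley transform, `σ(Z', ·)` pushes `dm` forward to a constant
times `(σ-1) dσ` (`map_sigmaInv_siegelMeasure`). After rescaling, the inner shell tends to a
multiple of `r g(Z')`. The outer shell misses the support of a compactly supported `g`, and is
`O(R^(2 - Re s))` for bounded `g`. The volume of the unit ball enters only as a positive constant;
`4π²` is divided out in `reproducingConst`.

Automorphic functions. The modulus of an automorphic `g`, and that of `(-Δ_k + λ)g`, is invariant,
hence bounded by compactness of the quotient, so the formula holds on the whole domain and is
unfolded to a fundamental domain (`integral_autKernel`). The series converges by comparison with the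
integral of `σ^(-Re s)`, using `σ(A, C) ≤ 4 σ(A, B) σ(B, C)` and the bounded overlap of translates
of a compact set (`tsum_sigmaInv_rpow_lt_top`). Equivariance of `Δ_k g` is deduced from Green's
formula instead of a computation with derivatives (`weightLaplacian_smul`). -/

/-! ### Geometry of the Siegel domain and of the invariant `σ`. -/

theorem rho_self (Z : ℂ × ℂ) : rho Z Z = (rhoDiag Z : ℂ) := by
  apply Complex.ext <;> simp [rhoDiag, rho]
  ring

theorem rhoDiag_eq (Z : ℂ × ℂ) : rhoDiag Z = 2 * Z.1.re - normSq Z.2 := by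
  simp [rhoDiag, rho, normSq_apply]; ring

theorem conj_rho (Z W : ℂ × ℂ) : conj (rho Z W) = rho W Z := by
  simp [rho]; ring

/-- The coordinate `(Z - B)₁ - conj B₂ (Z - B)₂`, which is `rho B Z - rho B B`. -/
noncomputable def shearCoord (B Z : ℂ × ℂ) : ℂ := Z.1 - B.1 - conj B.2 * (Z.2 - B.2)

/-- `|rho B Z|² - rho(B) rho(Z)`, written as a sum of squares. -/
noncomputable def heisNorm (B Z : ℂ × ℂ) : ℝ :=
  normSq (shearCoord B Z) + rhoDiag B * normSq (Z.2 - B.2)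

/-- For the Hermitian form of signature `(2, 1)`, the lifts of `A` and `C` split into a component
along `B` and one orthogonal to it, on which the form is definite when `ρ(B) > 0`. The case `A = C`
yields `σ ≥ 1`; the general case yields the triangle inequality. -/
theorem rho_mul_rhoDiag (A B C : ℂ × ℂ) :
    rho A C * (rhoDiag B : ℂ) = rho A B * rho B C
      - (conj (shearCoord B A) * shearCoord B C
        + rhoDiag B * (conj (A.2 - B.2) * (C.2 - B.2))) := by
  rw [← rho_self]
  simp only [rho, shearCoord, map_sub, map_mul, conj_conj]
  ring

theorem normSq_rho (B Z : ℂ × ℂ) :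
    normSq (rho B Z) = rhoDiag B * rhoDiag Z + heisNorm B Z := by
  have h := rho_mul_rhoDiag Z B Z
  rw [rho_self, ← conj_rho B Z] at h
  have h' : ((rhoDiag Z * rhoDiag B : ℝ) : ℂ) = ((normSq (rho B Z) - heisNorm B Z : ℝ) : ℂ) := by
    push_cast
    rw [h]
    simp only [heisNorm, ofReal_add, ofReal_mul, normSq_eq_conj_mul_self]
  have := ofReal_injective h'
  linarith

theorem two_mul_re_rho (Z W : ℂ × ℂ) :
    2 * (rho Z W).re = rhoDiag Z + rhoDiag W + normSq (Z.2 - W.2) := by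
  simp [rhoDiag, rho, normSq_apply]; ring

theorem rhoDiag_pos (Z : siegelDomain) : 0 < rhoDiag Z := Z.2

theorem re_rho_pos {Z W : ℂ × ℂ} (hZ : Z ∈ siegelDomain) (hW : W ∈ siegelDomain) :
    0 < (rho Z W).re := by
  have h := two_mul_re_rho Z W
  have h1 : 0 < rhoDiag Z := hZ
  have h2 : 0 < rhoDiag W := hW
  have := normSq_nonneg (Z.2 - W.2)
  linarith

theorem rho_ne_zero {Z W : ℂ × ℂ} (hZ : Z ∈ siegelDomain) (hW : W ∈ siegelDomain) :
    rho Z W ≠ 0 := by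
  intro h
  have := re_rho_pos hZ hW
  simp [h] at this

theorem heisNorm_nonneg {B : ℂ × ℂ} (hB : B ∈ siegelDomain) (Z : ℂ × ℂ) : 0 ≤ heisNorm B Z := by
  have h1 : 0 < rhoDiag B := hB
  have := normSq_nonneg (shearCoord B Z)
  have := normSq_nonneg (Z.2 - B.2)
  unfold heisNorm
  positivity

theorem heisNorm_pos {B : ℂ × ℂ} (hB : B ∈ siegelDomain) {Z : ℂ × ℂ} (hZ : B ≠ Z) :
    0 < heisNorm B Z := by
  refine lt_of_le_of_ne (heisNorm_nonneg hB Z) fun h => hZ ?_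
  have h1 : 0 < rhoDiag B := hB
  have h2 := normSq_nonneg (shearCoord B Z)
  have h3 := normSq_nonneg (Z.2 - B.2)
  have h4 : 0 ≤ rhoDiag B * normSq (Z.2 - B.2) := by positivity
  unfold heisNorm at h
  have h5 : normSq (shearCoord B Z) = 0 := by linarith
  have h6 : rhoDiag B * normSq (Z.2 - B.2) = 0 := by linarith
  have h7 : normSq (Z.2 - B.2) = 0 := by
    rcases mul_eq_zero.1 h6 with h | h
    · exact absurd h h1.ne'
    · exact h
  rw [map_eq_zero, sub_eq_zero] at h7
  rw [map_eq_zero] at h5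
  simp only [shearCoord, h7, sub_self, mul_zero, sub_zero, sub_eq_zero] at h5
  exact (Prod.ext h5 h7).symm

theorem sigmaInv_eq (A Z : ℂ × ℂ) : sigmaInv A Z = normSq (rho A Z) / (rhoDiag A * rhoDiag Z) := by
  rw [sigmaInv, normSq_eq_norm_sq]

theorem sigmaInv_sub_one {A Z : ℂ × ℂ} (hA : A ∈ siegelDomain) (hZ : Z ∈ siegelDomain) :
    sigmaInv A Z - 1 = heisNorm A Z / (rhoDiag A * rhoDiag Z) := by
  have h1 : 0 < rhoDiag A := hA
  have h2 : 0 < rhoDiag Z := hZ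
  rw [sigmaInv_eq, normSq_rho]
  field_simp
  ring

theorem one_le_sigmaInv {A Z : ℂ × ℂ} (hA : A ∈ siegelDomain) (hZ : Z ∈ siegelDomain) :
    1 ≤ sigmaInv A Z := by
  have h1 : 0 < rhoDiag A := hA
  have h2 : 0 < rhoDiag Z := hZ
  have h := sigmaInv_sub_one hA hZ
  have : 0 ≤ heisNorm A Z / (rhoDiag A * rhoDiag Z) :=
    div_nonneg (heisNorm_nonneg hA Z) (by positivity)
  linarith

theorem one_lt_sigmaInv {A Z : ℂ × ℂ} (hA : A ∈ siegelDomain) (hZ : Z ∈ siegelDomain)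
    (h : A ≠ Z) : 1 < sigmaInv A Z := by
  have h1 : 0 < rhoDiag A := hA
  have h2 : 0 < rhoDiag Z := hZ
  have h3 := sigmaInv_sub_one hA hZ
  have : 0 < heisNorm A Z / (rhoDiag A * rhoDiag Z) :=
    div_pos (heisNorm_pos hA h) (by positivity)
  linarith

theorem sigmaInv_self {A : ℂ × ℂ} (hA : A ∈ siegelDomain) : sigmaInv A A = 1 := by
  have := sigmaInv_sub_one hA hA
  have h0 : heisNorm A A = 0 := by simp [heisNorm, shearCoord]
  rw [h0, zero_div] at this
  linarith

/-- The formula for `σ` makes sense off the domain, division by zero being zero. Thanks to this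
sign, a function of `σ` that vanishes below a positive number is automatically extended by zero to
`ℂ²`. -/
theorem sigmaInv_nonpos_of_notMem {A Z : ℂ × ℂ} (hA : A ∈ siegelDomain) (hZ : Z ∉ siegelDomain) :
    sigmaInv A Z ≤ 0 := by
  have h1 : 0 < rhoDiag A := hA
  have h2 : rhoDiag Z ≤ 0 := not_lt.1 hZ
  rw [sigmaInv_eq]
  exact div_nonpos_of_nonneg_of_nonpos (normSq_nonneg _) (mul_nonpos_of_nonneg_of_nonpos h1.le h2)

theorem rhoDiag_moebius (g : SU21) {Z : ℂ × ℂ} (hZ : Z ∈ siegelDomain) :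
    rhoDiag (moebius g Z) = rhoDiag Z / normSq (autJ g Z) := by
  have h := rho_moebius g hZ hZ
  rw [rho_self, rho_self, ← normSq_eq_conj_mul_self] at h
  exact_mod_cast h

theorem coe_smul_siegel (g : SU21) (Z : siegelDomain) :
    ((g • Z : siegelDomain) : ℂ × ℂ) = moebius g Z := rfl

theorem sigmaInv_smul (g : SU21) (Z W : siegelDomain) :
    sigmaInv (g • Z : siegelDomain) (g • W : siegelDomain) = sigmaInv Z W := by
  have h1 := normSq_pos.2 (autJ_ne_zero g Z.2)
  have h2 := normSq_pos.2 (autJ_ne_zero g W.2)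
  rw [coe_smul_siegel, coe_smul_siegel, sigmaInv_eq, sigmaInv_eq, rho_moebius g Z.2 W.2,
    rhoDiag_moebius g Z.2, rhoDiag_moebius g W.2, normSq_div, normSq_mul, normSq_conj]
  field_simp

theorem norm_autPhase (g : SU21) {Z : ℂ × ℂ} (hZ : Z ∈ siegelDomain) : ‖autPhase g Z‖ = 1 := by
  have := autJ_ne_zero g hZ
  simp [autPhase, this]

theorem autPhase_ne_zero (g : SU21) {Z : ℂ × ℂ} (hZ : Z ∈ siegelDomain) : autPhase g Z ≠ 0 := by
  rw [← norm_ne_zero_iff, norm_autPhase g hZ]; exact one_ne_zero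

theorem conj_autPhase (g : SU21) {Z : ℂ × ℂ} (hZ : Z ∈ siegelDomain) :
    conj (autPhase g Z) = (autPhase g Z)⁻¹ := by
  rw [inv_eq_conj (norm_autPhase g hZ)]

theorem norm_phaseH (m : ℤ) {Z W : ℂ × ℂ} (hZ : Z ∈ siegelDomain) (hW : W ∈ siegelDomain) :
    ‖phaseH m Z W‖ = 1 := by
  have := rho_ne_zero hZ hW
  have h : ‖rho Z W‖ ≠ 0 := norm_ne_zero_iff.2 this
  rw [phaseH, norm_div, norm_zpow, norm_zpow, norm_real, norm_norm, div_self]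
  exact zpow_ne_zero _ h

theorem phaseH_self (m : ℤ) {Z : ℂ × ℂ} (hZ : Z ∈ siegelDomain) : phaseH m Z Z = 1 := by
  have h1 : 0 < rhoDiag Z := hZ
  have h2 : (rhoDiag Z : ℂ) ≠ 0 := by exact_mod_cast h1.ne'
  rw [phaseH, rho_self, norm_real, Real.norm_of_nonneg h1.le, div_self]
  exact zpow_ne_zero _ h2

theorem phaseH_smul (m : ℤ) (g : SU21) (Z W : siegelDomain) :
    phaseH m (g • Z : siegelDomain) (g • W : siegelDomain)
      = autPhase g Z ^ m * phaseH m Z W * (autPhase g W ^ m)⁻¹ := by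
  have hz := autJ_ne_zero g Z.2
  have hw := autJ_ne_zero g W.2
  have hr := rho_ne_zero Z.2 W.2
  have e1 : rho (moebius g Z) (moebius g W) / (‖rho (moebius g Z) (moebius g W)‖ : ℂ)
      = autPhase g Z * (rho Z W / (‖rho Z W‖ : ℂ)) * (autPhase g W)⁻¹ := by
    have h : autPhase g Z = (conj (autPhase g Z))⁻¹ := by rw [conj_autPhase g Z.2, inv_inv]
    rw [h, rho_moebius g Z.2 W.2]
    simp only [autPhase, map_div₀, conj_ofReal, norm_div, norm_mul, norm_conj]
    have n1 : (‖autJ g Z‖ : ℂ) ≠ 0 := by simpa using hz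
    have n2 : (‖autJ g W‖ : ℂ) ≠ 0 := by simpa using hw
    have n3 : (‖rho Z W‖ : ℂ) ≠ 0 := by simpa using hr
    have n4 : conj (autJ g Z) ≠ 0 := by simpa using hz
    push_cast
    field_simp
  rw [coe_smul_siegel, coe_smul_siegel]
  simp only [phaseH, ← div_zpow, ← inv_zpow, ← mul_zpow]
  rw [e1]

/-- Multiplicative triangle inequality for `sigmaInv = cosh² (d / 2)`. -/
theorem sigmaInv_triangle {A B C : ℂ × ℂ} (hA : A ∈ siegelDomain) (hB : B ∈ siegelDomain)
    (hC : C ∈ siegelDomain) : sigmaInv A C ≤ 4 * (sigmaInv A B * sigmaInv B C) := by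
  have h1 : 0 < rhoDiag A := hA
  have h2 : 0 < rhoDiag B := hB
  have h3 : 0 < rhoDiag C := hC
  have key : ‖rho A C‖ * rhoDiag B ≤ 2 * (‖rho A B‖ * ‖rho B C‖) := by
    have e := rho_mul_rhoDiag A B C
    set p := shearCoord B A
    set q := shearCoord B C
    set x := A.2 - B.2
    set y := C.2 - B.2
    have hp : ‖p‖ ^ 2 + rhoDiag B * ‖x‖ ^ 2 ≤ ‖rho A B‖ ^ 2 := by
      have := normSq_rho B A
      rw [← conj_rho A B, normSq_conj, normSq_eq_norm_sq, heisNorm, normSq_eq_norm_sq,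
        normSq_eq_norm_sq] at this
      have : 0 < rhoDiag B * rhoDiag A := by positivity
      linarith
    have hq : ‖q‖ ^ 2 + rhoDiag B * ‖y‖ ^ 2 ≤ ‖rho B C‖ ^ 2 := by
      have := normSq_rho B C
      rw [normSq_eq_norm_sq, heisNorm, normSq_eq_norm_sq, normSq_eq_norm_sq] at this
      have : 0 < rhoDiag B * rhoDiag C := by positivity
      linarith
    have n1 : ‖rho A C‖ * rhoDiag B ≤ ‖rho A B‖ * ‖rho B C‖ +
        (‖p‖ * ‖q‖ + rhoDiag B * (‖x‖ * ‖y‖)) := by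
      calc ‖rho A C‖ * rhoDiag B = ‖rho A C * (rhoDiag B : ℂ)‖ := by
            rw [norm_mul, norm_real, Real.norm_of_nonneg h2.le]
        _ ≤ ‖rho A B * rho B C‖ + (‖conj p * q‖ + ‖rhoDiag B * (conj x * y)‖) := by
            rw [e]
            exact (norm_sub_le _ _).trans (add_le_add_right (norm_add_le _ _) _)
        _ = _ := by
            simp only [norm_mul, norm_conj, norm_real, Real.norm_of_nonneg h2.le]
    have n2 : ‖p‖ * ‖q‖ + rhoDiag B * (‖x‖ * ‖y‖) ≤ ‖rho A B‖ * ‖rho B C‖ := by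
      refine le_of_sq_le_sq ?_ (by positivity)
      calc (‖p‖ * ‖q‖ + rhoDiag B * (‖x‖ * ‖y‖)) ^ 2
          ≤ (‖p‖ ^ 2 + rhoDiag B * ‖x‖ ^ 2) * (‖q‖ ^ 2 + rhoDiag B * ‖y‖ ^ 2) := by
            -- Lagrange's identity: this is the defect in the Cauchy–Schwarz inequality for the
            -- inner product with weights `1` and `ρ(B)`.
            have := mul_nonneg h2.le (sq_nonneg (‖p‖ * ‖y‖ - ‖q‖ * ‖x‖))
            nlinarith
        _ ≤ ‖rho A B‖ ^ 2 * ‖rho B C‖ ^ 2 := by gcongr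
        _ = _ := by ring
    linarith
  have key2 : ‖rho A C‖ ^ 2 * rhoDiag B ^ 2 ≤ 4 * (‖rho A B‖ ^ 2 * ‖rho B C‖ ^ 2) := by
    calc ‖rho A C‖ ^ 2 * rhoDiag B ^ 2 = (‖rho A C‖ * rhoDiag B) ^ 2 := by ring
      _ ≤ (2 * (‖rho A B‖ * ‖rho B C‖)) ^ 2 := by gcongr
      _ = _ := by ring
  unfold sigmaInv
  rw [div_mul_div_comm, ← mul_div_assoc, div_le_div_iff₀ (by positivity) (by positivity)]
  calc ‖rho A C‖ ^ 2 * (rhoDiag A * rhoDiag B * (rhoDiag B * rhoDiag C))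
      = (‖rho A C‖ ^ 2 * rhoDiag B ^ 2) * (rhoDiag A * rhoDiag C) := by ring
    _ ≤ (4 * (‖rho A B‖ ^ 2 * ‖rho B C‖ ^ 2)) * (rhoDiag A * rhoDiag C) := by gcongr

theorem continuous_rho (A : ℂ × ℂ) : Continuous (rho A) := by
  unfold rho; fun_prop

theorem continuous_rhoDiag : Continuous rhoDiag := by
  unfold rhoDiag rho
  have := continuous_conj
  fun_prop

theorem isOpen_siegelDomain : IsOpen siegelDomain :=
  isOpen_lt continuous_const continuous_rhoDiag

theorem continuousOn_sigmaInv {A : ℂ × ℂ} (hA : A ∈ siegelDomain) :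
    ContinuousOn (sigmaInv A) siegelDomain := by
  unfold sigmaInv
  refine ContinuousOn.div ?_ ?_ ?_
  · exact ((continuous_rho A).norm.pow 2).continuousOn
  · exact (continuous_const.mul continuous_rhoDiag).continuousOn
  · intro Z hZ
    have h1 : 0 < rhoDiag A := hA
    have h2 : 0 < rhoDiag Z := hZ
    positivity

theorem continuousOn_phaseH (m : ℤ) {A : ℂ × ℂ} (hA : A ∈ siegelDomain) :
    ContinuousOn (phaseH m A) siegelDomain := by
  unfold phaseH
  have h : ∀ Z ∈ siegelDomain, rho A Z ≠ 0 := fun Z hZ => rho_ne_zero hA hZ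
  refine ContinuousOn.div ?_ ?_ ?_
  · exact (continuous_rho A).continuousOn.zpow₀ m fun Z hZ => Or.inl (h Z hZ)
  · refine ContinuousOn.zpow₀ ?_ m fun Z hZ => Or.inl (by simpa using h Z hZ)
    exact (continuous_ofReal.comp (continuous_rho A).norm).continuousOn
  · intro Z hZ
    exact zpow_ne_zero _ (by simpa using h Z hZ)

/-- Closed: after clearing the denominator, a boundary point with `ρ(Z) = 0` would have `ρ(A, Z) =
0`, although `Re ρ(A, Z) > 0`. Bounded: `ρ(Z) ≤ 2|ρ(A, Z)|`, so `|ρ(A, Z)|² ≤ R ρ(A) ρ(Z)` bounds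
`|ρ(A, Z)|`, and with it both coordinates. -/
theorem isCompact_sigmaInv_le {A : ℂ × ℂ} (hA : A ∈ siegelDomain) (R : ℝ) :
    IsCompact {Z | Z ∈ siegelDomain ∧ sigmaInv A Z ≤ R} := by
  have h1 : 0 < rhoDiag A := hA
  have hset : {Z | Z ∈ siegelDomain ∧ sigmaInv A Z ≤ R}
      = {Z | 0 ≤ rhoDiag Z ∧ normSq (rho A Z) ≤ R * (rhoDiag A * rhoDiag Z)} := by
    ext Z
    constructor
    · rintro ⟨hZ, h⟩
      have h2 : 0 < rhoDiag Z := hZ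
      rw [sigmaInv_eq, div_le_iff₀ (by positivity)] at h
      exact ⟨h2.le, h⟩
    · rintro ⟨h2, h⟩
      have h3 : 0 < rhoDiag Z := by
        refine lt_of_le_of_ne h2 fun h0 => ?_
        rw [← h0] at h
        have h4 := two_mul_re_rho A Z
        have h5 : rho A Z = 0 := normSq_eq_zero.1 (le_antisymm (by simpa using h) (normSq_nonneg _))
        rw [h5, ← h0] at h4
        have := normSq_nonneg (A.2 - Z.2)
        simp at h4
        linarith
      refine ⟨h3, ?_⟩
      rw [sigmaInv_eq, div_le_iff₀ (by positivity)]
      exact h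
  have hclosed : IsClosed {Z | Z ∈ siegelDomain ∧ sigmaInv A Z ≤ R} := by
    rw [hset]
    rw [Set.ofPred_and]
    exact (isClosed_le continuous_const continuous_rhoDiag).inter
      (isClosed_le (continuous_normSq.comp (continuous_rho A))
        (continuous_const.mul (continuous_const.mul continuous_rhoDiag)))
  refine Metric.isCompact_of_isClosed_isBounded hclosed ?_
  have bnd : ∀ Z, Z ∈ siegelDomain ∧ sigmaInv A Z ≤ R →
      ‖rho A Z‖ ≤ 2 * R * rhoDiag A ∧ ‖Z.2‖ ≤ ‖A.2‖ + 4 * R * rhoDiag A + 1 := by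
    rintro Z ⟨hZ, h⟩
    have h2 : 0 < rhoDiag Z := hZ
    rw [sigmaInv, div_le_iff₀ (by positivity)] at h
    have h4 := two_mul_re_rho A Z
    rw [normSq_eq_norm_sq] at h4
    have h5 := (rho A Z).re_le_norm
    have h6 := sq_nonneg ‖A.2 - Z.2‖
    have hr : 0 < ‖rho A Z‖ := norm_pos_iff.2 (rho_ne_zero hA hZ)
    have h7 : rhoDiag Z ≤ 2 * ‖rho A Z‖ := by linarith
    have hR : 0 ≤ R := by
      by_contra hR
      push Not at hR
      have : R * (rhoDiag A * rhoDiag Z) < 0 := mul_neg_of_neg_of_pos hR (by positivity)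
      nlinarith
    have h8 : ‖rho A Z‖ ^ 2 ≤ (2 * R * rhoDiag A) * ‖rho A Z‖ := by
      have : 0 ≤ R * rhoDiag A := by positivity
      nlinarith
    have h9 : ‖rho A Z‖ ≤ 2 * R * rhoDiag A := by
      rw [sq] at h8
      exact le_of_mul_le_mul_right h8 hr
    refine ⟨h9, ?_⟩
    have h10 : ‖A.2 - Z.2‖ ^ 2 ≤ 4 * R * rhoDiag A := by linarith
    have h11 : ‖A.2 - Z.2‖ ≤ 4 * R * rhoDiag A + 1 := by nlinarith [sq_nonneg (‖A.2 - Z.2‖ - 1)]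
    have h12 : ‖Z.2‖ ≤ ‖A.2‖ + ‖A.2 - Z.2‖ := by
      calc ‖Z.2‖ = ‖A.2 - (A.2 - Z.2)‖ := by ring_nf
        _ ≤ _ := norm_sub_le _ _
    linarith
  rw [isBounded_iff_forall_norm_le]
  set K := ‖A.2‖ + 4 * R * rhoDiag A + 1
  refine ⟨max (2 * R * rhoDiag A + ‖A.1‖ + ‖A.2‖ * K) K, fun Z hZ => ?_⟩
  obtain ⟨b1, b2⟩ := bnd Z hZ
  rw [Prod.norm_def]
  refine max_le_max ?_ b2
  calc ‖Z.1‖ = ‖rho A Z - conj A.1 + conj A.2 * Z.2‖ := by congr 1; simp only [rho]; ring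
    _ ≤ ‖rho A Z‖ + ‖conj A.1‖ + ‖conj A.2 * Z.2‖ :=
        (norm_add_le _ _).trans (add_le_add_left (norm_sub_le _ _) _)
    _ ≤ _ := by
        rw [norm_mul, norm_conj, norm_conj]
        gcongr

theorem isCompact_sigmaInv_le_subtype (A : siegelDomain) (R : ℝ) :
    IsCompact {Z : siegelDomain | sigmaInv A Z ≤ R} := by
  rw [Subtype.isCompact_iff]
  convert! isCompact_sigmaInv_le A.2 R using 1
  ext Z
  simp [and_comm]

theorem continuous_sigmaInv (A : siegelDomain) : Continuous fun Z : siegelDomain => sigmaInv A Z :=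
  continuousOn_iff_continuous_domRestrict.1 (continuousOn_sigmaInv A.2)

/-- On the compact set `σ ≤ 2` with a neighbourhood of `A` removed, `σ` attains its minimum, and
this exceeds `1`. So concentration at `σ = 1` is concentration at the point `A`. -/
theorem exists_sigmaInv_lt_subset (A : siegelDomain) {U : Set siegelDomain} (hU : U ∈ 𝓝 A) :
    ∃ δ > 0, ∀ Z : siegelDomain, sigmaInv A Z < 1 + δ → Z ∈ U := by
  obtain ⟨V, hVU, hV, hAV⟩ := mem_nhds_iff.1 hU
  have hK : IsCompact ({Z : siegelDomain | sigmaInv A Z ≤ 2} \ V) :=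
    (isCompact_sigmaInv_le_subtype A 2).diff hV
  rcases Set.eq_empty_or_nonempty ({Z : siegelDomain | sigmaInv A Z ≤ 2} \ V) with h | h
  · refine ⟨1, one_pos, fun Z hZ => hVU ?_⟩
    by_contra hZV
    have : Z ∈ ({Z : siegelDomain | sigmaInv A Z ≤ 2} \ V) := by
      refine ⟨?_, hZV⟩
      change sigmaInv A Z ≤ 2
      linarith
    rw [h] at this
    exact this
  · obtain ⟨W, hW, hmin⟩ := hK.exists_isMinOn h (continuous_sigmaInv A).continuousOn
    have hAW : (A : ℂ × ℂ) ≠ W := fun h => hW.2 (Subtype.ext h ▸ hAV)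
    have h1 := one_lt_sigmaInv A.2 W.2 hAW
    refine ⟨min 1 (sigmaInv A W - 1), by simp [h1], fun Z hZ => hVU ?_⟩
    by_contra hZV
    have h2 : sigmaInv A Z < 2 := by
      have := min_le_left 1 (sigmaInv (A : ℂ × ℂ) W - 1)
      linarith
    have h3 : sigmaInv A W ≤ sigmaInv A Z := hmin ⟨h2.le, hZV⟩
    have := min_le_right 1 (sigmaInv (A : ℂ × ℂ) W - 1)
    linarith

/-! ### Wirtinger calculus and the action of the adjoint operator on radial functions. -/

/-- The real-linear form `a₁ dz₁ + b₁ dz̄₁ + a₂ dz₂ + b₂ dz̄₂` on `ℂ²`. -/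
noncomputable def wirtForm (a₁ b₁ a₂ b₂ : ℂ) : ℂ × ℂ →L[ℝ] ℂ :=
  a₁ • ContinuousLinearMap.fst ℝ ℂ ℂ
    + b₁ • ((conjCLE : ℂ →L[ℝ] ℂ).comp (ContinuousLinearMap.fst ℝ ℂ ℂ))
    + a₂ • ContinuousLinearMap.snd ℝ ℂ ℂ
    + b₂ • ((conjCLE : ℂ →L[ℝ] ℂ).comp (ContinuousLinearMap.snd ℝ ℂ ℂ))

theorem wirtForm_apply (a₁ b₁ a₂ b₂ : ℂ) (v : ℂ × ℂ) :
    wirtForm a₁ b₁ a₂ b₂ v = a₁ * v.1 + b₁ * conj v.1 + a₂ * v.2 + b₂ * conj v.2 := by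
  simp [wirtForm]

/-- `f` is real-differentiable at `Z` with Wirtinger derivatives `∂₁ f = a₁`, `∂̄₁ f = b₁`,
`∂₂ f = a₂`, `∂̄₂ f = b₂`. -/
def HasWirtAt (f : ℂ × ℂ → ℂ) (Z : ℂ × ℂ) (a₁ b₁ a₂ b₂ : ℂ) : Prop :=
  HasFDerivAt f (wirtForm a₁ b₁ a₂ b₂) Z

namespace HasWirtAt

variable {f g : ℂ × ℂ → ℂ} {Z : ℂ × ℂ} {a₁ b₁ a₂ b₂ c₁ d₁ c₂ d₂ : ℂ}

theorem wirt1_eq (h : HasWirtAt f Z a₁ b₁ a₂ b₂) : wirt1 f Z = a₁ := by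
  rw [wirt1, HasFDerivAt.fderiv h]
  simp only [wirtForm_apply, map_one, conj_I, map_zero]
  linear_combination (-(a₁ - b₁) / 2) * I_mul_I

theorem wirt1bar_eq (h : HasWirtAt f Z a₁ b₁ a₂ b₂) : wirt1bar f Z = b₁ := by
  rw [wirt1bar, HasFDerivAt.fderiv h]
  simp only [wirtForm_apply, map_one, conj_I, map_zero]
  linear_combination ((a₁ - b₁) / 2) * I_mul_I

theorem wirt2_eq (h : HasWirtAt f Z a₁ b₁ a₂ b₂) : wirt2 f Z = a₂ := by
  rw [wirt2, HasFDerivAt.fderiv h]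
  simp only [wirtForm_apply, map_one, conj_I, map_zero]
  linear_combination (-(a₂ - b₂) / 2) * I_mul_I

theorem wirt2bar_eq (h : HasWirtAt f Z a₁ b₁ a₂ b₂) : wirt2bar f Z = b₂ := by
  rw [wirt2bar, HasFDerivAt.fderiv h]
  simp only [wirtForm_apply, map_one, conj_I, map_zero]
  linear_combination ((a₂ - b₂) / 2) * I_mul_I

theorem of_hasFDerivAt {f' : ℂ × ℂ →L[ℝ] ℂ} (h : HasFDerivAt f f' Z)
    (h' : ∀ v : ℂ × ℂ, f' v = a₁ * v.1 + b₁ * conj v.1 + a₂ * v.2 + b₂ * conj v.2) :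
    HasWirtAt f Z a₁ b₁ a₂ b₂ := by
  have : f' = wirtForm a₁ b₁ a₂ b₂ := by
    refine ContinuousLinearMap.ext fun v => ?_
    rw [h', wirtForm_apply]
  rw [HasWirtAt, ← this]
  exact h

theorem const (c : ℂ) : HasWirtAt (fun _ => c) Z 0 0 0 0 :=
  of_hasFDerivAt (hasFDerivAt_const c Z) (by simp)

theorem fst : HasWirtAt (fun W => W.1) Z 1 0 0 0 :=
  of_hasFDerivAt (ContinuousLinearMap.fst ℝ ℂ ℂ).hasFDerivAt (by simp)

theorem snd : HasWirtAt (fun W => W.2) Z 0 0 1 0 :=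
  of_hasFDerivAt (ContinuousLinearMap.snd ℝ ℂ ℂ).hasFDerivAt (by simp)

theorem add (hf : HasWirtAt f Z a₁ b₁ a₂ b₂) (hg : HasWirtAt g Z c₁ d₁ c₂ d₂) :
    HasWirtAt (fun W => f W + g W) Z (a₁ + c₁) (b₁ + d₁) (a₂ + c₂) (b₂ + d₂) :=
  of_hasFDerivAt (HasFDerivAt.add hf hg) fun v => by
    simp only [add_apply, wirtForm_apply]; ring

theorem sub (hf : HasWirtAt f Z a₁ b₁ a₂ b₂) (hg : HasWirtAt g Z c₁ d₁ c₂ d₂) :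
    HasWirtAt (fun W => f W - g W) Z (a₁ - c₁) (b₁ - d₁) (a₂ - c₂) (b₂ - d₂) :=
  of_hasFDerivAt (HasFDerivAt.sub hf hg) fun v => by
    simp only [sub_apply, wirtForm_apply]; ring

theorem mul (hf : HasWirtAt f Z a₁ b₁ a₂ b₂) (hg : HasWirtAt g Z c₁ d₁ c₂ d₂) :
    HasWirtAt (fun W => f W * g W) Z (a₁ * g Z + f Z * c₁) (b₁ * g Z + f Z * d₁)
      (a₂ * g Z + f Z * c₂) (b₂ * g Z + f Z * d₂) :=
  of_hasFDerivAt (HasFDerivAt.mul hf hg) fun v => by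
    simp only [add_apply, smul_apply, wirtForm_apply,
      smul_eq_mul]
    ring

theorem const_mul (c : ℂ) (hf : HasWirtAt f Z a₁ b₁ a₂ b₂) :
    HasWirtAt (fun W => c * f W) Z (c * a₁) (c * b₁) (c * a₂) (c * b₂) :=
  of_hasFDerivAt (HasFDerivAt.const_mul hf c) fun v => by
    simp only [smul_apply, wirtForm_apply, smul_eq_mul]
    ring

theorem conj_comp (hf : HasWirtAt f Z a₁ b₁ a₂ b₂) :
    HasWirtAt (fun W => conj (f W)) Z (conj b₁) (conj a₁) (conj b₂) (conj a₂) :=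
  of_hasFDerivAt ((conjCLE : ℂ →L[ℝ] ℂ).hasFDerivAt.comp Z hf) fun v => by
    simp [wirtForm_apply]; ring

theorem comp_hasDerivAt {h : ℂ → ℂ} {h' : ℂ} (hh : HasDerivAt h h' (f Z))
    (hf : HasWirtAt f Z a₁ b₁ a₂ b₂) :
    HasWirtAt (fun W => h (f W)) Z (h' * a₁) (h' * b₁) (h' * a₂) (h' * b₂) :=
  of_hasFDerivAt ((hh.hasFDerivAt.restrictScalars ℝ).comp Z hf) fun v => by
    simp [wirtForm_apply]; ring

theorem inv (hf : HasWirtAt f Z a₁ b₁ a₂ b₂) (h0 : f Z ≠ 0) :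
    HasWirtAt (fun W => (f W)⁻¹) Z (-a₁ / f Z ^ 2) (-b₁ / f Z ^ 2) (-a₂ / f Z ^ 2)
      (-b₂ / f Z ^ 2) := by
  have := comp_hasDerivAt (hasDerivAt_inv h0) hf
  convert! this using 1 <;> ring

/-- As `q` is real, its derivative takes real values, so the chain rule only asks `Ψ` to be
differentiable along the real line. -/
theorem comp_ofReal {q : ℂ × ℂ → ℝ} (hq : HasWirtAt (fun W => (q W : ℂ)) Z a₁ b₁ a₂ b₂)
    {Ψ : ℝ → ℂ} {Ψ' : ℂ} (hΨ : HasDerivAt Ψ Ψ' (q Z)) :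
    HasWirtAt (fun W => Ψ (q W)) Z (Ψ' * a₁) (Ψ' * b₁) (Ψ' * a₂) (Ψ' * b₂) := by
  have hre : HasFDerivAt q (reCLM.comp (wirtForm a₁ b₁ a₂ b₂)) Z := by
    have := reCLM.hasFDerivAt.comp Z hq
    exact this
  have him : HasFDerivAt (fun _ : ℂ × ℂ => (0 : ℝ)) (imCLM.comp (wirtForm a₁ b₁ a₂ b₂)) Z := by
    have := imCLM.hasFDerivAt.comp Z hq
    exact this
  have him0 := him.unique (hasFDerivAt_const 0 Z)
  have hreal : ∀ v, ((wirtForm a₁ b₁ a₂ b₂ v).re : ℂ) = wirtForm a₁ b₁ a₂ b₂ v := fun v => by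
    have := congrArg (fun L => L v) him0
    apply Complex.ext
    · simp
    · simpa using this.symm
  refine of_hasFDerivAt (hΨ.hasFDerivAt.comp Z hre) fun v => ?_
  have : ((wirtForm a₁ b₁ a₂ b₂ v).re : ℂ) * Ψ' = wirtForm a₁ b₁ a₂ b₂ v * Ψ' := by rw [hreal]
  simp only [ContinuousLinearMap.comp_apply, ContinuousLinearMap.toSpanSingleton_apply,
    reCLM_apply, real_smul]
  rw [this, wirtForm_apply]
  ring

theorem congr_of_eventuallyEq (hf : HasWirtAt f Z a₁ b₁ a₂ b₂) (h : g =ᶠ[𝓝 Z] f) :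
    HasWirtAt g Z a₁ b₁ a₂ b₂ :=
  HasFDerivAt.congr_of_eventuallyEq hf h

end HasWirtAt

theorem DifferentiableAt.hasWirtAt {f : ℂ × ℂ → ℂ} {Z : ℂ × ℂ} (h : DifferentiableAt ℝ f Z) :
    HasWirtAt f Z (wirt1 f Z) (wirt1bar f Z) (wirt2 f Z) (wirt2bar f Z) := by
  refine HasWirtAt.of_hasFDerivAt h.hasFDerivAt fun v => ?_
  obtain ⟨⟨x, y⟩, ⟨p, q⟩⟩ := v
  have e (a b : ℝ) : (⟨a, b⟩ : ℂ) = a + b * I := mk_eq_add_mul_I a b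
  have hv : ((⟨x, y⟩, ⟨p, q⟩) : ℂ × ℂ)
      = x • (1, 0) + y • (I, 0) + p • (0, 1) + q • (0, I) := by
    ext1 <;> simp [e]
  rw [hv]
  simp only [map_add, map_smul, real_smul]
  simp only [Prod.smul_mk, Prod.mk_add_mk, smul_zero, real_smul, mul_one, add_zero, zero_add,
    wirt1, wirt1bar, wirt2, wirt2bar, map_add, map_mul, conj_ofReal, conj_I]
  linear_combination ((y : ℂ) * fderiv ℝ f Z (I, 0) + q * fderiv ℝ f Z (0, I)) * I_mul_I

theorem hasWirtAt_rho (A Z : ℂ × ℂ) : HasWirtAt (rho A) Z 1 0 (-conj A.2) 0 := by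
  have := ((HasWirtAt.const (Z := Z) (conj A.1)).add HasWirtAt.fst).sub
    (HasWirtAt.const_mul (conj A.2) HasWirtAt.snd)
  convert! this using 1 <;> simp

theorem hasWirtAt_rhoDiag (Z : ℂ × ℂ) :
    HasWirtAt (fun W => (rhoDiag W : ℂ)) Z 1 1 (-conj Z.2) (-Z.2) := by
  have h := (HasWirtAt.fst (Z := Z).conj_comp.add HasWirtAt.fst).sub
    ((HasWirtAt.snd (Z := Z)).conj_comp.mul HasWirtAt.snd)
  convert! h using 1
  · ext W
    rw [← rho_self]
    rfl
  all_goals simp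

/-- The phase is `(ρ / ρ̄)^k`, written through the principal logarithm, which is smooth where it is
used because `Re ρ > 0` on the domain. This makes the Wirtinger derivatives of the phase accessible
even for half-integral `k`. -/
theorem phaseH_eq_exp (m : ℤ) {A Z : ℂ × ℂ} (h : rho A Z ≠ 0) :
    phaseH m A Z = exp (((m / 2 : ℝ) : ℂ) * (log (rho A Z) - conj (log (rho A Z)))) := by
  have h1 : log (rho A Z) - conj (log (rho A Z)) = 2 * (log (rho A Z) - Real.log ‖rho A Z‖) := by
    apply Complex.ext
    · simp [log_re]
    · simp; ring
  have h2 : (‖rho A Z‖ : ℂ) ≠ 0 := by simpa using h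
  rw [h1, phaseH, ofReal_log (norm_nonneg _)]
  have : ((m / 2 : ℝ) : ℂ) * (2 * (log (rho A Z) - log (‖rho A Z‖ : ℂ)))
      = m * log (rho A Z) - m * log (‖rho A Z‖ : ℂ) := by push_cast; ring
  rw [this, exp_sub, exp_int_mul, exp_int_mul, exp_log h, exp_log h2]

theorem hasWirtAt_phaseH (m : ℤ) {A Z : ℂ × ℂ} (hA : A ∈ siegelDomain) (hZ : Z ∈ siegelDomain) :
    HasWirtAt (phaseH m A) Z (phaseH m A Z * ((m / 2 : ℝ) / rho A Z))
      (-(phaseH m A Z * ((m / 2 : ℝ) / conj (rho A Z))))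
      (-(phaseH m A Z * ((m / 2 : ℝ) * conj A.2 / rho A Z)))
      (phaseH m A Z * ((m / 2 : ℝ) * A.2 / conj (rho A Z))) := by
  have hr := re_rho_pos hA hZ
  have hl := HasWirtAt.comp_hasDerivAt (hasDerivAt_log (Or.inl hr)) (hasWirtAt_rho A Z)
  have h := HasWirtAt.comp_hasDerivAt (Complex.hasDerivAt_exp _)
    (HasWirtAt.const_mul (((m / 2 : ℝ) : ℂ)) (hl.sub hl.conj_comp))
  rw [← phaseH_eq_exp m (rho_ne_zero hA hZ)] at h
  have h' : HasWirtAt (phaseH m A) Z _ _ _ _ := h.congr_of_eventuallyEq (by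
    filter_upwards [isOpen_siegelDomain.mem_nhds hZ] with W hW
    exact phaseH_eq_exp m (rho_ne_zero hA hW))
  convert! h' using 1 <;>
    simp only [map_mul, map_neg, map_inv₀, map_zero, map_one, conj_conj, div_eq_mul_inv] <;> ring

theorem sigmaInv_ofReal (A Z : ℂ × ℂ) :
    (sigmaInv A Z : ℂ) = (rho A Z * conj (rho A Z)) * ((rhoDiag A : ℂ)⁻¹ * (rhoDiag Z : ℂ)⁻¹) := by
  rw [sigmaInv_eq, mul_conj]
  push_cast
  rw [div_eq_mul_inv, mul_inv]

theorem hasWirtAt_sigmaInv {A Z : ℂ × ℂ} (hA : A ∈ siegelDomain) (hZ : Z ∈ siegelDomain) :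
    HasWirtAt (fun W => (sigmaInv A W : ℂ)) Z
      (sigmaInv A Z * (1 / rho A Z - 1 / rhoDiag Z))
      (sigmaInv A Z * (1 / conj (rho A Z) - 1 / rhoDiag Z))
      (sigmaInv A Z * (-conj A.2 / rho A Z + conj Z.2 / rhoDiag Z))
      (sigmaInv A Z * (-A.2 / conj (rho A Z) + Z.2 / rhoDiag Z)) := by
  have hr := rho_ne_zero hA hZ
  have hr' : conj (rho A Z) ≠ 0 := by simpa using hr
  have h1 : (rhoDiag Z : ℂ) ≠ 0 := by exact_mod_cast (show (0 : ℝ) < rhoDiag Z from hZ).ne'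
  have h2 : (rhoDiag A : ℂ) ≠ 0 := by exact_mod_cast (show (0 : ℝ) < rhoDiag A from hA).ne'
  have h := ((hasWirtAt_rho A Z).mul (hasWirtAt_rho A Z).conj_comp).mul
    (((hasWirtAt_rhoDiag Z).inv h1).const_mul (rhoDiag A : ℂ)⁻¹)
  have h' : HasWirtAt (fun W => (sigmaInv A W : ℂ)) Z _ _ _ _ :=
    h.congr_of_eventuallyEq (Eventually.of_forall fun W => sigmaInv_ofReal A W)
  convert! h' using 1 <;> simp [sigmaInv_ofReal] <;> field_simp <;> ring

/-- First derivatives of the product of the phase `phaseH m A` and a function of `sigmaInv A`. -/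
theorem hasWirtAt_radial (m : ℤ) {A Z : ℂ × ℂ} (hA : A ∈ siegelDomain) (hZ : Z ∈ siegelDomain)
    {Ψ : ℝ → ℂ} {Ψ' : ℂ} (hΨ : HasDerivAt Ψ Ψ' (sigmaInv A Z)) :
    HasWirtAt (fun W => phaseH m A W * Ψ (sigmaInv A W)) Z
      (phaseH m A Z * ((m / 2 : ℝ) / rho A Z * Ψ (sigmaInv A Z)
        + Ψ' * (sigmaInv A Z * (1 / rho A Z - 1 / rhoDiag Z))))
      (phaseH m A Z * (-((m / 2 : ℝ) / conj (rho A Z)) * Ψ (sigmaInv A Z)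
        + Ψ' * (sigmaInv A Z * (1 / conj (rho A Z) - 1 / rhoDiag Z))))
      (phaseH m A Z * (-((m / 2 : ℝ) * conj A.2 / rho A Z) * Ψ (sigmaInv A Z)
        + Ψ' * (sigmaInv A Z * (-conj A.2 / rho A Z + conj Z.2 / rhoDiag Z))))
      (phaseH m A Z * ((m / 2 : ℝ) * A.2 / conj (rho A Z) * Ψ (sigmaInv A Z)
        + Ψ' * (sigmaInv A Z * (-A.2 / conj (rho A Z) + Z.2 / rhoDiag Z)))) := by
  have h := (hasWirtAt_phaseH m hA hZ).mul ((hasWirtAt_sigmaInv hA hZ).comp_ofReal hΨ)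
  convert! h using 1 <;> ring

/-- The formal adjoint of `weightLaplacian k`, that is `weightLaplacian (-k)`, with the derivatives
taken in the other order. -/
noncomputable def adjLaplacian (k : ℝ) (f : ℂ × ℂ → ℂ) (Z : ℂ × ℂ) : ℂ :=
  (rhoDiag Z : ℂ) *
    ((Z.1 + conj Z.1) * wirt1bar (wirt1 f) Z
      + wirt2bar (wirt2 f) Z
      + Z.2 * wirt1bar (wirt2 f) Z
      + conj Z.2 * wirt2bar (wirt1 f) Z
      + (k : ℂ) * (wirt1 f Z - wirt1bar f Z))

/-- Separation of variables. The derivatives of the phase and of `σ` are rational in `ρ(A, Z)`, its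
conjugate, `ρ(Z)` and the second coordinates; the first-order term of weight `k` combines with the
derivatives of the phase so that only functions of `σ` remain. -/
theorem adjLaplacian_radial (m : ℤ) {A Z : ℂ × ℂ} (hA : A ∈ siegelDomain) (hZ : Z ∈ siegelDomain)
    {Ψ Ψ₁ Ψ₂ : ℝ → ℂ} (h₁ : ∀ t > 0, HasDerivAt Ψ (Ψ₁ t) t)
    (h₂ : ∀ t > 0, HasDerivAt Ψ₁ (Ψ₂ t) t) :
    adjLaplacian (m / 2 : ℝ) (fun W => phaseH m A W * Ψ (sigmaInv A W)) Z
      = phaseH m A Z * (sigmaInv A Z * (sigmaInv A Z - 1) * Ψ₂ (sigmaInv A Z)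
        + (3 * sigmaInv A Z - 1) * Ψ₁ (sigmaInv A Z)
        + ((m / 2 : ℝ) : ℂ) ^ 2 / sigmaInv A Z * Ψ (sigmaInv A Z)) := by
  have hpos : ∀ {W}, W ∈ siegelDomain → 0 < sigmaInv A W := fun hW =>
    lt_of_lt_of_le one_pos (one_le_sigmaInv hA hW)
  set k : ℂ := ((m / 2 : ℝ) : ℂ) with hk
  -- The first derivatives are again phases times radial functions: `Φ` multiplies `1/ρ(A, Z)` and
  -- `Θ` multiplies `1/ρ(Z)`. Hence `hasWirtAt_radial` can be applied a second time.
  set Φ : ℝ → ℂ := fun t => k * Ψ t + t * Ψ₁ t with hΦ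
  set Θ : ℝ → ℂ := fun t => t * Ψ₁ t with hΘ
  have hΘ' : ∀ t > 0, HasDerivAt Θ (Ψ₁ t + t * Ψ₂ t) t := fun t ht => by
    have h := (hasDerivAt_id t).ofReal_comp.mul (h₂ t ht)
    simp only [id, ofReal_one, one_mul] at h
    exact h
  have hΦ' : ∀ t > 0, HasDerivAt Φ (k * Ψ₁ t + (Ψ₁ t + t * Ψ₂ t)) t := fun t ht =>
    ((h₁ t ht).const_mul k).add (hΘ' t ht)
  have hf : ∀ W ∈ siegelDomain, HasWirtAt (fun W => phaseH m A W * Ψ (sigmaInv A W)) W _ _ _ _ :=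
    fun W hW => hasWirtAt_radial m hA hW (h₁ _ (hpos hW))
  have ne1 : ∀ {W}, W ∈ siegelDomain → rho A W ≠ 0 := fun hW => rho_ne_zero hA hW
  have ne2 : ∀ {W}, W ∈ siegelDomain → (rhoDiag W : ℂ) ≠ 0 := fun {W} hW => by
    exact_mod_cast (show (0 : ℝ) < rhoDiag W from hW).ne'
  have e1 : wirt1 (fun W => phaseH m A W * Ψ (sigmaInv A W)) =ᶠ[𝓝 Z] fun W =>
      (rho A W)⁻¹ * (phaseH m A W * Φ (sigmaInv A W))
        - (rhoDiag W : ℂ)⁻¹ * (phaseH m A W * Θ (sigmaInv A W)) := by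
    filter_upwards [isOpen_siegelDomain.mem_nhds hZ] with W hW
    rw [(hf W hW).wirt1_eq]
    simp only [hΦ, hΘ]
    ring
  have e2 : wirt2 (fun W => phaseH m A W * Ψ (sigmaInv A W)) =ᶠ[𝓝 Z] fun W =>
      (-conj A.2) * ((rho A W)⁻¹ * (phaseH m A W * Φ (sigmaInv A W)))
        + conj W.2 * ((rhoDiag W : ℂ)⁻¹ * (phaseH m A W * Θ (sigmaInv A W))) := by
    filter_upwards [isOpen_siegelDomain.mem_nhds hZ] with W hW
    rw [(hf W hW).wirt2_eq]
    simp only [hΦ, hΘ]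
    ring
  have dU := ((hasWirtAt_rho A Z).inv (ne1 hZ)).mul
    (hasWirtAt_radial m hA hZ (hΦ' _ (hpos hZ)))
  have dV := ((hasWirtAt_rhoDiag Z).inv (ne2 hZ)).mul
    (hasWirtAt_radial m hA hZ (hΘ' _ (hpos hZ)))
  have d1 := (dU.sub dV).congr_of_eventuallyEq e1
  have d2 := ((dU.const_mul (-conj A.2)).add
    (HasWirtAt.snd.conj_comp.mul dV)).congr_of_eventuallyEq e2
  rw [adjLaplacian, d1.wirt1bar_eq, d1.wirt2bar_eq, d2.wirt1bar_eq, d2.wirt2bar_eq,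
    (hf Z hZ).wirt1_eq, (hf Z hZ).wirt1bar_eq]
  have hσ := sigmaInv_ofReal A Z
  have hq : (rhoDiag A : ℂ) = conj A.1 + A.1 - conj A.2 * A.2 := by rw [← rho_self, rho]
  have hp : (rhoDiag Z : ℂ) = conj Z.1 + Z.1 - conj Z.2 * Z.2 := by rw [← rho_self, rho]
  -- The identity `2 Re ρ(A, Z) = ρ(A) + ρ(Z) + |Z₂ - A₂|²`, recorded before the quantities in it
  -- are replaced by independent variables.
  have hX : rho A Z + conj (rho A Z) - rhoDiag A
      = rhoDiag Z + (conj Z.2 - conj A.2) * (Z.2 - A.2) := by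
    rw [hq, hp]; simp [rho]; ring
  have n1 := ne1 hZ
  have n1' : conj (rho A Z) ≠ 0 := by simpa using n1
  have n2 := ne2 hZ
  have n3 := ne2 hA
  have n4 : (sigmaInv A Z : ℂ) ≠ 0 := by exact_mod_cast (hpos hZ).ne'
  simp only [hΦ, hΘ, ← hk]
  generalize phaseH m A Z = H
  generalize Ψ (sigmaInv A Z) = x
  generalize Ψ₁ (sigmaInv A Z) = x₁
  generalize Ψ₂ (sigmaInv A Z) = x₂
  generalize (sigmaInv A Z : ℂ) = S at *
  generalize conj (rho A Z) = rb at *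
  generalize rho A Z = r at *
  simp only [map_zero, map_one]
  have hs : Z.1 + conj Z.1 = rhoDiag Z + conj Z.2 * Z.2 := by rw [hp]; ring
  rw [hs]
  generalize (rhoDiag Z : ℂ) = p at *
  generalize (rhoDiag A : ℂ) = q at *
  generalize conj Z.2 = wb at *
  generalize Z.2 = w at *
  generalize conj A.2 = Bb at *
  generalize A.2 = B at *
  clear hp hq hs dU dV d1 d2 e1 e2 hf ne1 ne2 h₁ h₂ hΦ hΘ hΦ' hΘ' Φ Θ hpos
  clear_value k
  subst hσ
  -- With `σ` already substituted, `hX` is the one relation still needed; once this multiple of it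
  -- is subtracted, a purely rational identity is left.
  linear_combination (norm := skip) -(H * p * (r * rb)⁻¹ * (-k * (k * x + r * rb * (q⁻¹ * p⁻¹) * x₁)
    + (k * x₁ + (x₁ + r * rb * (q⁻¹ * p⁻¹) * x₂)) * (r * rb * (q⁻¹ * p⁻¹)))) * hX
  field_simp
  ring

/-! ### Regularity, integration against the invariant measure, and Green's formula. -/

theorem contDiff_mul_of_tsupport_subset {n : WithTop ℕ∞} {f G : ℂ × ℂ → ℂ} {U : Set (ℂ × ℂ)}
    (hU : IsOpen U) (hf : ContDiff ℝ n f) (hfU : tsupport f ⊆ U) (hG : ContDiffOn ℝ n G U) :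
    ContDiff ℝ n fun Z => f Z * G Z := by
  rw [contDiff_iff_contDiffAt]
  intro Z
  by_cases hZ : Z ∈ tsupport f
  · exact hf.contDiffAt.mul (hG.contDiffAt (hU.mem_nhds (hfU hZ)))
  · refine (contDiffAt_const (c := (0 : ℂ))).congr_of_eventuallyEq ?_
    filter_upwards [(isClosed_tsupport f).isOpen_compl.mem_nhds hZ] with W hW
    simp [image_eq_zero_of_notMem_tsupport hW]

section Regularity

variable {n m : WithTop ℕ∞} {f : ℂ × ℂ → ℂ} {U : Set (ℂ × ℂ)}

theorem ContDiffOn.fderiv_apply_const (hf : ContDiffOn ℝ n f U) (hU : IsOpen U)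
    (hmn : m + 1 ≤ n) (v : ℂ × ℂ) : ContDiffOn ℝ m (fun Z => fderiv ℝ f Z v) U :=
  (hf.fderiv_of_isOpen hU hmn).clm_apply contDiffOn_const

theorem ContDiffOn.wirt1 (hf : ContDiffOn ℝ n f U) (hU : IsOpen U) (hmn : m + 1 ≤ n) :
    ContDiffOn ℝ m (wirt1 f) U :=
  ((hf.fderiv_apply_const hU hmn _).sub
    (contDiffOn_const.mul (hf.fderiv_apply_const hU hmn _))).div_const 2

theorem ContDiffOn.wirt1bar (hf : ContDiffOn ℝ n f U) (hU : IsOpen U) (hmn : m + 1 ≤ n) :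
    ContDiffOn ℝ m (wirt1bar f) U :=
  ((hf.fderiv_apply_const hU hmn _).add
    (contDiffOn_const.mul (hf.fderiv_apply_const hU hmn _))).div_const 2

theorem ContDiffOn.wirt2 (hf : ContDiffOn ℝ n f U) (hU : IsOpen U) (hmn : m + 1 ≤ n) :
    ContDiffOn ℝ m (wirt2 f) U :=
  ((hf.fderiv_apply_const hU hmn _).sub
    (contDiffOn_const.mul (hf.fderiv_apply_const hU hmn _))).div_const 2

theorem ContDiffOn.wirt2bar (hf : ContDiffOn ℝ n f U) (hU : IsOpen U) (hmn : m + 1 ≤ n) :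
    ContDiffOn ℝ m (wirt2bar f) U :=
  ((hf.fderiv_apply_const hU hmn _).add
    (contDiffOn_const.mul (hf.fderiv_apply_const hU hmn _))).div_const 2

theorem fderiv_eq_zero_of_notMem_tsupport {Z : ℂ × ℂ} (hZ : Z ∉ tsupport f) :
    fderiv ℝ f Z = 0 :=
  image_eq_zero_of_notMem_tsupport fun h => hZ (tsupport_fderiv_subset ℝ h)

theorem tsupport_wirt1_subset (f : ℂ × ℂ → ℂ) : tsupport (wirt1 f) ⊆ tsupport f :=
  closure_minimal (fun Z hZ => by
    by_contra h
    exact hZ (by simp [_root_.wirt1, fderiv_eq_zero_of_notMem_tsupport h])) (isClosed_tsupport f)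

theorem tsupport_wirt2_subset (f : ℂ × ℂ → ℂ) : tsupport (wirt2 f) ⊆ tsupport f :=
  closure_minimal (fun Z hZ => by
    by_contra h
    exact hZ (by simp [_root_.wirt2, fderiv_eq_zero_of_notMem_tsupport h])) (isClosed_tsupport f)

end Regularity

section VanishingIntegrals

instance instIsAddHaarMeasureComplexProd : (volume : Measure (ℂ × ℂ)).IsAddHaarMeasure := by
  rw [Measure.volume_eq_prod]; infer_instance

variable {F : ℂ × ℂ → ℂ}

theorem integrable_fderiv_apply (hF : ContDiff ℝ 1 F) (hc : HasCompactSupport F) (v : ℂ × ℂ) :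
    Integrable fun Z => fderiv ℝ F Z v :=
  ((hF.continuous_fderiv one_ne_zero).clm_apply continuous_const).integrable_of_hasCompactSupport
    (hc.fderiv_apply (𝕜 := ℝ) v)

theorem integral_fderiv_apply_eq_zero (hF : ContDiff ℝ 1 F) (hc : HasCompactSupport F)
    (v : ℂ × ℂ) : ∫ Z, fderiv ℝ F Z v = 0 := by
  -- Integration by parts against the constant `1`; only the products have to be integrable.
  have h := integral_mul_fderiv_eq_neg_fderiv_mul_of_integrable (μ := (volume : Measure (ℂ × ℂ)))
    (f := fun _ => (1 : ℂ)) (g := F) (v := v) (by simp)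
    (by simpa using integrable_fderiv_apply hF hc v)
    (by simpa using hF.continuous.integrable_of_hasCompactSupport hc)
    (fun _ _ => differentiableAt_const _)
    (fun _ _ => hF.differentiable one_ne_zero _)
  simpa using h

theorem integrable_wirt (hF : ContDiff ℝ 1 F) (hc : HasCompactSupport F) :
    Integrable (wirt1 F) ∧ Integrable (wirt1bar F) ∧ Integrable (wirt2 F)
      ∧ Integrable (wirt2bar F) := by
  have h := integrable_fderiv_apply hF hc
  exact ⟨((h _).sub ((h _).const_mul I)).div_const 2, ((h _).add ((h _).const_mul I)).div_const 2,
    ((h _).sub ((h _).const_mul I)).div_const 2, ((h _).add ((h _).const_mul I)).div_const 2⟩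

theorem integral_wirt (hF : ContDiff ℝ 1 F) (hc : HasCompactSupport F) :
    ∫ Z, wirt1 F Z = 0 ∧ ∫ Z, wirt1bar F Z = 0 ∧ ∫ Z, wirt2 F Z = 0 ∧ ∫ Z, wirt2bar F Z = 0 := by
  have h := integrable_fderiv_apply hF hc
  have h0 := integral_fderiv_apply_eq_zero hF hc
  refine ⟨?_, ?_, ?_, ?_⟩
  · simp only [wirt1]
    rw [integral_div, integral_sub (h _) ((h _).const_mul I), integral_const_mul, h0, h0]; simp
  · simp only [wirt1bar]
    rw [integral_div, integral_add (h _) ((h _).const_mul I), integral_const_mul, h0, h0]; simp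
  · simp only [wirt2]
    rw [integral_div, integral_sub (h _) ((h _).const_mul I), integral_const_mul, h0, h0]; simp
  · simp only [wirt2bar]
    rw [integral_div, integral_add (h _) ((h _).const_mul I), integral_const_mul, h0, h0]; simp

end VanishingIntegrals

theorem measurable_siegelDensity :
    Measurable fun Z : siegelDomain => ENNReal.ofReal (4 / rhoDiag Z ^ 3) := by
  have := continuous_rhoDiag.measurable
  fun_prop

theorem lintegral_siegelMeasure (h : ℂ × ℂ → ENNReal) :
    ∫⁻ Z : siegelDomain, h Z ∂siegelMeasure
      = ∫⁻ Z in siegelDomain, ENNReal.ofReal (4 / rhoDiag Z ^ 3) * h Z := by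
  rw [siegelMeasure, lintegral_withDensity_eq_lintegral_mul_non_measurable₀ _
    measurable_siegelDensity.aemeasurable (by simp),
    ← lintegral_subtype_comap isOpen_siegelDomain.measurableSet]
  rfl

theorem integral_siegelMeasure (h : ℂ × ℂ → ℂ) :
    ∫ Z : siegelDomain, h Z ∂siegelMeasure
      = ∫ Z in siegelDomain, (4 / (rhoDiag Z : ℂ) ^ 3) * h Z := by
  rw [siegelMeasure, integral_withDensity_eq_integral_toReal_smul measurable_siegelDensity (by simp),
    ← integral_subtype_comap isOpen_siegelDomain.measurableSet]
  congr 1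
  ext Z
  have := rhoDiag_pos Z
  rw [ENNReal.toReal_ofReal (by positivity), real_smul]
  push_cast
  rfl

theorem integrable_siegelMeasure_iff (h : ℂ × ℂ → ℂ) :
    Integrable (fun Z : siegelDomain => h Z) siegelMeasure
      ↔ IntegrableOn (fun Z => (4 / (rhoDiag Z : ℂ) ^ 3) * h Z) siegelDomain := by
  have e : (fun x : siegelDomain => (ENNReal.ofReal (4 / rhoDiag x ^ 3)).toReal • h x)
      = (fun Z => (4 / (rhoDiag Z : ℂ) ^ 3) * h Z) ∘ ((↑) : siegelDomain → ℂ × ℂ) := by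
    ext Z
    have := rhoDiag_pos Z
    rw [ENNReal.toReal_ofReal (by positivity), real_smul]
    push_cast
    rfl
  rw [siegelMeasure, integrable_withDensity_iff_integrable_smul' measurable_siegelDensity (by simp),
    e, ← integrableOn_iff_comap_subtypeVal isOpen_siegelDomain.measurableSet]

theorem tsupport_mul_subset_left' {f G : ℂ × ℂ → ℂ} :
    tsupport (fun Z => f Z * G Z) ⊆ tsupport f := tsupport_mul_subset_left

theorem wirt_eq_zero_of_notMem_tsupport {F : ℂ × ℂ → ℂ} {Z : ℂ × ℂ} (hZ : Z ∉ tsupport F) :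
    wirt1 F Z = 0 ∧ wirt1bar F Z = 0 ∧ wirt2 F Z = 0 ∧ wirt2bar F Z = 0 := by
  simp [wirt1, wirt1bar, wirt2, wirt2bar, fderiv_eq_zero_of_notMem_tsupport hZ]

theorem contDiff_rhoDiag {n : WithTop ℕ∞} : ContDiff ℝ n fun Z => (rhoDiag Z : ℂ) := by
  have h : (fun Z : ℂ × ℂ => (rhoDiag Z : ℂ)) = fun Z => conjCLE Z.1 + Z.1 - conjCLE Z.2 * Z.2 := by
    ext Z; rw [← rho_self]; rfl
  rw [h]
  exact ((conjCLE.contDiff.comp contDiff_fst).add contDiff_fst).sub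
    ((conjCLE.contDiff.comp contDiff_snd).mul contDiff_snd)

theorem contDiffOn_inv_rhoDiag {n : WithTop ℕ∞} :
    ContDiffOn ℝ n (fun Z => (rhoDiag Z : ℂ)⁻¹) siegelDomain :=
  contDiff_rhoDiag.contDiffOn.inv fun Z hZ => by
    exact_mod_cast (show (0 : ℝ) < rhoDiag Z from hZ).ne'

theorem contDiff_conj_fst {n : WithTop ℕ∞} : ContDiff ℝ n fun Z : ℂ × ℂ => conj Z.1 :=
  conjCLE.contDiff.comp contDiff_fst

theorem contDiff_conj_snd {n : WithTop ℕ∞} : ContDiff ℝ n fun Z : ℂ × ℂ => conj Z.2 :=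
  conjCLE.contDiff.comp contDiff_snd

theorem continuousOn_weightLaplacian (k : ℝ) {g : ℂ × ℂ → ℂ} (hg : ContDiffOn ℝ 2 g siegelDomain) :
    ContinuousOn (weightLaplacian k g) siegelDomain := by
  have o := isOpen_siegelDomain
  have h1 : ContDiffOn ℝ 1 (wirt1 g) siegelDomain := hg.wirt1 o (by norm_num)
  have h1b : ContDiffOn ℝ 1 (wirt1bar g) siegelDomain := hg.wirt1bar o (by norm_num)
  have h2b : ContDiffOn ℝ 1 (wirt2bar g) siegelDomain := hg.wirt2bar o (by norm_num)
  have a1 : ContDiffOn ℝ 0 (wirt1 (wirt1bar g)) siegelDomain := h1b.wirt1 o (by norm_num)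
  have a2 : ContDiffOn ℝ 0 (wirt2 (wirt2bar g)) siegelDomain := h2b.wirt2 o (by norm_num)
  have a3 : ContDiffOn ℝ 0 (wirt2 (wirt1bar g)) siegelDomain := h1b.wirt2 o (by norm_num)
  have a4 : ContDiffOn ℝ 0 (wirt1 (wirt2bar g)) siegelDomain := h2b.wirt1 o (by norm_num)
  unfold weightLaplacian
  exact (continuous_ofReal.comp continuous_rhoDiag).continuousOn.mul
    ((((((continuous_fst.add (continuous_conj.comp continuous_fst)).continuousOn.mul
      a1.continuousOn).add a2.continuousOn).add (continuous_snd.continuousOn.mul a3.continuousOn)).add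
      ((continuous_conj.comp continuous_snd).continuousOn.mul a4.continuousOn)).sub
      (continuousOn_const.mul (h1.continuousOn.sub h1b.continuousOn)))

section IntegrationByParts

variable {f g : ℂ × ℂ → ℂ}

/-- The measure contributes `ρ⁻³` and the operator `ρ`, so `ρ⁻²` stands in front of the second-order
expressions. With this weight the integrand is a sum of Wirtinger derivatives of C¹ functions with
compact support in the domain, each of which integrates to zero. -/
theorem integral_sub_adjLaplacian (k : ℝ) (hf : ContDiff ℝ 2 f) (hc : HasCompactSupport f)
    (hs : tsupport f ⊆ siegelDomain) (hg : ContDiffOn ℝ 2 g siegelDomain) :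
    ∫ Z : siegelDomain, (f Z * weightLaplacian k g Z - adjLaplacian k f Z * g Z) ∂siegelMeasure
      = 0 := by
  have o := isOpen_siegelDomain
  have hf1 : ContDiff ℝ 1 f := hf.of_le (by norm_num)
  have hfo : ContDiffOn ℝ 2 f Set.univ := hf.contDiffOn
  have f1 : ContDiff ℝ 1 (wirt1 f) :=
    contDiffOn_univ.1 (hfo.wirt1 isOpen_univ (by norm_num))
  have f2 : ContDiff ℝ 1 (wirt2 f) :=
    contDiffOn_univ.1 (hfo.wirt2 isOpen_univ (by norm_num))
  have c1 : HasCompactSupport (wirt1 f) :=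
    hc.of_isClosed_subset (isClosed_tsupport _) (tsupport_wirt1_subset f)
  have c2 : HasCompactSupport (wirt2 f) :=
    hc.of_isClosed_subset (isClosed_tsupport _) (tsupport_wirt2_subset f)
  have s1 := (tsupport_wirt1_subset f).trans hs
  have s2 := (tsupport_wirt2_subset f).trans hs
  have hg1 : ContDiffOn ℝ 1 g siegelDomain := hg.of_le (by norm_num)
  have g1b : ContDiffOn ℝ 1 (wirt1bar g) siegelDomain := hg.wirt1bar o (by norm_num)
  have g2b : ContDiffOn ℝ 1 (wirt2bar g) siegelDomain := hg.wirt2bar o (by norm_num)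
  have hD := contDiffOn_inv_rhoDiag (n := 1)
  have hz1 : ContDiffOn ℝ 1 (fun Z : ℂ × ℂ => Z.1 + conj Z.1) siegelDomain :=
    (contDiff_fst.add contDiff_conj_fst).contDiffOn
  have hz2 : ContDiffOn ℝ 1 (fun Z : ℂ × ℂ => Z.2) siegelDomain := contDiff_snd.contDiffOn
  have hz2b : ContDiffOn ℝ 1 (fun Z : ℂ × ℂ => conj Z.2) siegelDomain :=
    contDiff_conj_snd.contDiffOn
  set D : ℂ × ℂ → ℂ := fun Z => (rhoDiag Z : ℂ)⁻¹ with hDdef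
  -- the components of the vector field whose divergence is the integrand
  have key : ∀ {a G : ℂ × ℂ → ℂ}, ContDiff ℝ 1 a → HasCompactSupport a → tsupport a ⊆ siegelDomain →
      ContDiffOn ℝ 1 G siegelDomain →
      ContDiff ℝ 1 (fun Z => a Z * G Z) ∧ HasCompactSupport (fun Z => a Z * G Z)
        ∧ tsupport (fun Z => a Z * G Z) ⊆ siegelDomain := fun ha hac has hG =>
    ⟨contDiff_mul_of_tsupport_subset o ha has hG, hac.mul_right,
      tsupport_mul_subset_left'.trans has⟩
  set X1 : ℂ × ℂ → ℂ := fun Z => f Z *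
    (D Z * D Z * ((Z.1 + conj Z.1) * wirt1bar g Z + conj Z.2 * wirt2bar g Z)) with hX1
  set X2 : ℂ × ℂ → ℂ := fun Z => f Z * (D Z * D Z * (wirt2bar g Z + Z.2 * wirt1bar g Z)) with hX2
  set Y1 : ℂ × ℂ → ℂ := fun Z => wirt1 f Z * (D Z * D Z * (g Z * (Z.1 + conj Z.1))) with hY1
  set Y2 : ℂ × ℂ → ℂ := fun Z => wirt2 f Z * (D Z * D Z * (g Z * Z.2)) with hY2
  set Y3 : ℂ × ℂ → ℂ := fun Z => wirt2 f Z * (D Z * D Z * g Z) with hY3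
  set Y4 : ℂ × ℂ → ℂ := fun Z => wirt1 f Z * (D Z * D Z * (g Z * conj Z.2)) with hY4
  set W : ℂ × ℂ → ℂ := fun Z => f Z * (D Z * D Z * g Z) with hW
  obtain ⟨x1, x1c, x1s⟩ := key hf1 hc hs
    ((hD.mul hD).mul ((hz1.mul g1b).add (hz2b.mul g2b)))
  obtain ⟨x2, x2c, x2s⟩ := key hf1 hc hs ((hD.mul hD).mul (g2b.add (hz2.mul g1b)))
  obtain ⟨y1, y1c, y1s⟩ := key f1 c1 s1 ((hD.mul hD).mul (hg1.mul hz1))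
  obtain ⟨y2, y2c, y2s⟩ := key f2 c2 s2 ((hD.mul hD).mul (hg1.mul hz2))
  obtain ⟨y3, y3c, y3s⟩ := key f2 c2 s2 ((hD.mul hD).mul hg1)
  obtain ⟨y4, y4c, y4s⟩ := key f1 c1 s1 ((hD.mul hD).mul (hg1.mul hz2b))
  obtain ⟨w, wc, ws⟩ := key hf1 hc hs ((hD.mul hD).mul hg1)
  have pointwise : ∀ Z ∈ siegelDomain, (4 / (rhoDiag Z : ℂ) ^ 3) *
      (f Z * weightLaplacian k g Z - adjLaplacian k f Z * g Z)
      = 4 * (wirt1 X1 Z + wirt2 X2 Z - wirt1bar Y1 Z - wirt1bar Y2 Z - wirt2bar Y3 Z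
        - wirt2bar Y4 Z - k * wirt1 W Z + k * wirt1bar W Z) := by
    intro Z hZ
    have hp : (rhoDiag Z : ℂ) ≠ 0 := by exact_mod_cast (show (0 : ℝ) < rhoDiag Z from hZ).ne'
    have at1 : ∀ {h : ℂ × ℂ → ℂ}, ContDiffOn ℝ 1 h siegelDomain →
        HasWirtAt h Z (wirt1 h Z) (wirt1bar h Z) (wirt2 h Z) (wirt2bar h Z) := fun hh =>
      ((hh.contDiffAt (o.mem_nhds hZ)).differentiableAt one_ne_zero).hasWirtAt
    have dD : HasWirtAt D Z _ _ _ _ := (hasWirtAt_rhoDiag Z).inv hp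
    have dDD := dD.mul dD
    have df := at1 hf1.contDiffOn
    have df1 := at1 f1.contDiffOn
    have df2 := at1 f2.contDiffOn
    have dg := at1 hg1
    have dg1 := at1 g1b
    have dg2 := at1 g2b
    have dz1 := (HasWirtAt.fst (Z := Z)).add (HasWirtAt.fst (Z := Z)).conj_comp
    have dz2 := HasWirtAt.snd (Z := Z)
    have dz2b := (HasWirtAt.snd (Z := Z)).conj_comp
    have e1 := (df.mul (dDD.mul ((dz1.mul dg1).add (dz2b.mul dg2)))).wirt1_eq
    have e2 := (df.mul (dDD.mul (dg2.add (dz2.mul dg1)))).wirt2_eq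
    have e3 := (df1.mul (dDD.mul (dg.mul dz1))).wirt1bar_eq
    have e4 := (df2.mul (dDD.mul (dg.mul dz2))).wirt1bar_eq
    have e5 := (df2.mul (dDD.mul dg)).wirt2bar_eq
    have e6 := (df1.mul (dDD.mul (dg.mul dz2b))).wirt2bar_eq
    have e7 := (df.mul (dDD.mul dg)).wirt1_eq
    have e8 := (df.mul (dDD.mul dg)).wirt1bar_eq
    simp only [hX1, hX2, hY1, hY2, hY3, hY4, hW]
    rw [e1, e2, e3, e4, e5, e6, e7, e8]
    simp only [weightLaplacian, adjLaplacian, map_zero, map_one, hDdef]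
    have hs : Z.1 + conj Z.1 = rhoDiag Z + conj Z.2 * Z.2 := by rw [← rho_self, rho]; ring
    rw [hs]
    field_simp
    ring
  -- The inverse of `ρ` has no meaning off the domain, but all supports lie inside, so the integral
  -- may be extended to `ℂ²`.
  have zero_off : ∀ Z ∉ siegelDomain, (4 : ℂ) * (wirt1 X1 Z + wirt2 X2 Z - wirt1bar Y1 Z
      - wirt1bar Y2 Z - wirt2bar Y3 Z - wirt2bar Y4 Z - k * wirt1 W Z + k * wirt1bar W Z) = 0 := by
    intro Z hZ
    have off : ∀ {F : ℂ × ℂ → ℂ}, tsupport F ⊆ siegelDomain →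
        wirt1 F Z = 0 ∧ wirt1bar F Z = 0 ∧ wirt2 F Z = 0 ∧ wirt2bar F Z = 0 := fun hF =>
      wirt_eq_zero_of_notMem_tsupport fun h => hZ (hF h)
    rw [(off x1s).1, (off x2s).2.2.1, (off y1s).2.1, (off y2s).2.1, (off y3s).2.2.2,
      (off y4s).2.2.2, (off ws).1, (off ws).2.1]
    simp
  rw [integral_siegelMeasure fun Z => f Z * weightLaplacian k g Z - adjLaplacian k f Z * g Z,
    setIntegral_congr_fun o.measurableSet pointwise,
    setIntegral_eq_integral_of_forall_compl_eq_zero zero_off, integral_const_mul]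
  have add0 : ∀ {u v : ℂ × ℂ → ℂ}, (Integrable u ∧ ∫ Z, u Z = 0) → (Integrable v ∧ ∫ Z, v Z = 0) →
      (Integrable fun Z => u Z + v Z) ∧ ∫ Z, (u Z + v Z) = 0 := fun hu hv =>
    ⟨hu.1.add hv.1, by rw [integral_add hu.1 hv.1, hu.2, hv.2, add_zero]⟩
  have sub0 : ∀ {u v : ℂ × ℂ → ℂ}, (Integrable u ∧ ∫ Z, u Z = 0) → (Integrable v ∧ ∫ Z, v Z = 0) →
      (Integrable fun Z => u Z - v Z) ∧ ∫ Z, (u Z - v Z) = 0 := fun hu hv =>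
    ⟨hu.1.sub hv.1, by rw [integral_sub hu.1 hv.1, hu.2, hv.2, sub_zero]⟩
  have mul0 : ∀ {u : ℂ × ℂ → ℂ}, (Integrable u ∧ ∫ Z, u Z = 0) →
      (Integrable fun Z => (k : ℂ) * u Z) ∧ ∫ Z, (k : ℂ) * u Z = 0 := fun hu =>
    ⟨hu.1.const_mul _, by rw [integral_const_mul, hu.2, mul_zero]⟩
  have i1 := And.intro (integrable_wirt x1 x1c).1 (integral_wirt x1 x1c).1
  have i2 := And.intro (integrable_wirt x2 x2c).2.2.1 (integral_wirt x2 x2c).2.2.1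
  have i3 := And.intro (integrable_wirt y1 y1c).2.1 (integral_wirt y1 y1c).2.1
  have i4 := And.intro (integrable_wirt y2 y2c).2.1 (integral_wirt y2 y2c).2.1
  have i5 := And.intro (integrable_wirt y3 y3c).2.2.2 (integral_wirt y3 y3c).2.2.2
  have i6 := And.intro (integrable_wirt y4 y4c).2.2.2 (integral_wirt y4 y4c).2.2.2
  have i7 := mul0 (And.intro (integrable_wirt w wc).1 (integral_wirt w wc).1)
  have i8 := mul0 (And.intro (integrable_wirt w wc).2.1 (integral_wirt w wc).2.1)
  rw [(add0 (sub0 (sub0 (sub0 (sub0 (sub0 (add0 i1 i2) i3) i4) i5) i6) i7) i8).2, mul_zero]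

theorem integrable_siegelMeasure_of_compact_left {h : ℂ × ℂ → ℂ} (hf : Continuous f)
    (hc : HasCompactSupport f) (hs : tsupport f ⊆ siegelDomain)
    (hh : ContinuousOn h siegelDomain) :
    Integrable (fun Z : siegelDomain => f Z * h Z) siegelMeasure := by
  rw [integrable_siegelMeasure_iff fun Z => f Z * h Z]
  have hD := contDiffOn_inv_rhoDiag (n := 0)
  have hG : ContDiffOn ℝ 0 (fun Z => 4 * (rhoDiag Z : ℂ)⁻¹ ^ 3 * h Z) siegelDomain :=
    (contDiffOn_const.mul (hD.pow 3)).mul (contDiffOn_zero.2 hh)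
  have h0 := contDiff_mul_of_tsupport_subset isOpen_siegelDomain (contDiff_zero.2 hf) hs hG
  have h1 := h0.continuous.integrable_of_hasCompactSupport (μ := volume) hc.mul_right
  convert! h1.integrableOn using 1
  ext Z
  simp only [div_eq_mul_inv, inv_pow]
  ring

theorem hasCompactSupport_adjLaplacian (k : ℝ) (hf : ContDiff ℝ 2 f) (hc : HasCompactSupport f) :
    Continuous (adjLaplacian k f) ∧ HasCompactSupport (adjLaplacian k f)
      ∧ tsupport (adjLaplacian k f) ⊆ tsupport f := by
  have hfo : ContDiffOn ℝ 2 f Set.univ := hf.contDiffOn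
  have h1 : ContDiffOn ℝ 1 (wirt1 f) Set.univ := hfo.wirt1 isOpen_univ (by norm_num)
  have h2 : ContDiffOn ℝ 1 (wirt2 f) Set.univ := hfo.wirt2 isOpen_univ (by norm_num)
  have h1b : ContDiffOn ℝ 1 (wirt1bar f) Set.univ := hfo.wirt1bar isOpen_univ (by norm_num)
  have a1 : ContDiffOn ℝ 0 (wirt1bar (wirt1 f)) Set.univ := h1.wirt1bar isOpen_univ (by norm_num)
  have a2 : ContDiffOn ℝ 0 (wirt2bar (wirt2 f)) Set.univ := h2.wirt2bar isOpen_univ (by norm_num)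
  have a3 : ContDiffOn ℝ 0 (wirt1bar (wirt2 f)) Set.univ := h2.wirt1bar isOpen_univ (by norm_num)
  have a4 : ContDiffOn ℝ 0 (wirt2bar (wirt1 f)) Set.univ := h1.wirt2bar isOpen_univ (by norm_num)
  have sub : tsupport (adjLaplacian k f) ⊆ tsupport f := by
    refine closure_minimal (fun Z hZ => ?_) (isClosed_tsupport f)
    by_contra h
    apply hZ
    have e := wirt_eq_zero_of_notMem_tsupport h
    have e1 := wirt_eq_zero_of_notMem_tsupport fun h' => h (tsupport_wirt1_subset f h')
    have e2 := wirt_eq_zero_of_notMem_tsupport fun h' => h (tsupport_wirt2_subset f h')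
    simp [adjLaplacian, e.1, e.2.1, e1.2.1, e1.2.2.2, e2.2.1, e2.2.2.2]
  refine ⟨?_, hc.of_isClosed_subset (isClosed_tsupport _) sub, sub⟩
  unfold adjLaplacian
  have c {h : ℂ × ℂ → ℂ} {n : WithTop ℕ∞} (hh : ContDiffOn ℝ n h Set.univ) : Continuous h :=
    continuousOn_univ.1 hh.continuousOn
  exact (continuous_ofReal.comp continuous_rhoDiag).mul
    ((((((continuous_fst.add (continuous_conj.comp continuous_fst)).mul
      (c a1)).add (c a2)).add (continuous_snd.mul (c a3))).add
      ((continuous_conj.comp continuous_snd).mul (c a4))).add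
      (continuous_const.mul ((c h1).sub (c h1b))))

/-- Green's formula: `adjLaplacian k` is the adjoint of `weightLaplacian k`. -/
theorem integral_mul_weightLaplacian (k : ℝ) (hf : ContDiff ℝ 2 f) (hc : HasCompactSupport f)
    (hs : tsupport f ⊆ siegelDomain) (hg : ContDiffOn ℝ 2 g siegelDomain) :
    ∫ Z : siegelDomain, f Z * weightLaplacian k g Z ∂siegelMeasure
      = ∫ Z : siegelDomain, adjLaplacian k f Z * g Z ∂siegelMeasure := by
  have h := integral_sub_adjLaplacian k hf hc hs hg
  obtain ⟨a, b, c⟩ := hasCompactSupport_adjLaplacian k hf hc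
  rw [integral_sub (integrable_siegelMeasure_of_compact_left hf.continuous hc hs
    (continuousOn_weightLaplacian k hg))
    (integrable_siegelMeasure_of_compact_left a b (c.trans hs) hg.continuousOn), sub_eq_zero] at h
  exact h

end IntegrationByParts

/-! ### Jacobians of fractional linear maps, invariance of the measure, transitivity. -/

/-- The complex-linear map of `ℂ²` with matrix `!![a, b; c, d]`. -/
noncomputable def planeMap (a b c d : ℂ) : ℂ × ℂ →L[ℂ] ℂ × ℂ :=
  LinearMap.toContinuousLinearMap
    (Matrix.toLin (Module.Basis.finTwoProd ℂ) (Module.Basis.finTwoProd ℂ) !![a, b; c, d])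

theorem det_planeMap_restrictScalars (a b c d : ℂ) :
    ((planeMap a b c d).restrictScalars ℝ).det = normSq (a * d - b * c) := by
  have h : ((planeMap a b c d).restrictScalars ℝ).det
      = LinearMap.det ((Matrix.toLin (Module.Basis.finTwoProd ℂ) (Module.Basis.finTwoProd ℂ)
        !![a, b; c, d]).restrictScalars ℝ) := rfl
  rw [h, LinearMap.det_restrictScalars, Algebra.norm_complex_apply, LinearMap.det_toLin,
    Matrix.det_fin_two_of]

/-- The `i`-th coordinate of `M (z₁, z₂, 1)ᵀ`. -/
noncomputable def projForm (M : Matrix (Fin 3) (Fin 3) ℂ) (i : Fin 3) (Z : ℂ × ℂ) : ℂ :=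
  M i 0 * Z.1 + M i 1 * Z.2 + M i 2

/-- The fractional linear map of `ℂ²` given by a `3 × 3` matrix. -/
noncomputable def projMap (M : Matrix (Fin 3) (Fin 3) ℂ) (Z : ℂ × ℂ) : ℂ × ℂ :=
  (projForm M 0 Z / projForm M 2 Z, projForm M 1 Z / projForm M 2 Z)

theorem hasFDerivAt_projForm_div (M : Matrix (Fin 3) (Fin 3) ℂ) (i : Fin 3) {Z : ℂ × ℂ}
    (h : projForm M 2 Z ≠ 0) :
    HasFDerivAt (fun W => projForm M i W / projForm M 2 W)
      (((M i 0 * projForm M 2 Z - projForm M i Z * M 2 0) / projForm M 2 Z ^ 2) •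
          ContinuousLinearMap.fst ℂ ℂ ℂ
        + ((M i 1 * projForm M 2 Z - projForm M i Z * M 2 1) / projForm M 2 Z ^ 2) •
          ContinuousLinearMap.snd ℂ ℂ ℂ) Z := by
  have hform : ∀ j, HasFDerivAt (projForm M j)
      (M j 0 • ContinuousLinearMap.fst ℂ ℂ ℂ + M j 1 • ContinuousLinearMap.snd ℂ ℂ ℂ) Z := fun j =>
    (((hasFDerivAt_fst (𝕜 := ℂ)).const_mul (M j 0)).add
      ((hasFDerivAt_snd (𝕜 := ℂ)).const_mul (M j 1))).add_const (M j 2)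
  have h1 := (hform i).mul ((hasDerivAt_inv h).comp_hasFDerivAt Z (hform 2))
  have h2 : (fun W => projForm M i W / projForm M 2 W)
      = projForm M i * ((fun x => x⁻¹) ∘ projForm M 2) := by
    ext W; simp [div_eq_mul_inv]
  rw [h2]
  convert! h1 using 1
  ext <;> simp <;> field_simp <;> ring

theorem hasFDerivAt_projMap (M : Matrix (Fin 3) (Fin 3) ℂ) {Z : ℂ × ℂ}
    (h : projForm M 2 Z ≠ 0) :
    HasFDerivAt (projMap M) (planeMap
      ((M 0 0 * projForm M 2 Z - projForm M 0 Z * M 2 0) / projForm M 2 Z ^ 2)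
      ((M 0 1 * projForm M 2 Z - projForm M 0 Z * M 2 1) / projForm M 2 Z ^ 2)
      ((M 1 0 * projForm M 2 Z - projForm M 1 Z * M 2 0) / projForm M 2 Z ^ 2)
      ((M 1 1 * projForm M 2 Z - projForm M 1 Z * M 2 1) / projForm M 2 Z ^ 2)) Z := by
  have := (hasFDerivAt_projForm_div M 0 h).prodMk (hasFDerivAt_projForm_div M 1 h)
  rw [planeMap, Matrix.toLin_finTwoProd_toContinuousLinearMap]
  exact this

/-- Replacing the last column of `M` by `M (z₁, z₂, 1)ᵀ` leaves `det M` unchanged; expanding shows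
that the complex Jacobian is `det M` over the cube of the denominator. The real Jacobian is its
squared modulus. -/
theorem jacobian_projMap (M : Matrix (Fin 3) (Fin 3) ℂ) {Z : ℂ × ℂ} (h : projForm M 2 Z ≠ 0) :
    ∃ f' : ℂ × ℂ →L[ℝ] ℂ × ℂ, HasFDerivAt (projMap M) f' Z
      ∧ f'.det = normSq M.det / normSq (projForm M 2 Z) ^ 3 := by
  refine ⟨_, (hasFDerivAt_projMap M h).restrictScalars ℝ, ?_⟩
  rw [det_planeMap_restrictScalars, ← map_pow, ← map_div₀]
  congr 1
  rw [Matrix.det_fin_three]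
  have e (i : Fin 3) : M i 2 = projForm M i Z - (M i 0 * Z.1 + M i 1 * Z.2) := by
    simp [projForm]
  rw [e 0, e 1, e 2]
  field_simp
  ring

theorem lintegral_image_projMap (M : Matrix (Fin 3) (Fin 3) ℂ) (hM : M.det = 1)
    {s : Set (ℂ × ℂ)} (hs : MeasurableSet s) (h0 : ∀ Z ∈ s, projForm M 2 Z ≠ 0)
    (hinj : Set.InjOn (projMap M) s) (G : ℂ × ℂ → ENNReal) :
    ∫⁻ W in projMap M '' s, G W
      = ∫⁻ Z in s, ENNReal.ofReal (normSq (projForm M 2 Z) ^ 3)⁻¹ * G (projMap M Z) := by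
  have hex : ∀ Z, ∃ f' : ℂ × ℂ →L[ℝ] ℂ × ℂ, Z ∈ s → HasFDerivAt (projMap M) f' Z
      ∧ f'.det = (normSq (projForm M 2 Z) ^ 3)⁻¹ := by
    intro Z
    by_cases hZ : Z ∈ s
    · obtain ⟨f', h1, h2⟩ := jacobian_projMap M (h0 Z hZ)
      exact ⟨f', fun _ => ⟨h1, by rw [h2, hM]; simp⟩⟩
    · exact ⟨0, fun h => absurd h hZ⟩
  choose f' hf' using hex
  rw [lintegral_image_eq_lintegral_abs_det_fderiv_mul volume hs
    (fun Z hZ => (hf' Z hZ).1.hasFDerivWithinAt) hinj G]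
  refine setLIntegral_congr_fun hs fun Z hZ => ?_
  have : 0 ≤ (normSq (projForm M 2 Z) ^ 3)⁻¹ := inv_nonneg.2 (pow_nonneg (normSq_nonneg _) 3)
  rw [(hf' Z hZ).2, abs_of_nonneg this]

theorem moebius_inv_moebius (g : SU21) {Z : ℂ × ℂ} (hZ : Z ∈ siegelDomain) :
    moebius g⁻¹ (moebius g Z) = Z := by
  have h := inv_smul_smul g (⟨Z, hZ⟩ : siegelDomain)
  exact congrArg Subtype.val h

/-- The Jacobian `|j|⁻⁶` cancels against `ρ(gZ)⁻³ = |j|⁶ ρ(Z)⁻³`. -/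
theorem lintegral_moebius (g : SU21) (h : ℂ × ℂ → ENNReal) :
    ∫⁻ Z : siegelDomain, h (moebius g Z) ∂siegelMeasure = ∫⁻ Z : siegelDomain, h Z ∂siegelMeasure := by
  have hm : ∀ Z, projMap (g.1 : Matrix (Fin 3) (Fin 3) ℂ) Z = moebius g Z := fun Z => rfl
  have hj : ∀ Z, projForm (g.1 : Matrix (Fin 3) (Fin 3) ℂ) 2 Z = autJ g Z := fun Z => rfl
  have himg : projMap (g.1 : Matrix (Fin 3) (Fin 3) ℂ) '' siegelDomain = siegelDomain := by
    ext Z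
    constructor
    · rintro ⟨W, hW, rfl⟩
      exact moebius_mem g hW
    · intro hZ
      refine ⟨moebius g⁻¹ Z, moebius_mem _ hZ, ?_⟩
      have := moebius_inv_moebius g⁻¹ hZ
      rwa [inv_inv] at this
  have hinj : Set.InjOn (projMap (g.1 : Matrix (Fin 3) (Fin 3) ℂ)) siegelDomain := by
    intro Z hZ W hW e
    rw [← moebius_inv_moebius g hZ, ← moebius_inv_moebius g hW, ← hm, ← hm, e]
  have key := lintegral_image_projMap (g.1 : Matrix (Fin 3) (Fin 3) ℂ) g.1.2
    isOpen_siegelDomain.measurableSet (fun Z hZ => autJ_ne_zero g hZ) hinj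
    (fun Z => ENNReal.ofReal (4 / rhoDiag Z ^ 3) * h Z)
  rw [himg] at key
  rw [lintegral_siegelMeasure (fun Z => h (moebius g Z)), lintegral_siegelMeasure h, key]
  refine setLIntegral_congr_fun isOpen_siegelDomain.measurableSet fun Z hZ => ?_
  have h1 := normSq_pos.2 (autJ_ne_zero g hZ)
  have h2 : 0 < rhoDiag Z := hZ
  rw [hm, hj, ← mul_assoc, rhoDiag_moebius g hZ, ← ENNReal.ofReal_mul (by positivity)]
  congr 2
  field_simp

theorem measurable_smul_siegel (g : SU21) : Measurable fun Z : siegelDomain => g • Z := by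
  refine Measurable.subtype_mk (f := fun Z : siegelDomain => moebius g Z) ?_
  unfold moebius autJ linForm
  fun_prop

instance instSMulInvariantMeasureSiegel : SMulInvariantMeasure SU21 siegelDomain siegelMeasure where
  measure_preimage_smul g s hs := by
    have e : ∀ t : Set siegelDomain, MeasurableSet t → siegelMeasure t
        = ∫⁻ Z : siegelDomain, ((↑) '' t : Set (ℂ × ℂ)).indicator 1 (Z : ℂ × ℂ) ∂siegelMeasure := by
      intro t ht
      rw [← lintegral_indicator_one ht]
      congr 1
      ext Z
      by_cases hZ : Z ∈ t <;> simp [hZ]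
    have hp := measurable_smul_siegel g hs
    rw [e s hs, ← lintegral_moebius g, e _ hp]
    congr 1
    ext Z
    have : (moebius g Z : ℂ × ℂ) ∈ ((↑) '' s : Set (ℂ × ℂ))
        ↔ (Z : ℂ × ℂ) ∈ ((↑) '' ((fun x : siegelDomain => g • x) ⁻¹' s) : Set (ℂ × ℂ)) := by
      rw [← coe_smul_siegel]
      simp only [Subtype.val_injective.mem_set_image]
      rfl
    by_cases hZ : (Z : ℂ × ℂ) ∈ ((↑) '' ((fun x : siegelDomain => g • x) ⁻¹' s) : Set (ℂ × ℂ))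
    · rw [Set.indicator_of_mem hZ, Set.indicator_of_mem (this.2 hZ)]; rfl
    · rw [Set.indicator_of_notMem hZ, Set.indicator_of_notMem fun h => hZ (this.1 h)]

instance instMeasurableConstSMulSiegel : MeasurableConstSMul SU21 siegelDomain :=
  ⟨measurable_smul_siegel⟩

theorem measurePreserving_smul_siegel (g : SU21) :
    MeasurePreserving (fun Z : siegelDomain => g • Z) siegelMeasure siegelMeasure :=
  measurePreserving_smul g siegelMeasure

/-- The point `(1/2, 0)` of the Siegel domain. -/
noncomputable def siegelBase : siegelDomain := ⟨(1 / 2, 0), by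
  change 0 < rhoDiag _
  rw [rhoDiag_eq]; norm_num⟩

theorem exists_smul_siegelBase (A : siegelDomain) : ∃ g : SU21, g • siegelBase = A := by
  obtain ⟨⟨a, b⟩, hA⟩ := A
  have hpos : 0 < rhoDiag (a, b) := hA
  set t : ℝ := Real.sqrt (rhoDiag (a, b)) with ht
  have htp : 0 < t := Real.sqrt_pos.2 hpos
  have ht2 : (t : ℂ) ^ 2 = conj a + a - conj b * b := by
    rw [← ofReal_pow, ht, Real.sq_sqrt hpos.le, ← rho_self, rho]
  have htc : (t : ℂ) ≠ 0 := by exact_mod_cast htp.ne'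
  -- The dilation `(t² z₁, t z₂)` followed by a Heisenberg translation. Here `t = √ρ(A)` because `ρ`
  -- is `1` at the base point, and the last column is fixed by the requirement that the base point
  -- go to `(a, b)`.
  set M : Matrix (Fin 3) (Fin 3) ℂ := !![(t : ℂ), conj b, (a - t ^ 2 / 2) / t; 0, 1, b / t; 0, 0, 1 / t]
    with hM
  have hdet : M.det = 1 := by
    simp [hM, Matrix.det_fin_three, htc]
  have hform : Mᴴ * formJ * M = formJ := by
    ext i j
    fin_cases i <;> fin_cases j <;>
      simp [hM, formJ, Matrix.mul_apply, Fin.sum_univ_three, htc, map_ofNat]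
    all_goals try field_simp
    all_goals try linear_combination 2 * ht2
    all_goals try ring
  let g : SU21 := ⟨⟨M, hdet⟩, hform⟩
  refine ⟨g, Subtype.ext ?_⟩
  have e : ∀ i j, g.1 i j = M i j := fun _ _ => rfl
  change moebius g (1 / 2, 0) = (a, b)
  simp only [moebius, autJ, linForm, e]
  simp [hM]
  field_simp
  simp

/-! ### The distribution of `σ` under the invariant measure. -/

/-- The measure `(σ - 1) dσ` on `(1, ∞)`. -/
noncomputable def radialMeasure : Measure ℝ :=
  (volume.restrict (Set.Ioi 1)).withDensity fun t => ENNReal.ofReal (t - 1)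

/-- The squared Euclidean norm on `ℂ²`. -/
noncomputable def euclidSq (w : ℂ × ℂ) : ℝ := normSq w.1 + normSq w.2

theorem continuous_euclidSq : Continuous euclidSq :=
  (continuous_normSq.comp continuous_fst).add (continuous_normSq.comp continuous_snd)

theorem euclidSq_nonneg (w : ℂ × ℂ) : 0 ≤ euclidSq w :=
  add_nonneg (normSq_nonneg _) (normSq_nonneg _)

open scoped Pointwise in
theorem volume_euclidSq_le {t : ℝ} (ht : 0 ≤ t) :
    volume {w : ℂ × ℂ | euclidSq w ≤ t} = ENNReal.ofReal (t ^ 2) * volume {w | euclidSq w ≤ 1} := by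
  rcases ht.eq_or_lt with rfl | ht
  · have : {w : ℂ × ℂ | euclidSq w ≤ 0} ⊆ {0} := by
      intro w hw
      have h1 := normSq_nonneg w.1
      have h2 := normSq_nonneg w.2
      have hw' : normSq w.1 + normSq w.2 ≤ 0 := hw
      exact Prod.ext (normSq_eq_zero.1 (by linarith)) (normSq_eq_zero.1 (by linarith))
    rw [measure_mono_null this (measure_singleton _)]
    simp
  · have hs : {w : ℂ × ℂ | euclidSq w ≤ t} = Real.sqrt t • {w : ℂ × ℂ | euclidSq w ≤ 1} := by
      have hr := Real.sqrt_pos.2 ht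
      ext w
      rw [Set.mem_smul_set_iff_inv_smul_mem₀ hr.ne']
      have : euclidSq ((Real.sqrt t)⁻¹ • w) = euclidSq w / t := by
        simp only [euclidSq, Prod.smul_fst, Prod.smul_snd, real_smul, normSq_mul, normSq_ofReal]
        rw [← mul_inv, Real.mul_self_sqrt ht.le]
        ring
      simp only [Set.mem_ofPred_eq]
      rw [this, div_le_one ht]
    rw [hs, Measure.addHaar_smul]
    have : Module.finrank ℝ (ℂ × ℂ) = 4 := by simp
    rw [this, show Real.sqrt t ^ 4 = t ^ 2 by
      rw [show (4 : ℕ) = 2 * 2 from rfl, pow_mul, Real.sq_sqrt ht.le], abs_of_nonneg (by positivity)]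

/-- The Euclidean volume of the unit ball of `ℂ²`. -/
noncomputable def ballVolume : ENNReal := volume {w : ℂ × ℂ | euclidSq w ≤ 1}

theorem ballVolume_ne_top : ballVolume ≠ ⊤ := by
  refine (IsCompact.measure_lt_top ?_).ne
  refine Metric.isCompact_of_isClosed_isBounded
    (isClosed_le continuous_euclidSq continuous_const) ?_
  rw [isBounded_iff_forall_norm_le]
  refine ⟨1, fun w hw => ?_⟩
  have h1 := normSq_nonneg w.1
  have h2 := normSq_nonneg w.2
  have hw' : normSq w.1 + normSq w.2 ≤ 1 := hw
  rw [normSq_eq_norm_sq] at h1 hw'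
  rw [normSq_eq_norm_sq] at h2 hw'
  rw [Prod.norm_def]
  exact max_le (by nlinarith [norm_nonneg w.1]) (by nlinarith [norm_nonneg w.2])

theorem ballVolume_ne_zero : ballVolume ≠ 0 := by
  have ho : IsOpen {w : ℂ × ℂ | euclidSq w < 1} := isOpen_lt continuous_euclidSq continuous_const
  have : 0 < volume {w : ℂ × ℂ | euclidSq w < 1} :=
    ho.measure_pos volume ⟨0, by simp [euclidSq]⟩
  exact (this.trans_le (measure_mono fun w (hw : euclidSq w < 1) => hw.le)).ne'

theorem lintegral_Ioc_two_mul {a b : ℝ} (ha : 0 ≤ a) (hab : a ≤ b) :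
    ∫⁻ t in Set.Ioc a b, ENNReal.ofReal (2 * t) = ENNReal.ofReal (b ^ 2 - a ^ 2) := by
  rw [← ofReal_integral_eq_lintegral_ofReal, ← intervalIntegral.integral_of_le hab]
  · congr 1
    rw [intervalIntegral.integral_const_mul, integral_id]; ring
  · exact (Continuous.integrableOn_Ioc (by fun_prop))
  · filter_upwards [ae_restrict_mem measurableSet_Ioc] with t ht
    have := ht.1
    change 0 ≤ 2 * t
    linarith

/-- By scaling in real dimension four, the ball of squared radius `t` has volume `t²` times that of
the unit ball, which gives the density `2t`; measures agreeing on half-open intervals are equal. -/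
theorem map_euclidSq_volume :
    Measure.map euclidSq (volume : Measure (ℂ × ℂ))
      = (volume.restrict (Set.Ioi 0)).withDensity fun t => ballVolume * ENNReal.ofReal (2 * t) := by
  have hm := continuous_euclidSq.measurable
  have hmap : ∀ a b : ℝ, a < b → Measure.map euclidSq (volume : Measure (ℂ × ℂ)) (Set.Ioc a b)
      = ENNReal.ofReal ((max b 0) ^ 2 - (max a 0) ^ 2) * ballVolume := by
    intro a b hab
    rw [Measure.map_apply hm measurableSet_Ioc]
    have hle : ∀ t : ℝ, volume {w : ℂ × ℂ | euclidSq w ≤ max t 0}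
        = ENNReal.ofReal ((max t 0) ^ 2) * ballVolume := fun t =>
      volume_euclidSq_le (le_max_right _ _)
    rcases lt_or_ge a 0 with ha | ha
    · rcases lt_or_ge b 0 with hb | hb
      · have : euclidSq ⁻¹' Set.Ioc a b = ∅ := by
          ext w
          have := euclidSq_nonneg w
          simp only [Set.mem_preimage, Set.mem_Ioc, Set.mem_empty_iff_false, iff_false]
          intro h
          linarith [h.2]
        rw [this, max_eq_right hb.le, max_eq_right ha.le]
        simp
      · have : euclidSq ⁻¹' Set.Ioc a b = {w | euclidSq w ≤ max b 0} := by
          ext w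
          have := euclidSq_nonneg w
          simp only [Set.mem_preimage, Set.mem_Ioc, Set.mem_ofPred_eq, max_eq_left hb]
          exact ⟨fun h => h.2, fun h => ⟨by linarith, h⟩⟩
        rw [this, hle, max_eq_right ha.le]
        simp
    · have : euclidSq ⁻¹' Set.Ioc a b
          = {w | euclidSq w ≤ max b 0} \ {w | euclidSq w ≤ max a 0} := by
        ext w
        simp only [Set.mem_preimage, Set.mem_Ioc, Set.mem_ofPred_eq, Set.mem_sdiff,
          max_eq_left ha, max_eq_left (ha.trans hab.le), not_le]
        exact and_comm
      rw [this, measure_sdiff, hle, hle, ENNReal.ofReal_sub _ (by positivity),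
        ENNReal.sub_mul fun _ _ => ballVolume_ne_top]
      · intro w hw
        exact le_trans (show euclidSq w ≤ max a 0 from hw) (max_le_max hab.le le_rfl)
      · exact (measurableSet_le hm measurable_const).nullMeasurableSet
      · rw [hle]
        exact ENNReal.mul_ne_top ENNReal.ofReal_ne_top ballVolume_ne_top
  refine Measure.ext_of_Ioc' _ _ (fun a b hab => ?_) fun a b hab => ?_
  · rw [hmap a b hab]
    exact ENNReal.mul_ne_top ENNReal.ofReal_ne_top ballVolume_ne_top
  · rw [hmap a b hab, withDensity_apply _ measurableSet_Ioc,
      Measure.restrict_restrict measurableSet_Ioc]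
    have : Set.Ioc a b ∩ Set.Ioi 0 = Set.Ioc (max a 0) (max b 0) := by
      ext t
      simp only [Set.mem_inter_iff, Set.mem_Ioc, Set.mem_Ioi, max_lt_iff, le_max_iff]
      constructor
      · rintro ⟨⟨h1, h2⟩, h3⟩; exact ⟨⟨h1, h3⟩, Or.inl h2⟩
      · rintro ⟨⟨h1, h3⟩, h2 | h2⟩
        · exact ⟨⟨h1, h2⟩, h3⟩
        · linarith
    rw [this, lintegral_const_mul _ (by fun_prop),
      lintegral_Ioc_two_mul (le_max_right _ _) (max_le_max hab.le le_rfl), mul_comm]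

/-- The matrix of the Cayley transform, which maps the Siegel domain onto the unit ball. -/
noncomputable def cayley : Matrix (Fin 3) (Fin 3) ℂ := !![1, 0, -(1 / 2); 0, 1, 0; 1, 0, 1 / 2]

theorem det_cayley : cayley.det = 1 := by
  simp [cayley, Matrix.det_fin_three]; norm_num

theorem projForm_cayley (Z : ℂ × ℂ) : projForm cayley 0 Z = Z.1 - 1 / 2
    ∧ projForm cayley 1 Z = Z.2 ∧ projForm cayley 2 Z = Z.1 + 1 / 2 := by
  refine ⟨?_, ?_, ?_⟩ <;> (simp [projForm, cayley]; try ring)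

theorem cayley_denom_ne_zero {Z : ℂ × ℂ} (hZ : Z ∈ siegelDomain) : Z.1 + 1 / 2 ≠ 0 := by
  intro h
  have h1 : 0 < rhoDiag Z := hZ
  rw [rhoDiag_eq] at h1
  have h2 := normSq_nonneg Z.2
  have h3 := congrArg re h
  simp at h3
  linarith

theorem one_sub_euclidSq_cayley {Z : ℂ × ℂ} (hZ : Z ∈ siegelDomain) :
    1 - euclidSq (projMap cayley Z) = rhoDiag Z / normSq (Z.1 + 1 / 2) := by
  obtain ⟨h0, h1, h2⟩ := projForm_cayley Z
  have hn := normSq_pos.2 (cayley_denom_ne_zero hZ)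
  rw [projMap, h0, h1, h2, euclidSq, rhoDiag_eq]
  have e : normSq (Z.1 - 1 / 2) = normSq (Z.1 + 1 / 2) - 2 * Z.1.re := by
    simp [normSq_apply]; ring
  simp only [normSq_div]
  rw [e]
  generalize normSq (Z.1 + 1 / 2) = n at *
  field_simp
  ring

theorem sigmaInv_siegelBase {Z : ℂ × ℂ} (hZ : Z ∈ siegelDomain) :
    sigmaInv siegelBase Z = 1 / (1 - euclidSq (projMap cayley Z)) := by
  rw [one_sub_euclidSq_cayley hZ, sigmaInv_eq, one_div_div]
  have h1 : rho siegelBase Z = Z.1 + 1 / 2 := by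
    simp [siegelBase, rho, add_comm, map_ofNat]
  have h2 : rhoDiag siegelBase = 1 := by simp [rhoDiag_eq, siegelBase]
  rw [h1, h2, one_mul]

theorem image_cayley : projMap cayley '' siegelDomain = {w | euclidSq w < 1} := by
  ext w
  constructor
  · rintro ⟨Z, hZ, rfl⟩
    have h := one_sub_euclidSq_cayley hZ
    have h1 : 0 < rhoDiag Z := hZ
    have hn := normSq_pos.2 (cayley_denom_ne_zero hZ)
    have : 0 < rhoDiag Z / normSq (Z.1 + 1 / 2) := by positivity
    change euclidSq _ < 1
    linarith
  · intro hw
    have hw' : normSq w.1 + normSq w.2 < 1 := hw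
    have hne : 1 - w.1 ≠ 0 := by
      intro h
      have : w.1 = 1 := (sub_eq_zero.1 h).symm
      rw [this] at hw'
      have := normSq_nonneg w.2
      simp at hw'
      linarith
    have hn := normSq_pos.2 hne
    refine ⟨((1 + w.1) / (2 * (1 - w.1)), w.2 / (1 - w.1)), ?_, ?_⟩
    · change 0 < rhoDiag _
      rw [rhoDiag_eq]
      have e1 : ((1 + w.1) / (2 * (1 - w.1))) = ((1 + w.1) * conj (1 - w.1)) * ((normSq (1 - w.1))⁻¹ / 2 : ℝ) := by
        push_cast
        rw [← mul_conj]
        have : conj (1 - w.1) ≠ 0 := (map_ne_zero _).2 hne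
        field_simp
      have e2 : 2 * ((1 + w.1) / (2 * (1 - w.1))).re = (1 - normSq w.1) / normSq (1 - w.1) := by
        rw [e1, re_mul_ofReal]
        field_simp
        simp [normSq_apply]
        ring
      simp only
      rw [e2, normSq_div, ← sub_div]
      exact div_pos (by linarith) hn
    · obtain ⟨h0, h1, h2⟩ := projForm_cayley ((1 + w.1) / (2 * (1 - w.1)), w.2 / (1 - w.1))
      rw [projMap, h0, h1, h2]
      have e : (1 + w.1) / (2 * (1 - w.1)) + 1 / 2 = 1 / (1 - w.1) := by field_simp; ring
      have e' : (1 + w.1) / (2 * (1 - w.1)) - 1 / 2 = w.1 / (1 - w.1) := by field_simp; ring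
      simp only [e, e']
      ext
      · simp only; field_simp
      · simp only; field_simp

theorem injOn_cayley : Set.InjOn (projMap cayley) siegelDomain := by
  intro Z hZ W hW h
  obtain ⟨a0, a1, a2⟩ := projForm_cayley Z
  obtain ⟨b0, b1, b2⟩ := projForm_cayley W
  have hz := cayley_denom_ne_zero hZ
  have hw := cayley_denom_ne_zero hW
  rw [projMap, projMap, a0, a1, a2, b0, b1, b2, Prod.mk.injEq, div_eq_div_iff hz hw,
    div_eq_div_iff hz hw] at h
  have h1 : Z.1 = W.1 := by linear_combination h.1
  refine Prod.ext h1 ?_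
  have h2 := h.2
  rw [h1] at h2
  exact mul_right_cancel₀ hw h2

/-- In the ball model, with `x` the squared norm, `σ = 1/(1-x)` and the invariant measure has
density `4/(1-x)³`. As `x` is distributed like `2x dx` and `dx = dσ/σ²`, the density in `σ` is `4σ³
· 2(1 - 1/σ) · σ⁻² = 8(σ-1)`. -/
theorem lintegral_sigmaInv_siegelBase {f : ℝ → ENNReal} (hf : Measurable f) :
    ∫⁻ Z : siegelDomain, f (sigmaInv siegelBase Z) ∂siegelMeasure
      = 8 * ballVolume * ∫⁻ t, f t ∂radialMeasure := by
  set G : ℝ → ENNReal := fun x => (Set.Iio (1 : ℝ)).indicator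
    (fun x => ENNReal.ofReal (4 / (1 - x) ^ 3) * f (1 / (1 - x))) x with hG
  have hGm : Measurable G := Measurable.indicator (by fun_prop) measurableSet_Iio
  have hGx : ∀ x < 1, G x = ENNReal.ofReal (4 / (1 - x) ^ 3) * f (1 / (1 - x)) := fun x hx =>
    Set.indicator_of_mem (show x ∈ Set.Iio (1 : ℝ) from hx) _
  have hG0 : ∀ x, 1 ≤ x → G x = 0 := fun x hx =>
    Set.indicator_of_notMem (show x ∉ Set.Iio (1 : ℝ) from fun h => absurd hx (not_le.2 h)) _
  have step1 : ∫⁻ Z : siegelDomain, f (sigmaInv siegelBase Z) ∂siegelMeasure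
      = ∫⁻ w in {w : ℂ × ℂ | euclidSq w < 1}, G (euclidSq w) := by
    rw [← image_cayley, lintegral_image_projMap cayley det_cayley isOpen_siegelDomain.measurableSet
      (fun Z hZ => by rw [(projForm_cayley Z).2.2]; exact cayley_denom_ne_zero hZ) injOn_cayley,
      lintegral_siegelMeasure fun Z => f (sigmaInv siegelBase Z)]
    refine setLIntegral_congr_fun isOpen_siegelDomain.measurableSet fun Z hZ => ?_
    have h1 : 0 < rhoDiag Z := hZ
    have hn := normSq_pos.2 (cayley_denom_ne_zero hZ)
    have hlt : euclidSq (projMap cayley Z) < 1 := by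
      have := one_sub_euclidSq_cayley hZ
      have : 0 < rhoDiag Z / normSq (Z.1 + 1 / 2) := by positivity
      linarith
    rw [hGx _ hlt, ← sigmaInv_siegelBase hZ, one_sub_euclidSq_cayley hZ, (projForm_cayley Z).2.2,
      ← mul_assoc, ← ENNReal.ofReal_mul (by positivity)]
    generalize normSq (Z.1 + 1 / 2) = n at *
    congr 2
    field_simp
  have step2 : ∫⁻ w in {w : ℂ × ℂ | euclidSq w < 1}, G (euclidSq w) = ∫⁻ w, G (euclidSq w) := by
    rw [← lintegral_indicator (measurableSet_lt continuous_euclidSq.measurable measurable_const)]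
    congr 1
    ext w
    by_cases hw : euclidSq w < 1
    · rw [Set.indicator_of_mem (by exact hw)]
    · rw [Set.indicator_of_notMem (by exact hw), hG0 _ (not_lt.1 hw)]
  have step3 : ∫⁻ w, G (euclidSq w)
      = ∫⁻ x in Set.Ioo 0 1, ballVolume * ENNReal.ofReal (2 * x) * G x := by
    rw [← lintegral_map hGm continuous_euclidSq.measurable, map_euclidSq_volume,
      lintegral_withDensity_eq_lintegral_mul _ (by fun_prop) hGm, ← Set.Iio_inter_Ioi,
      ← Measure.restrict_restrict measurableSet_Iio, ← lintegral_indicator measurableSet_Iio]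
    congr 1
    ext x
    by_cases hx : x < 1
    · rw [Set.indicator_of_mem (by exact hx)]; rfl
    · rw [Set.indicator_of_notMem (by exact hx), Pi.mul_apply, hG0 _ (not_lt.1 hx), mul_zero]
  have himg : (fun t : ℝ => 1 - 1 / t) '' Set.Ioi 1 = Set.Ioo 0 1 := by
    ext x
    constructor
    · rintro ⟨t, ht, rfl⟩
      have ht' : (1 : ℝ) < t := ht
      have : 1 / t < 1 := by rw [div_lt_one (by linarith)]; exact ht'
      have : 0 < 1 / t := by positivity
      constructor <;> simp only <;> linarith
    · rintro ⟨h0, h1⟩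
      refine ⟨1 / (1 - x), ?_, ?_⟩
      · change 1 < 1 / (1 - x)
        rw [lt_div_iff₀ (by linarith)]; linarith
      · simp
  have step4 : ∫⁻ x in Set.Ioo 0 1, ballVolume * ENNReal.ofReal (2 * x) * G x
      = ∫⁻ t in Set.Ioi 1, 8 * ballVolume * (ENNReal.ofReal (t - 1) * f t) := by
    rw [← himg, lintegral_image_eq_lintegral_abs_deriv_mul measurableSet_Ioi
      (f' := fun t => 1 / t ^ 2)]
    · refine setLIntegral_congr_fun measurableSet_Ioi fun t ht => ?_
      have ht' : (1 : ℝ) < t := ht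
      have hp : 0 < t := by linarith
      have : 0 < 1 / t := by positivity
      have e1 : 1 - (1 - 1 / t) = 1 / t := by ring
      rw [hGx _ (by linarith), e1, one_div_one_div]
      have : ENNReal.ofReal |1 / t ^ 2| * (ballVolume * ENNReal.ofReal (2 * (1 - 1 / t)) *
          (ENNReal.ofReal (4 / (1 / t) ^ 3) * f t))
          = ballVolume * (ENNReal.ofReal |1 / t ^ 2| * ENNReal.ofReal (2 * (1 - 1 / t)) *
            ENNReal.ofReal (4 / (1 / t) ^ 3)) * f t := by ring
      rw [this, abs_of_pos (by positivity), ← ENNReal.ofReal_mul (by positivity),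
        ← ENNReal.ofReal_mul (by
          have : 1 / t < 1 := by rw [div_lt_one (by linarith)]; exact ht'
          have : 0 ≤ 1 - 1 / t := by linarith
          positivity)]
      have : 1 / t ^ 2 * (2 * (1 - 1 / t)) * (4 / (1 / t) ^ 3) = 8 * (t - 1) := by
        field_simp; ring
      rw [this, ENNReal.ofReal_mul (by norm_num), ENNReal.ofReal_ofNat]
      ring
    · intro t ht
      have ht' : (1 : ℝ) < t := ht
      have := ((hasDerivAt_id t).inv (by simp; linarith)).const_sub 1
      refine HasDerivAt.hasDerivWithinAt ?_
      simp only [one_div]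
      convert! this using 1
      simp [neg_div]
    · intro t ht u hu h
      simp only [one_div, sub_right_inj, inv_inj] at h
      exact h
  have hR : ∫⁻ t, f t ∂radialMeasure = ∫⁻ t in Set.Ioi 1, ENNReal.ofReal (t - 1) * f t := by
    rw [radialMeasure, lintegral_withDensity_eq_lintegral_mul _ (by fun_prop) hf]
    rfl
  rw [step1, step2, step3, step4, hR, lintegral_const_mul]
  fun_prop

theorem map_sigmaInv_siegelMeasure (A : siegelDomain) :
    Measure.map (fun Z : siegelDomain => sigmaInv A Z) siegelMeasure
      = (8 * ballVolume) • radialMeasure := by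
  obtain ⟨g, rfl⟩ := exists_smul_siegelBase A
  ext s hs
  have hm (B : siegelDomain) := (continuous_sigmaInv B).measurable
  rw [← lintegral_indicator_one hs, lintegral_map (measurable_one.indicator hs) (hm _),
    ← (measurePreserving_smul_siegel g).lintegral_comp
      (f := fun Z => s.indicator 1 (sigmaInv (g • siegelBase : siegelDomain) Z))
      ((measurable_one.indicator hs).comp (hm _))]
  simp only [sigmaInv_smul]
  rw [lintegral_sigmaInv_siegelBase (measurable_one.indicator hs), lintegral_indicator_one hs]
  rfl

/-! ### Power series in the unit disc and Abel's theorem. -/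

/-- The coefficients of a power series which converges in the open unit disc. -/
def UnitDiscSummable (a : ℕ → ℂ) : Prop := ∀ r : ℝ, 0 ≤ r → r < 1 → Summable fun n => ‖a n‖ * r ^ n

/-- The sum of the power series with coefficients `a`. -/
noncomputable def powerSum (a : ℕ → ℂ) (w : ℂ) : ℂ := ∑' n, a n * w ^ n

namespace UnitDiscSummable

variable {a b : ℕ → ℂ}

theorem summable (ha : UnitDiscSummable a) {w : ℂ} (hw : ‖w‖ < 1) :
    Summable fun n => a n * w ^ n := by
  refine Summable.of_norm ?_
  simpa using ha ‖w‖ (norm_nonneg w) hw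

theorem add (ha : UnitDiscSummable a) (hb : UnitDiscSummable b) :
    UnitDiscSummable fun n => a n + b n := fun r h0 h1 =>
  ((ha r h0 h1).add (hb r h0 h1)).of_nonneg_of_le (fun n => by positivity) fun n => by
    rw [← add_mul]
    exact mul_le_mul_of_nonneg_right (norm_add_le _ _) (by positivity)

theorem const_mul (c : ℂ) (ha : UnitDiscSummable a) : UnitDiscSummable fun n => c * a n :=
  fun r h0 h1 => by simpa [mul_assoc] using (ha r h0 h1).mul_left ‖c‖

theorem sub (ha : UnitDiscSummable a) (hb : UnitDiscSummable b) :
    UnitDiscSummable fun n => a n - b n := by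
  simpa [sub_eq_add_neg] using ha.add (hb.const_mul (-1))

theorem nat_mul (ha : UnitDiscSummable a) : UnitDiscSummable fun n => (n : ℂ) * a n := by
  intro r h0 h1
  obtain ⟨q, hrq, hq1⟩ := exists_between h1
  have hq0 : 0 < q := h0.trans_lt hrq
  have ht := tendsto_self_mul_const_pow_of_lt_one (div_nonneg h0 hq0.le) ((div_lt_one hq0).2 hrq)
  obtain ⟨C, hC⟩ := ht.bddAbove_range
  refine ((ha q hq0.le hq1).mul_left C).of_nonneg_of_le (fun n => by positivity) fun n => ?_
  have h2 : (n : ℝ) * (r / q) ^ n ≤ C := hC ⟨n, rfl⟩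
  have e : ‖(n : ℂ) * a n‖ * r ^ n = ((n : ℝ) * (r / q) ^ n) * (‖a n‖ * q ^ n) := by
    rw [norm_mul, norm_natCast, div_pow]
    field_simp
  rw [e]
  exact mul_le_mul_of_nonneg_right h2 (by positivity)

theorem add_nat_mul (c : ℂ) (ha : UnitDiscSummable a) :
    UnitDiscSummable fun n => (c + n) * a n := by
  simpa [add_mul] using (ha.const_mul c).add ha.nat_mul

theorem shift (ha : UnitDiscSummable a) : UnitDiscSummable fun n => a (n + 1) := by
  intro r h0 h1
  obtain ⟨q, hrq, hq1⟩ := exists_between h1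
  have hq0 : 0 < q := h0.trans_lt hrq
  have h := ((summable_nat_add_iff 1).2 (ha q hq0.le hq1)).mul_left q⁻¹
  refine h.of_nonneg_of_le (fun n => by positivity) fun n => ?_
  have : q⁻¹ * (‖a (n + 1)‖ * q ^ (n + 1)) = ‖a (n + 1)‖ * q ^ n := by
    rw [pow_succ]; field_simp
  rw [this]
  gcongr

theorem unshift (ha : UnitDiscSummable fun n => a (n + 1)) : UnitDiscSummable a := by
  intro r h0 h1
  refine (summable_nat_add_iff 1).1 ?_
  refine ((ha r h0 h1).mul_left r).congr fun n => ?_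
  rw [pow_succ]; ring

end UnitDiscSummable

section PowerSum

variable {a b : ℕ → ℂ} {w : ℂ}

theorem powerSum_add (ha : UnitDiscSummable a) (hb : UnitDiscSummable b) (hw : ‖w‖ < 1) :
    powerSum (fun n => a n + b n) w = powerSum a w + powerSum b w := by
  simp only [powerSum, add_mul]
  exact (ha.summable hw).tsum_add (hb.summable hw)

theorem powerSum_const_mul (c : ℂ) : powerSum (fun n => c * a n) w = c * powerSum a w := by
  simp only [powerSum, mul_assoc]
  exact tsum_mul_left

theorem powerSum_sub (ha : UnitDiscSummable a) (hb : UnitDiscSummable b) (hw : ‖w‖ < 1) :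
    powerSum (fun n => a n - b n) w = powerSum a w - powerSum b w := by
  simp only [powerSum, sub_mul]
  exact (ha.summable hw).tsum_sub (hb.summable hw)

theorem powerSum_eq_shift (ha : UnitDiscSummable a) (hw : ‖w‖ < 1) :
    powerSum a w = a 0 + w * powerSum (fun n => a (n + 1)) w := by
  simp only [powerSum]
  rw [(ha.summable hw).tsum_eq_zero_add, ← tsum_mul_left]
  simp only [pow_zero, mul_one]
  congr 1
  refine tsum_congr fun n => ?_
  rw [pow_succ]; ring

theorem hasDerivAt_powerSum (ha : UnitDiscSummable a) (hw : ‖w‖ < 1) :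
    HasDerivAt (powerSum a) (powerSum (fun n => ((n : ℂ) + 1) * a (n + 1)) w) w := by
  obtain ⟨r, hwr, hr1⟩ := exists_between hw
  have hr0 : 0 < r := (norm_nonneg w).trans_lt hwr
  have hsum : Summable fun n => ‖((n : ℕ) : ℂ) * a n‖ * r ^ (n - 1) := by
    refine (summable_nat_add_iff 1).1 ?_
    exact ha.nat_mul.shift r hr0.le hr1
  have h := hasDerivAt_tsum_of_isPreconnected (g := fun n (z : ℂ) => a n * z ^ n)
    (g' := fun n z => a n * (n * z ^ (n - 1))) hsum (Metric.isOpen_ball (x := (0 : ℂ)) (ε := r))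
    (convex_ball (0 : ℂ) r).isPreconnected
    (fun n y _ => (hasDerivAt_pow n y).const_mul (a n))
    (fun n y hy => by
      have hy' : ‖y‖ < r := by simpa using hy
      rw [← mul_assoc, mul_comm (a n), norm_mul _ (y ^ (n - 1)), norm_pow]
      gcongr)
    (Metric.mem_ball_self hr0) (ha.summable (by simp)) (show w ∈ Metric.ball (0 : ℂ) r by simpa)
  have e : ∑' n, a n * ((n : ℂ) * w ^ (n - 1))
      = powerSum (fun n => ((n : ℂ) + 1) * a (n + 1)) w := by
    have hs : Summable fun n => a n * ((n : ℂ) * w ^ (n - 1)) := by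
      refine (summable_nat_add_iff 1).1 ((ha.nat_mul.shift.summable hw).congr fun n => ?_)
      simp only [Nat.add_sub_cancel]; ring
    rw [hs.tsum_eq_zero_add, powerSum]
    simp only [CharP.cast_eq_zero, zero_mul, mul_zero, zero_add, Nat.add_sub_cancel]
    refine tsum_congr fun n => ?_
    push_cast; ring
  rw [e] at h
  exact h

theorem mul_powerSum_deriv (ha : UnitDiscSummable a) (hw : ‖w‖ < 1) :
    w * powerSum (fun n => ((n : ℂ) + 1) * a (n + 1)) w = powerSum (fun n => (n : ℂ) * a n) w := by
  rw [powerSum_eq_shift ha.nat_mul hw]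
  simp

theorem one_sub_mul_powerSum (ha : UnitDiscSummable a) (hw : ‖w‖ < 1) {b : ℕ → ℂ}
    (hb0 : b 0 = a 0) (hb : ∀ n, b (n + 1) = a (n + 1) - a n) :
    (1 - w) * powerSum a w = powerSum b w := by
  have hbs : UnitDiscSummable b := UnitDiscSummable.unshift (by
    simp only [hb]
    exact ha.shift.sub ha)
  rw [powerSum_eq_shift hbs hw]
  simp only [hb]
  rw [powerSum_sub ha.shift ha hw, hb0]
  have := powerSum_eq_shift ha hw
  linear_combination this

/-- If `a n → L` then `(1 - x) ∑ a n xⁿ → L` as `x → 1-`. -/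
theorem tendsto_one_sub_mul_powerSum (ha : UnitDiscSummable a) {L : ℂ}
    (hL : Tendsto a atTop (𝓝 L)) :
    Tendsto (fun x : ℝ => (1 - (x : ℂ)) * powerSum a x) (𝓝[<] 1) (𝓝 L) := by
  -- The coefficients of `(1 - w) ∑ a n wⁿ`. Their partial sums telescope to `a n`, so Abel's limit
  -- theorem applies to the series of `b`.
  set b : ℕ → ℂ := fun n => if n = 0 then a 0 else a n - a (n - 1) with hb
  have hpart : Tendsto (fun n => ∑ i ∈ Finset.range n, b i) atTop (𝓝 L) := by
    rw [← tendsto_add_atTop_iff_nat 1]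
    refine hL.congr fun n => ?_
    induction n with
    | zero => simp [hb]
    | succ n ih =>
      rw [Finset.sum_range_succ, ← ih]
      simp [hb]
  have h := Complex.tendsto_tsum_powerSeries_nhdsWithin_lt hpart
  rw [tendsto_map'_iff] at h
  refine h.congr' ?_
  have h01 : Set.Ioo (0 : ℝ) 1 ∈ 𝓝[<] (1 : ℝ) := Ioo_mem_nhdsLT one_pos
  filter_upwards [h01] with x hx
  have hw : ‖(x : ℂ)‖ < 1 := by
    rw [norm_real, Real.norm_of_nonneg hx.1.le]; exact hx.2
  exact (one_sub_mul_powerSum ha hw (by simp [hb]) (fun n => by simp [hb])).symm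

theorem norm_powerSum_le (ha : UnitDiscSummable a) {r : ℝ} (h0 : 0 ≤ r) (h1 : r < 1)
    (hw : ‖w‖ ≤ r) : ‖powerSum a w‖ ≤ ∑' n, ‖a n‖ * r ^ n :=
  tsum_of_norm_bounded (ha r h0 h1).hasSum fun n => by
    rw [norm_mul, norm_pow]; gcongr

/-- Termwise differentiation of `σ ^ (-β) ∑ a n σ⁻ⁿ`. -/
theorem hasDerivAt_cpow_mul_powerSum (ha : UnitDiscSummable a) (β : ℂ) {σ : ℝ} (hσ : 1 < σ) :
    HasDerivAt (fun t : ℝ => (t : ℂ) ^ (-β) * powerSum a (t : ℂ)⁻¹)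
      ((σ : ℂ) ^ (-(β + 1)) * powerSum (fun n => -1 * ((β + n) * a n)) (σ : ℂ)⁻¹) σ := by
  have hσ0 : (σ : ℂ) ≠ 0 := by exact_mod_cast (by linarith : σ ≠ 0)
  have hw : ‖(σ : ℂ)⁻¹‖ < 1 := by
    rw [norm_inv, norm_real, Real.norm_of_nonneg (by linarith)]
    exact inv_lt_one_of_one_lt₀ hσ
  have h1 : HasDerivAt (fun z : ℂ => z ^ (-β)) (-β * (σ : ℂ) ^ (-β - 1)) (σ : ℂ) := by
    have := (hasDerivAt_id (σ : ℂ)).cpow_const (c := -β) (Or.inl (by simp; linarith))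
    simpa using this
  have h2 := (hasDerivAt_powerSum ha hw).comp (σ : ℂ) (hasDerivAt_inv hσ0)
  have h3 := (h1.mul h2).comp_ofReal
  convert! h3 using 1
  have e1 : (σ : ℂ) ^ (-(β + 1)) = (σ : ℂ) ^ (-β) * (σ : ℂ)⁻¹ := by
    rw [show -(β + 1) = -β - 1 by ring, cpow_sub _ _ hσ0, cpow_one, div_eq_mul_inv]
  have e2 : (σ : ℂ) ^ (-β - 1) = (σ : ℂ) ^ (-β) * (σ : ℂ)⁻¹ := by
    rw [cpow_sub _ _ hσ0, cpow_one, div_eq_mul_inv]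
  have e3 : powerSum (fun n => -1 * ((β + n) * a n)) (σ : ℂ)⁻¹
      = -(β * powerSum a (σ : ℂ)⁻¹ + (σ : ℂ)⁻¹ *
        powerSum (fun n => ((n : ℂ) + 1) * a (n + 1)) (σ : ℂ)⁻¹) := by
    rw [mul_powerSum_deriv ha hw, powerSum_const_mul]
    simp only [add_mul]
    rw [powerSum_add (ha.const_mul β) ha.nat_mul hw, powerSum_const_mul]
    ring
  rw [e1, e2, e3]
  simp only [Function.comp_apply]
  field_simp
  ring

end PowerSum

/-! ### Hypergeometric coefficients and their limit. -/

section Coefficients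

variable {a b c : ℂ}

theorem hypergeometricCoeff_zero : ordinaryHypergeometricCoefficient a b c 0 = 1 := by
  simp [ordinaryHypergeometricCoefficient]

theorem hypergeometricCoeff_succ (hc : ∀ n : ℕ, c + n ≠ 0) (n : ℕ) :
    ((n : ℂ) + 1) * (c + n) * ordinaryHypergeometricCoefficient a b c (n + 1)
      = (a + n) * (b + n) * ordinaryHypergeometricCoefficient a b c n := by
  have h1 : (n : ℂ) + 1 ≠ 0 := by exact_mod_cast n.succ_ne_zero
  have h2 := hc n
  simp only [ordinaryHypergeometricCoefficient, ascPochhammer_succ_eval, Nat.factorial_succ]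
  push_cast
  rw [mul_inv, mul_inv]
  field_simp

/-- The radius of convergence is `1` unless one of the parameters is a nonpositive integer. In that
case the series terminates, for `c` because the inverse of zero is zero. -/
theorem unitDiscSummable_hypergeometricCoeff (a b c : ℂ) :
    UnitDiscSummable (ordinaryHypergeometricCoefficient a b c) := by
  have hrad : 1 ≤ (ordinaryHypergeometricSeries ℂ a b c).radius := by
    by_cases h : ∀ kn : ℕ, (kn : ℂ) ≠ -a ∧ (kn : ℂ) ≠ -b ∧ (kn : ℂ) ≠ -c
    · exact (ordinaryHypergeometricSeries_radius_eq_one ℂ a b c h).ge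
    · push Not at h
      obtain ⟨k, hk⟩ := h
      have : (ordinaryHypergeometricSeries ℂ a b c).radius = ⊤ := by
        by_cases ha : (k : ℂ) = -a
        · rw [show a = -(k : ℂ) by rw [ha, neg_neg]]
          exact ordinaryHypergeometric_radius_top_of_neg_nat₁ ℂ b c
        by_cases hb : (k : ℂ) = -b
        · rw [show b = -(k : ℂ) by rw [hb, neg_neg]]
          exact ordinaryHypergeometric_radius_top_of_neg_nat₂ ℂ a c
        · rw [show c = -(k : ℂ) by rw [hk ha hb, neg_neg]]
          exact ordinaryHypergeometric_radius_top_of_neg_nat₃ ℂ a b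
      rw [this]; exact le_top
  intro r h0 h1
  lift r to NNReal using h0
  have h := (ordinaryHypergeometricSeries ℂ a b c).summable_norm_mul_pow (r := r)
    (lt_of_lt_of_le (by exact_mod_cast h1) hrad)
  simpa only [ordinaryHypergeometricSeries, FormalMultilinearSeries.ofScalars_norm] using h

theorem ordinaryHypergeometric_eq_powerSum (a b c w : ℂ) :
    ₂F₁ a b c w = powerSum (ordinaryHypergeometricCoefficient a b c) w := by
  rw [ordinaryHypergeometric_eq_tsum]
  rfl

/-- The coefficients of `(1 - w) F(a, b; a + b - 1; w) = F(a - 1, b - 1; a + b - 1; w)`. -/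
theorem hypergeometricCoeff_sub (h : c = a + b - 1) (hc : ∀ n : ℕ, c + n ≠ 0) (n : ℕ) :
    ordinaryHypergeometricCoefficient (a - 1) (b - 1) c (n + 1)
      = ordinaryHypergeometricCoefficient a b c (n + 1) - ordinaryHypergeometricCoefficient a b c n := by
  have h1 : (n : ℂ) + 1 ≠ 0 := by exact_mod_cast n.succ_ne_zero
  have h2 := hc n
  have e : ((n : ℂ) + 1) * (c + n) * ordinaryHypergeometricCoefficient (a - 1) (b - 1) c (n + 1)
      = (a - 1) * (b - 1) * ordinaryHypergeometricCoefficient a b c n := by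
    have p : ∀ x : ℂ, (ascPochhammer ℂ (n + 1)).eval (x - 1) = (x - 1) * (ascPochhammer ℂ n).eval x := by
      intro x
      rw [ascPochhammer_succ_left]
      simp
    simp only [ordinaryHypergeometricCoefficient, p, Nat.factorial_succ]
    rw [ascPochhammer_succ_eval n c]
    push_cast
    rw [mul_inv, mul_inv]
    field_simp
  have e2 := hypergeometricCoeff_succ (a := a) (b := b) hc n
  refine mul_left_cancel₀ (mul_ne_zero h1 h2) ?_
  rw [e]
  linear_combination -e2 + ((n : ℂ) + 1) * ordinaryHypergeometricCoefficient a b c n * h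

/-- Euler's transformation in the case `c - a - b = -1`, where the power of `1 - w` is a first power
and comparing coefficients suffices. -/
theorem one_sub_mul_hypergeometric (h : c = a + b - 1) (hc : ∀ n : ℕ, c + n ≠ 0) {w : ℂ}
    (hw : ‖w‖ < 1) :
    (1 - w) * powerSum (ordinaryHypergeometricCoefficient a b c) w
      = powerSum (ordinaryHypergeometricCoefficient (a - 1) (b - 1) c) w :=
  one_sub_mul_powerSum (unitDiscSummable_hypergeometricCoeff a b c) hw
    (by rw [hypergeometricCoeff_zero, hypergeometricCoeff_zero]) (hypergeometricCoeff_sub h hc)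

theorem eval_ascPochhammer_eq_prod (n : ℕ) (x : ℂ) :
    (ascPochhammer ℂ n).eval x = ∏ j ∈ Finset.range n, (x + j) := by
  induction n with
  | zero => simp
  | succ n ih => rw [ascPochhammer_succ_eval, ih, Finset.prod_range_succ]

/-- The limit `Γ(c) / (Γ(a) Γ(b))` of the coefficients of `F(a, b; a + b - 1; w)`. Here
`1 / Γ(a) = 0` at the poles of `Γ`, in accordance with the convention for `Complex.Gamma`. -/
noncomputable def hypergeometricLimit (a b c : ℂ) : ℂ := Gamma c / (Gamma a * Gamma b)

theorem hypergeometricLimit_eq_zero_iff (hc : ∀ n : ℕ, c + n ≠ 0) :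
    hypergeometricLimit a b c = 0 ↔ ∃ n : ℕ, a = -n ∨ b = -n := by
  have hG : Gamma c ≠ 0 := Gamma_ne_zero fun n hn => hc n (by rw [hn]; ring)
  rw [hypergeometricLimit, div_eq_zero_iff, mul_eq_zero, Gamma_eq_zero_iff a, Gamma_eq_zero_iff b,
    exists_or]
  exact or_iff_right hG

/-- The coefficients are quotients of Euler's products for the Gamma function, in which the powers
of `n` cancel up to a factor tending to `1` because `c = a + b - 1`. If `a` or `b` is a pole of
Gamma, the coefficients vanish from some index on, in accordance with the value `0` of `Gamma`
there. -/
theorem tendsto_hypergeometricCoeff (h : c = a + b - 1) (hc : ∀ n : ℕ, c + n ≠ 0) :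
    Tendsto (ordinaryHypergeometricCoefficient a b c) atTop (𝓝 (hypergeometricLimit a b c)) := by
  unfold hypergeometricLimit
  by_cases hab : ∃ n : ℕ, a = -n ∨ b = -n
  · have h0 := (hypergeometricLimit_eq_zero_iff (a := a) (b := b) hc).2 hab
    rw [hypergeometricLimit] at h0
    rw [h0]
    obtain ⟨k, hk⟩ := hab
    refine tendsto_const_nhds.congr' ?_
    filter_upwards [eventually_gt_atTop k] with n hn
    have : (ascPochhammer ℂ n).eval a = 0 ∨ (ascPochhammer ℂ n).eval b = 0 := by
      rcases hk with hk | hk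
      · exact Or.inl ((ascPochhammer_eval_eq_zero_iff n _).2 ⟨k, hn, by rw [hk, neg_neg]⟩)
      · exact Or.inr ((ascPochhammer_eval_eq_zero_iff n _).2 ⟨k, hn, by rw [hk, neg_neg]⟩)
    rcases this with h | h <;> simp [h]
  · push Not at hab
    rw [← tendsto_add_atTop_iff_nat 1]
    have hGa := Gamma_ne_zero fun n => (hab n).1
    have hGb := Gamma_ne_zero fun n => (hab n).2
    have h1 := (GammaSeq_tendsto_Gamma c).div
      ((GammaSeq_tendsto_Gamma a).mul (GammaSeq_tendsto_Gamma b)) (mul_ne_zero hGa hGb)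
    -- `GammaSeq` at `n` has a product of `n + 1` factors, so it belongs to the coefficient of index
    -- `n + 1`; the factorials and powers leave over `n / (n + 1)`.
    have h2 : Tendsto (fun n : ℕ => (n : ℂ) / ((n : ℂ) + 1)) atTop (𝓝 1) :=
      tendsto_natCast_div_add_atTop 1
    have h3 := h2.mul h1
    rw [one_mul] at h3
    refine h3.congr' ?_
    filter_upwards [eventually_gt_atTop 0] with n hn
    have hn0 : (n : ℂ) ≠ 0 := by exact_mod_cast hn.ne'
    have hn1 : (n : ℂ) + 1 ≠ 0 := by exact_mod_cast n.succ_ne_zero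
    have hf : (n.factorial : ℂ) ≠ 0 := by exact_mod_cast n.factorial_ne_zero
    have pa : ∏ j ∈ Finset.range (n + 1), (a + j) ≠ 0 := Finset.prod_ne_zero_iff.2 fun j _ h =>
      (hab j).1 (eq_neg_of_add_eq_zero_left h)
    have pb : ∏ j ∈ Finset.range (n + 1), (b + j) ≠ 0 := Finset.prod_ne_zero_iff.2 fun j _ h =>
      (hab j).2 (eq_neg_of_add_eq_zero_left h)
    have pc : ∏ j ∈ Finset.range (n + 1), (c + j) ≠ 0 := Finset.prod_ne_zero_iff.2 fun j _ => hc j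
    have hcp : (n : ℂ) ^ c = (n : ℂ) ^ a * (n : ℂ) ^ b / n := by
      rw [h, cpow_sub _ _ hn0, cpow_add _ _ hn0, cpow_one]
    have ha0 : (n : ℂ) ^ a ≠ 0 := by simp [cpow_eq_zero_iff, hn0]
    have hb0 : (n : ℂ) ^ b ≠ 0 := by simp [cpow_eq_zero_iff, hn0]
    simp only [ordinaryHypergeometricCoefficient, eval_ascPochhammer_eq_prod, GammaSeq,
      Nat.factorial_succ, hcp, Pi.div_apply]
    push_cast
    field_simp

end Coefficients

/-! ### The hypergeometric equation and Pfaff's transformation. -/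

section HypergeometricEquation

variable {a b c : ℂ}

theorem hypergeometric_equation (a b : ℂ) (hc : ∀ n : ℕ, c + n ≠ 0) :
    ∃ f₁ f₂ : ℂ → ℂ, ∀ w : ℂ, ‖w‖ < 1 → HasDerivAt (₂F₁ a b c) (f₁ w) w
      ∧ HasDerivAt f₁ (f₂ w) w
      ∧ w * (1 - w) * f₂ w + (c - (a + b + 1) * w) * f₁ w - a * b * ₂F₁ a b c w = 0 := by
  set α := ordinaryHypergeometricCoefficient a b c with hα
  have hs : UnitDiscSummable α := unitDiscSummable_hypergeometricCoeff a b c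
  have hF : ₂F₁ a b c = powerSum α := by
    ext z; exact ordinaryHypergeometric_eq_powerSum a b c z
  set β : ℕ → ℂ := fun n => ((n : ℂ) + 1) * α (n + 1) with hβ
  have hβs : UnitDiscSummable β := by
    have := hs.shift.add_nat_mul 1
    simpa [hβ, add_comm] using this
  refine ⟨powerSum β, powerSum (fun n => ((n : ℂ) + 1) * β (n + 1)), fun w hw => ⟨?_,
    hasDerivAt_powerSum hβs hw, ?_⟩⟩
  · rw [hF]; exact hasDerivAt_powerSum hs hw
  · have e2 := mul_powerSum_deriv hβs hw
    have e1 := mul_powerSum_deriv hs hw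
    rw [hF]
    have key : powerSum (fun n => (n : ℂ) * β n) w + c * powerSum β w
        = (a + b + 1) * powerSum (fun n => (n : ℂ) * α n) w
          + powerSum (fun n => (n : ℂ) * ((n : ℂ) * α n)) w - powerSum (fun n => (n : ℂ) * α n) w
          + a * b * powerSum α w := by
      rw [← powerSum_const_mul, ← powerSum_const_mul, ← powerSum_const_mul,
        ← powerSum_add hβs.nat_mul (hβs.const_mul c) hw,
        ← powerSum_add (hs.nat_mul.const_mul _) hs.nat_mul.nat_mul hw,
        ← powerSum_sub ((hs.nat_mul.const_mul _).add hs.nat_mul.nat_mul) hs.nat_mul hw,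
        ← powerSum_add (((hs.nat_mul.const_mul _).add hs.nat_mul.nat_mul).sub hs.nat_mul)
          (hs.const_mul _) hw]
      congr 1
      ext n
      have := hypergeometricCoeff_succ (a := a) (b := b) hc n
      simp only [hβ]
      linear_combination this
    have e3 : w * powerSum (fun n => (n : ℂ) * β n) w
        = powerSum (fun n => (n : ℂ) * ((n : ℂ) * α n)) w - powerSum (fun n => (n : ℂ) * α n) w := by
      rw [← powerSum_sub hs.nat_mul.nat_mul hs.nat_mul hw,
        powerSum_eq_shift (hs.nat_mul.nat_mul.sub hs.nat_mul) hw]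
      simp only [CharP.cast_eq_zero, zero_mul, sub_zero, zero_add]
      congr 2
      ext n
      simp only [hβ]
      push_cast
      ring
    have hβd : powerSum (fun n => ((n : ℂ) + 1) * α (n + 1)) w = powerSum β w := rfl
    rw [hβd] at e1
    linear_combination (1 - w) * e2 + key - e3 - (a + b + 1) * e1

end HypergeometricEquation

/-- An analytic solution of the hypergeometric equation which vanishes at `0` is zero. -/
theorem eventually_eq_zero_of_hypergeometric_equation {a b c : ℂ} (hc : ∀ n : ℕ, c + n ≠ 0)
    {f f₁ f₂ : ℂ → ℂ} (hf : AnalyticAt ℂ f 0) (h0 : f 0 = 0)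
    (h1 : ∀ᶠ z in 𝓝 (0 : ℂ), HasDerivAt f (f₁ z) z) (h2 : ∀ᶠ z in 𝓝 (0 : ℂ), HasDerivAt f₁ (f₂ z) z)
    (hode : ∀ᶠ z in 𝓝 (0 : ℂ), z * (1 - z) * f₂ z + (c - (a + b + 1) * z) * f₁ z - a * b * f z = 0) :
    ∀ᶠ z in 𝓝 (0 : ℂ), f z = 0 := by
  by_contra hne
  obtain ⟨n, g, hg, hg0, hfg⟩ := hf.exists_eventuallyEq_pow_smul_nonzero_iff.2 hne
  simp only [sub_zero, smul_eq_mul] at hfg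
  obtain ⟨k, rfl⟩ : ∃ k, n = k + 1 := by
    refine Nat.exists_eq_succ_of_ne_zero fun hn => ?_
    have := hfg.self_of_nhds
    rw [hn, h0] at this
    simp at this
    exact hg0 this.symm
  set g₁ := deriv g with hg₁
  set g₂ := deriv g₁ with hg₂
  have dg : ∀ᶠ z in 𝓝 (0 : ℂ), HasDerivAt g (g₁ z) z := by
    filter_upwards [hg.eventually_analyticAt] with z hz
    exact hz.differentiableAt.hasDerivAt
  have dg₁ : ∀ᶠ z in 𝓝 (0 : ℂ), HasDerivAt g₁ (g₂ z) z := by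
    filter_upwards [hg.deriv.eventually_analyticAt] with z hz
    exact hz.differentiableAt.hasDerivAt
  have e1 : ∀ᶠ z in 𝓝 (0 : ℂ), f₁ z = ((k : ℂ) + 1) * z ^ k * g z + z ^ (k + 1) * g₁ z := by
    filter_upwards [hfg.eventually_nhds, h1, dg] with z hz hz1 hz2
    have hd := ((hasDerivAt_pow (k + 1) z).mul hz2).congr_of_eventuallyEq
      (f₁ := f) (by filter_upwards [hz] with w hw; rw [hw]; rfl)
    rw [hz1.unique hd]
    simp
  have e2 : ∀ᶠ z in 𝓝 (0 : ℂ), z * f₂ z = z ^ k * (((k : ℂ) + 1) * k * g z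
      + 2 * ((k : ℂ) + 1) * z * g₁ z + z ^ 2 * g₂ z) := by
    filter_upwards [e1.eventually_nhds, h2, dg, dg₁] with z hz hz1 hz2 hz3
    have hd := ((((hasDerivAt_pow k z).const_mul ((k : ℂ) + 1)).mul hz2).add
      ((hasDerivAt_pow (k + 1) z).mul hz3)).congr_of_eventuallyEq
      (f₁ := f₁) (by filter_upwards [hz] with w hw; rw [hw]; rfl)
    rw [hz1.unique hd]
    rcases k with _ | k
    · simp; ring
    · push_cast
      ring
  set E : ℂ → ℂ := fun z => (1 - z) * (((k : ℂ) + 1) * k * g z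
      + 2 * ((k : ℂ) + 1) * z * g₁ z + z ^ 2 * g₂ z)
      + (c - (a + b + 1) * z) * (((k : ℂ) + 1) * g z + z * g₁ z) - a * b * z * g z with hE
  have hE0 : ∀ᶠ z in 𝓝[≠] (0 : ℂ), E z = 0 := by
    have hall : ∀ᶠ z in 𝓝 (0 : ℂ), z ≠ 0 → E z = 0 := by
      filter_upwards [hfg, e1, e2, hode] with z p0 p1 p2 p3 hz
      have : z ^ k * E z = 0 := by
        rw [hE]
        rw [p0, p1] at p3
        linear_combination p3 - (1 - z) * p2
      exact (mul_eq_zero.1 this).resolve_left (pow_ne_zero _ hz)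
    exact eventually_nhdsWithin_iff.2 hall
  have hEc : ContinuousAt E 0 := by
    have c0 := hg.continuousAt
    have c1 : ContinuousAt g₁ 0 := hg.deriv.continuousAt
    have c2 : ContinuousAt g₂ 0 := hg.deriv.deriv.continuousAt
    fun_prop
  have hEz : E 0 = 0 := by
    have t1 : Tendsto E (𝓝[≠] 0) (𝓝 (E 0)) := hEc.tendsto.mono_left nhdsWithin_le_nhds
    exact tendsto_nhds_unique (t1.congr' hE0) tendsto_const_nhds
  simp only [hE] at hEz
  -- The indicial equation for a zero of order `k + 1`: the exponents at `0` are `0` and `1 - c`,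
  -- and `hc` prevents `1 - c` from being a positive integer.
  have : ((k : ℂ) + 1) * (c + k) * g 0 = 0 := by linear_combination hEz
  rcases mul_eq_zero.1 this with h | h
  · rcases mul_eq_zero.1 h with h | h
    · exact absurd h (by exact_mod_cast k.succ_ne_zero)
    · exact hc k h
  · exact hg0 h

theorem norm_div_sub_one_lt {z : ℂ} (hz : z.re < 1 / 2) : ‖z / (z - 1)‖ < 1 := by
  have h : z - 1 ≠ 0 := by
    intro h
    have := congrArg re h
    simp at this
    linarith
  rw [norm_div, div_lt_one (norm_pos_iff.2 h)]
  refine lt_of_pow_lt_pow_left₀ 2 (norm_nonneg _) ?_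
  rw [← normSq_eq_norm_sq, ← normSq_eq_norm_sq, normSq_apply, normSq_apply]
  simp
  nlinarith

/-- Pfaff's transformation of the hypergeometric function. -/
theorem hypergeometric_pfaff (a b : ℂ) {c : ℂ} (hc : ∀ n : ℕ, c + n ≠ 0) {z : ℂ} (hz : ‖z‖ < 1)
    (hre : z.re < 1 / 2) :
    ₂F₁ a b c z = (1 - z) ^ (-b) * ₂F₁ (c - a) b c (z / (z - 1)) := by
  obtain ⟨F₁, F₂, hF⟩ := hypergeometric_equation a b hc
  obtain ⟨f₁, f₂, hf⟩ := hypergeometric_equation (c - a) b hc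
  -- On this convex set both sides are analytic and solve the same equation with the same value at
  -- `0`. They agree near `0` by uniqueness, and on the whole set by the identity theorem.
  set U : Set ℂ := Metric.ball 0 1 ∩ {z | z.re < 1 / 2} with hU
  have hUo : IsOpen U := Metric.isOpen_ball.inter (isOpen_lt continuous_re continuous_const)
  have hUc : IsPreconnected U :=
    ((convex_ball 0 1).inter (convex_halfSpace_re_lt (1 / 2))).isPreconnected
  have h0U : (0 : ℂ) ∈ U := ⟨by simp, by simp⟩
  have hsl : ∀ w ∈ U, 1 - w ∈ slitPlane := fun w hw => Or.inl (by
    have : w.re < 1 / 2 := hw.2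
    simp; linarith)
  have hne : ∀ w ∈ U, 1 - w ≠ 0 := fun w hw => slitPlane_ne_zero (hsl w hw)
  set y : ℂ → ℂ := fun w => w / (w - 1) with hy
  set G : ℂ → ℂ := fun w => (1 - w) ^ (-b) * ₂F₁ (c - a) b c (y w) with hG
  set G₁ : ℂ → ℂ := fun w => (1 - w) ^ (-b - 1) *
    (b * ₂F₁ (c - a) b c (y w) - (1 - w)⁻¹ * f₁ (y w)) with hG₁
  set G₂ : ℂ → ℂ := fun w => (b + 1) * (1 - w) ^ (-b - 1 - 1) *
    (b * ₂F₁ (c - a) b c (y w) - (1 - w)⁻¹ * f₁ (y w)) + (1 - w) ^ (-b - 1) *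
    (-(b + 1) * (1 - w)⁻¹ ^ 2 * f₁ (y w) + (1 - w)⁻¹ ^ 3 * f₂ (y w)) with hG₂
  have dy : ∀ w ∈ U, HasDerivAt y (-(1 - w)⁻¹ ^ 2) w := by
    intro w hw
    have h1 : w - 1 ≠ 0 := by
      have := hne w hw
      rwa [← neg_ne_zero, neg_sub] at this
    have h := (hasDerivAt_id w).div ((hasDerivAt_id w).sub_const 1) h1
    convert! h using 1
    have h2 : (1 - w) ^ 2 = (w - 1) ^ 2 := by ring
    rw [inv_pow, h2]
    simp only [id]
    field_simp
    ring
  have dp : ∀ (β : ℂ), ∀ w ∈ U, HasDerivAt (fun w => (1 - w) ^ β) (-β * (1 - w) ^ (β - 1)) w := by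
    intro β w hw
    have h := ((hasDerivAt_id w).const_sub 1).cpow_const (c := β) (hsl w hw)
    convert! h using 1
    simp
  have di : ∀ w ∈ U, HasDerivAt (fun w : ℂ => (1 - w)⁻¹) ((1 - w)⁻¹ ^ 2) w := by
    intro w hw
    have h := ((hasDerivAt_id w).const_sub 1).inv (hne w hw)
    convert! h using 1
    simp
  have hyU : ∀ w ∈ U, ‖y w‖ < 1 := fun w hw => norm_div_sub_one_lt hw.2
  have dG : ∀ w ∈ U, HasDerivAt G (G₁ w) w := by
    intro w hw
    have h := (dp (-b) w hw).mul (((hf (y w) (hyU w hw)).1).comp w (dy w hw))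
    convert! h using 1
    have e : (1 - w) ^ (-b) = (1 - w) ^ (-b - 1) * (1 - w) := by
      rw [cpow_sub _ _ (hne w hw), cpow_one, div_mul_cancel₀ _ (hne w hw)]
    have := hne w hw
    simp only [hG₁, Function.comp_apply]
    rw [e]
    field_simp
    ring
  have dG₁ : ∀ w ∈ U, HasDerivAt G₁ (G₂ w) w := by
    intro w hw
    have h := (dp (-b - 1) w hw).mul
      (((((hf (y w) (hyU w hw)).1).comp w (dy w hw)).const_mul b).sub
        ((di w hw).mul (((hf (y w) (hyU w hw)).2.1).comp w (dy w hw))))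
    convert! h using 1
    simp only [hG₂, Function.comp_apply, Pi.mul_apply, Pi.sub_apply]
    ring
  have odeG : ∀ w ∈ U, w * (1 - w) * G₂ w + (c - (a + b + 1) * w) * G₁ w - a * b * G w = 0 := by
    intro w hw
    have h := (hf (y w) (hyU w hw)).2.2
    have n1 := hne w hw
    have e1 : (1 - w) ^ (-b) = (1 - w) ^ (-b - 1) * (1 - w) := by
      rw [cpow_sub _ _ n1, cpow_one, div_mul_cancel₀ _ n1]
    have e2 : (1 - w) ^ (-b - 1 - 1) = (1 - w) ^ (-b - 1) * (1 - w)⁻¹ := by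
      rw [cpow_sub _ _ n1, cpow_one, div_eq_mul_inv]
    simp only [hG, hG₁, hG₂]
    rw [e1, e2]
    generalize ₂F₁ (c - a) b c (y w) = x at *
    generalize f₁ (y w) = x₁ at *
    generalize f₂ (y w) = x₂ at *
    generalize (1 - w) ^ (-b - 1) = p
    have hyw : y w = -(w * (1 - w)⁻¹) := by
      simp only [hy, ← div_eq_mul_inv, ← div_neg, neg_sub]
    rw [hyw] at h
    obtain ⟨v, hv⟩ : ∃ v, v = 1 - w := ⟨_, rfl⟩
    have hw' : w = 1 - v := by rw [hv]; ring
    rw [← hv] at h n1 ⊢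
    rw [hw'] at h ⊢
    field_simp at h ⊢
    linear_combination -p * h
  have anF : AnalyticOnNhd ℂ (₂F₁ a b c) U := DifferentiableOn.analyticOnNhd (fun w hw =>
    ((hF w (by simpa using hw.1)).1.differentiableAt).differentiableWithinAt) hUo
  have anG : AnalyticOnNhd ℂ G U := DifferentiableOn.analyticOnNhd (fun w hw =>
    ((dG w hw).differentiableAt).differentiableWithinAt) hUo
  have hUn : U ∈ 𝓝 (0 : ℂ) := hUo.mem_nhds h0U
  have hD := eventually_eq_zero_of_hypergeometric_equation (a := a) (b := b) hc
    (f := fun w => ₂F₁ a b c w - G w) (f₁ := fun w => F₁ w - G₁ w) (f₂ := fun w => F₂ w - G₂ w)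
    ((anF 0 h0U).sub (anG 0 h0U)) (by simp [hG, hy])
    (by filter_upwards [hUn] with w hw
        exact (hF w (by simpa using hw.1)).1.sub (dG w hw))
    (by filter_upwards [hUn] with w hw
        exact (hF w (by simpa using hw.1)).2.1.sub (dG₁ w hw))
    (by filter_upwards [hUn] with w hw
        have h1 := (hF w (by simpa using hw.1)).2.2
        have h2 := odeG w hw
        linear_combination h1 - h2)
  have := anF.eqOn_of_preconnected_of_eventuallyEq anG hUc h0U
    (by filter_upwards [hD] with w hw; exact sub_eq_zero.1 hw)
  exact this ⟨by simpa using hz, hre⟩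

/-! ### The radial solution: its equation, its singularity at `σ = 1`, its bounds. -/

/-- The coefficients of `F(s - κ, s + κ; 2s - 1; w)`. -/
noncomputable def radialCoeff (s : ℂ) (κ : ℝ) : ℕ → ℂ :=
  ordinaryHypergeometricCoefficient (s - κ) (s + κ) (2 * s - 1)

/-- The decaying solution `σ ^ (-s) F(s - κ, s + κ; 2s - 1; 1/σ)` of the radial equation. -/
noncomputable def radialSol (s : ℂ) (κ : ℝ) (σ : ℝ) : ℂ :=
  (σ : ℂ) ^ (-s) * powerSum (radialCoeff s κ) (σ : ℂ)⁻¹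

/-- The derivative of `radialSol`. -/
noncomputable def radialSolDeriv (s : ℂ) (κ : ℝ) (σ : ℝ) : ℂ :=
  (σ : ℂ) ^ (-(s + 1)) * powerSum (fun n => -1 * ((s + n) * radialCoeff s κ n)) (σ : ℂ)⁻¹

/-- The second derivative of `radialSol`. -/
noncomputable def radialSolDeriv₂ (s : ℂ) (κ : ℝ) (σ : ℝ) : ℂ :=
  (σ : ℂ) ^ (-(s + 1 + 1)) *
    powerSum (fun n => -1 * ((s + 1 + n) * (-1 * ((s + n) * radialCoeff s κ n)))) (σ : ℂ)⁻¹

section RadialSolution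

variable {s : ℂ} {κ : ℝ}

theorem unitDiscSummable_radialCoeff (s : ℂ) (κ : ℝ) : UnitDiscSummable (radialCoeff s κ) :=
  unitDiscSummable_hypergeometricCoeff _ _ _

theorem hasDerivAt_radialSol (s : ℂ) (κ : ℝ) {σ : ℝ} (hσ : 1 < σ) :
    HasDerivAt (radialSol s κ) (radialSolDeriv s κ σ) σ :=
  hasDerivAt_cpow_mul_powerSum (unitDiscSummable_radialCoeff s κ) s hσ

theorem hasDerivAt_radialSolDeriv (s : ℂ) (κ : ℝ) {σ : ℝ} (hσ : 1 < σ) :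
    HasDerivAt (radialSolDeriv s κ) (radialSolDeriv₂ s κ σ) σ :=
  hasDerivAt_cpow_mul_powerSum
    (((unitDiscSummable_radialCoeff s κ).add_nat_mul s).const_mul (-1)) (s + 1) hσ

theorem norm_inv_ofReal_lt_one {σ : ℝ} (hσ : 1 < σ) : ‖(σ : ℂ)⁻¹‖ < 1 := by
  rw [norm_inv, norm_real, Real.norm_of_nonneg (by linarith)]
  exact inv_lt_one_of_one_lt₀ hσ

/-- Comparison of coefficients. The part of the operator that preserves powers of `σ`, minus the
eigenvalue, multiplies `σ^(-s-n)` by `n(n+2s-2)`, which vanishes at `n = 0` since `-s` is an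
exponent at infinity. The next order is the recurrence `(n+1)(2s-1+n) α(n+1) = ((s+n)² - κ²) α(n)`.
-/
theorem radialSol_equation (hc : ∀ n : ℕ, 2 * s - 1 + n ≠ 0) {σ : ℝ} (hσ : 1 < σ) :
    (σ : ℂ) * (σ - 1) * radialSolDeriv₂ s κ σ + (3 * σ - 1) * radialSolDeriv s κ σ
      + (κ : ℂ) ^ 2 / σ * radialSol s κ σ = s * (s - 2) * radialSol s κ σ := by
  have hσ0 : (σ : ℂ) ≠ 0 := by exact_mod_cast (by linarith : σ ≠ 0)
  have hw := norm_inv_ofReal_lt_one hσ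
  have hα := unitDiscSummable_radialCoeff s κ
  have hα1 := (hα.add_nat_mul s).const_mul (-1)
  have hα2 := (hα1.add_nat_mul (s + 1)).const_mul (-1)
  simp only [radialSol, radialSolDeriv, radialSolDeriv₂]
  set α := radialCoeff s κ
  have e1 : (σ : ℂ) ^ (-(s + 1)) = (σ : ℂ) ^ (-s) * (σ : ℂ)⁻¹ := by
    rw [neg_add, cpow_add _ _ hσ0, cpow_neg_one]
  have e2 : (σ : ℂ) ^ (-(s + 1 + 1)) = (σ : ℂ) ^ (-s) * (σ : ℂ)⁻¹ * (σ : ℂ)⁻¹ := by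
    rw [neg_add, cpow_add _ _ hσ0, cpow_neg_one, e1]
  have hL := powerSum_eq_shift ((hα2.add (hα1.const_mul 3)).sub (hα.const_mul (s * (s - 2)))) hw
  rw [powerSum_sub (hα2.add (hα1.const_mul 3)) (hα.const_mul (s * (s - 2))) hw,
    powerSum_add hα2 (hα1.const_mul 3) hw, powerSum_const_mul (a := α),
    powerSum_const_mul (a := fun n => -1 * ((s + n) * α n)) 3] at hL
  have hR : powerSum (fun n => -1 * ((s + 1 + (n + 1 : ℕ)) * (-1 * ((s + (n + 1 : ℕ)) * α (n + 1))))
      + 3 * (-1 * ((s + (n + 1 : ℕ)) * α (n + 1))) - s * (s - 2) * α (n + 1)) (σ : ℂ)⁻¹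
      = powerSum (fun n => -1 * ((s + 1 + n) * (-1 * ((s + n) * α n)))
        + -1 * ((s + n) * α n) - (κ : ℂ) ^ 2 * α n) (σ : ℂ)⁻¹ := by
    congr 1
    ext n
    have h := hypergeometricCoeff_succ (a := s - κ) (b := s + κ) hc n
    change ((n : ℂ) + 1) * (2 * s - 1 + n) * α (n + 1) = (s - κ + n) * (s + κ + n) * α n at h
    push_cast
    linear_combination h
  rw [hR, powerSum_sub (hα2.add hα1) (hα.const_mul _) hw, powerSum_add hα2 hα1 hw,
    powerSum_const_mul (a := α)] at hL
  rw [e1, e2]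
  generalize powerSum α (σ : ℂ)⁻¹ = p0 at *
  generalize powerSum (fun n => -1 * ((s + n) * α n)) (σ : ℂ)⁻¹ = p1 at *
  generalize powerSum (fun n => -1 * ((s + 1 + n) * (-1 * ((s + n) * α n)))) (σ : ℂ)⁻¹ = p2 at *
  field_simp
  field_simp at hL
  simp at hL
  linear_combination (σ : ℂ) ^ (-s) * hL

theorem tendsto_inv_nhdsGT_one : Tendsto (fun σ : ℝ => σ⁻¹) (𝓝[>] 1) (𝓝[<] 1) := by
  refine tendsto_nhdsWithin_iff.2 ⟨?_, ?_⟩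
  · have : ContinuousAt (fun σ : ℝ => σ⁻¹) 1 := continuousAt_inv₀ one_ne_zero
    simpa using this.tendsto.mono_left nhdsWithin_le_nhds
  · filter_upwards [self_mem_nhdsWithin] with σ hσ
    exact inv_lt_one_of_one_lt₀ (Set.mem_Ioi.1 hσ)

theorem tendsto_cpow_nhdsGT_one (β : ℂ) :
    Tendsto (fun σ : ℝ => (σ : ℂ) ^ β) (𝓝[>] 1) (𝓝 1) := by
  have : ContinuousAt (fun σ : ℝ => (σ : ℂ) ^ β) 1 := by
    have h1 : ContinuousAt (fun z : ℂ => z ^ β) ((1 : ℝ) : ℂ) := by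
      refine continuousAt_id.cpow continuousAt_const (Or.inl ?_)
      simp
    exact h1.comp continuous_ofReal.continuousAt
  simpa using this.tendsto.mono_left nhdsWithin_le_nhds

/-- The coefficient of the singularity of `radialSol` at `σ = 1`. -/
noncomputable def radialResidue (s : ℂ) (κ : ℝ) : ℂ := hypergeometricLimit (s - κ) (s + κ) (2 * s - 1)

/-- The zeros come from the poles of `Γ(s - κ)` and `Γ(s + κ)`. As `2κ` is a natural number, `s = -κ
- n` is `s = κ - (2κ + n)`, so the second kind is contained in the first. -/
theorem radialResidue_eq_zero_iff (hc : ∀ n : ℕ, 2 * s - 1 + n ≠ 0) (hκ : ∃ n : ℕ, 2 * κ = n) :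
    radialResidue s κ = 0 ↔ ∃ n : ℕ, s = κ - n := by
  rw [radialResidue, hypergeometricLimit_eq_zero_iff hc]
  constructor
  · rintro ⟨n, h | h⟩
    · exact ⟨n, by linear_combination h⟩
    · obtain ⟨l, hl⟩ := hκ
      have hl' : 2 * (κ : ℂ) = l := by exact_mod_cast hl
      exact ⟨l + n, by push_cast; linear_combination h - hl'⟩
  · rintro ⟨n, h⟩
    exact ⟨n, Or.inl (by linear_combination h)⟩

theorem tendsto_radialCoeff (hc : ∀ n : ℕ, 2 * s - 1 + n ≠ 0) :
    Tendsto (radialCoeff s κ) atTop (𝓝 (radialResidue s κ)) :=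
  tendsto_hypergeometricCoeff (by ring) hc

theorem tendsto_sub_one_mul_powerSum {a : ℕ → ℂ} (ha : UnitDiscSummable a) {L : ℂ}
    (hL : Tendsto a atTop (𝓝 L)) :
    Tendsto (fun σ : ℝ => ((σ : ℂ) - 1) * powerSum a (σ : ℂ)⁻¹) (𝓝[>] 1) (𝓝 L) := by
  have h := ((tendsto_one_sub_mul_powerSum ha hL).comp tendsto_inv_nhdsGT_one).mul
    (tendsto_cpow_nhdsGT_one 1)
  rw [mul_one] at h
  refine h.congr' ?_
  filter_upwards [self_mem_nhdsWithin] with σ hσ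
  have hσ0 : (σ : ℂ) ≠ 0 := by exact_mod_cast (by linarith [Set.mem_Ioi.1 hσ] : σ ≠ 0)
  simp only [Function.comp_apply, ofReal_inv, cpow_one]
  field_simp

theorem tendsto_sub_one_mul_radialSol (hc : ∀ n : ℕ, 2 * s - 1 + n ≠ 0) :
    Tendsto (fun σ : ℝ => ((σ : ℂ) - 1) * radialSol s κ σ) (𝓝[>] 1) (𝓝 (radialResidue s κ)) := by
  have h := (tendsto_cpow_nhdsGT_one (-s)).mul
    (tendsto_sub_one_mul_powerSum (unitDiscSummable_radialCoeff s κ) (tendsto_radialCoeff hc))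
  rw [one_mul] at h
  refine h.congr fun σ => ?_
  rw [radialSol]; ring

/-- By the recurrence the difference equals `α(n)` plus a constant times `α(n)/(2s-1+n)`. Thus
multiplying `∑ n α(n) wⁿ` by `1 - w` produces convergent coefficients, to which Abel's theorem
applies again. -/
theorem tendsto_sub_nat_mul_radialCoeff (hc : ∀ n : ℕ, 2 * s - 1 + n ≠ 0) :
    Tendsto (fun n : ℕ => ((n : ℂ) + 1) * radialCoeff s κ (n + 1) - n * radialCoeff s κ n) atTop
      (𝓝 (radialResidue s κ)) := by
  have hα := tendsto_radialCoeff (κ := κ) hc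
  have hinv : Tendsto (fun n : ℕ => (2 * s - 1 + n)⁻¹) atTop (𝓝 0) := by
    refine tendsto_inv₀_cobounded.comp ?_
    have : Tendsto (fun n : ℕ => (n : ℂ)) atTop (Bornology.cobounded ℂ) :=
      tendsto_norm_atTop_iff_cobounded.1 (by simpa using tendsto_natCast_atTop_atTop (R := ℝ))
    exact (tendsto_const_add_cobounded (2 * s - 1)).comp this
  have h := ((hinv.mul hα).const_mul ((s - κ) * (s + κ) - (2 * s - 1))).add hα
  simp only [zero_mul, mul_zero, zero_add] at h
  refine h.congr fun n => ?_
  have h := hypergeometricCoeff_succ (a := s - κ) (b := s + κ) hc n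
  change ((n : ℂ) + 1) * (2 * s - 1 + n) * radialCoeff s κ (n + 1)
    = (s - κ + n) * (s + κ + n) * radialCoeff s κ n at h
  have hn := hc n
  refine mul_left_cancel₀ hn ?_
  have hv := mul_inv_cancel₀ hn
  linear_combination ((s - κ) * (s + κ) - (2 * s - 1)) * radialCoeff s κ n * hv - h

/-- The asymptotics `r/(σ-1)` cannot simply be differentiated. Instead one factor `1 - w` turns the
coefficients `n α(n)` into the convergent sequence `β`, and Abel's theorem uses up the second
factor. -/
theorem tendsto_sub_one_sq_mul_radialSolDeriv (hc : ∀ n : ℕ, 2 * s - 1 + n ≠ 0) :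
    Tendsto (fun σ : ℝ => ((σ : ℂ) - 1) ^ 2 * radialSolDeriv s κ σ) (𝓝[>] 1)
      (𝓝 (-radialResidue s κ)) := by
  have hα := unitDiscSummable_radialCoeff s κ
  set β : ℕ → ℂ := fun n => n * radialCoeff s κ n - (n - 1 : ℕ) * radialCoeff s κ (n - 1) with hβ
  have hβs : UnitDiscSummable β := UnitDiscSummable.unshift (by
    simpa [hβ] using hα.nat_mul.shift.sub hα.nat_mul)
  have hβL : Tendsto β atTop (𝓝 (radialResidue s κ)) := by
    refine (tendsto_add_atTop_iff_nat 1).1 ((tendsto_sub_nat_mul_radialCoeff hc).congr fun n => ?_)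
    simp [hβ]
  have h1 := tendsto_sub_one_mul_powerSum hα (tendsto_radialCoeff (κ := κ) hc)
  have h2 := tendsto_sub_one_mul_powerSum hβs hβL
  have h0 : Tendsto (fun σ : ℝ => (σ : ℂ) - 1) (𝓝[>] 1) (𝓝 0) := by
    have := (tendsto_cpow_nhdsGT_one 1).sub_const 1
    simpa using this
  have h3 := (((h0.const_mul s).mul h1).neg.sub (h2.mul (tendsto_cpow_nhdsGT_one 1))).mul
    (tendsto_cpow_nhdsGT_one (-(s + 1)))
  simp only [mul_zero, zero_mul, neg_zero, zero_sub, mul_one] at h3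
  refine h3.congr' ?_
  filter_upwards [self_mem_nhdsWithin] with σ hσ
  have hσ0 : (σ : ℂ) ≠ 0 := by exact_mod_cast (by linarith [Set.mem_Ioi.1 hσ] : σ ≠ 0)
  have hw := norm_inv_ofReal_lt_one hσ
  have e := one_sub_mul_powerSum (b := β) hα.nat_mul hw (by simp [hβ]) (by simp [hβ])
  rw [radialSolDeriv, powerSum_const_mul]
  simp only [add_mul]
  rw [powerSum_add (hα.const_mul s) hα.nat_mul hw, powerSum_const_mul, ← e]
  simp only [cpow_one]
  field_simp
  ring

/-- `1 - w` times the series is bounded near `w = 1` by its limit, and on a smaller disc by absolute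
convergence. Against the density `σ - 1` this leaves `σ^(1 - Re s)`, which is integrable at infinity
for `Re s > 2`. -/
theorem exists_norm_radialSol_le (hc : ∀ n : ℕ, 2 * s - 1 + n ≠ 0) :
    ∃ K : ℝ, 0 < K ∧ ∀ σ : ℝ, 1 < σ → ‖radialSol s κ σ‖ ≤ K * σ ^ (1 - s.re) / (σ - 1) := by
  have hα := unitDiscSummable_radialCoeff s κ
  have h1 := (tendsto_one_sub_mul_powerSum hα (tendsto_radialCoeff (κ := κ) hc)).norm
  have hev := h1.eventually_le_const (lt_add_one _)
  obtain ⟨r, hr1, hr⟩ := (mem_nhdsLT_iff_exists_Ioo_subset' (zero_lt_one)).1 hev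
  set r' := max r (1 / 2)
  have hr'0 : 0 ≤ r' := le_max_of_le_right (by norm_num)
  have hr'1 : r' < 1 := max_lt hr1 (by norm_num)
  set K := max (‖radialResidue s κ‖ + 1) (∑' n, ‖radialCoeff s κ n‖ * r' ^ n) with hK
  have hK0 : 0 < K := lt_max_of_lt_left (by positivity)
  refine ⟨K, hK0, fun σ hσ => ?_⟩
  have hσ0 : (0 : ℝ) < σ := by linarith
  have hinv0 : 0 < σ⁻¹ := by positivity
  have hinv1 : σ⁻¹ < 1 := inv_lt_one_of_one_lt₀ hσ
  have hb : ‖(1 - ((σ⁻¹ : ℝ) : ℂ)) * powerSum (radialCoeff s κ) ((σ⁻¹ : ℝ) : ℂ)‖ ≤ K := by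
    rcases lt_or_ge r' σ⁻¹ with h | h
    · exact (hr (a := σ⁻¹) ⟨(le_max_left _ _).trans_lt h, hinv1⟩).trans (le_max_left _ _)
    · rw [norm_mul]
      have e1 : ‖1 - ((σ⁻¹ : ℝ) : ℂ)‖ ≤ 1 := by
        rw [← ofReal_one, ← ofReal_sub, norm_real, Real.norm_of_nonneg (by linarith)]
        linarith
      have e2 := norm_powerSum_le hα hr'0 hr'1 (w := ((σ⁻¹ : ℝ) : ℂ))
        (by rwa [norm_real, Real.norm_of_nonneg hinv0.le])
      calc _ ≤ 1 * ∑' n, ‖radialCoeff s κ n‖ * r' ^ n := by gcongr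
        _ ≤ K := by rw [one_mul]; exact le_max_right _ _
  rw [norm_mul] at hb
  have e1 : ‖1 - ((σ⁻¹ : ℝ) : ℂ)‖ = (σ - 1) / σ := by
    rw [← ofReal_one, ← ofReal_sub, norm_real, Real.norm_of_nonneg (by linarith)]
    field_simp
  rw [e1] at hb
  rw [radialSol, norm_mul, norm_cpow_eq_rpow_re_of_pos hσ0, sub_eq_add_neg, Real.rpow_add hσ0,
    Real.rpow_one, le_div_iff₀ (by linarith)]
  push_cast at hb
  calc _ = (σ * σ ^ (-s.re)) * ((σ - 1) / σ * ‖powerSum (radialCoeff s κ) (σ : ℂ)⁻¹‖) := by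
        simp only [neg_re]; field_simp
    _ ≤ (σ * σ ^ (-s.re)) * K := by gcongr
    _ = _ := by ring

theorem exists_norm_radialSolDeriv_le (s : ℂ) (κ : ℝ) :
    ∃ K : ℝ, 0 < K ∧ ∀ σ : ℝ, 2 ≤ σ → ‖radialSolDeriv s κ σ‖ ≤ K * σ ^ (-s.re - 1) := by
  have hα := ((unitDiscSummable_radialCoeff s κ).add_nat_mul s).const_mul (-1)
  refine ⟨(∑' n, ‖-1 * ((s + n) * radialCoeff s κ n)‖ * (1 / 2) ^ n) + 1, ?_, fun σ hσ => ?_⟩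
  · have : 0 ≤ ∑' n, ‖-1 * ((s + n) * radialCoeff s κ n)‖ * (1 / 2 : ℝ) ^ n :=
      tsum_nonneg fun n => by positivity
    linarith
  · have hσ0 : (0 : ℝ) < σ := by linarith
    have h := norm_powerSum_le hα (r := 1 / 2) (by norm_num) (by norm_num) (w := (σ : ℂ)⁻¹) (by
      rw [norm_inv, norm_real, Real.norm_of_nonneg hσ0.le, one_div]
      gcongr)
    rw [radialSolDeriv, norm_mul, norm_cpow_eq_rpow_re_of_pos hσ0, mul_comm]
    have e : (-(s + 1)).re = -s.re - 1 := by simp; ring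
    rw [e]
    gcongr
    linarith

/-- Principal value of a power of the negative number `1 - σ`. -/
theorem one_sub_cpow (β : ℂ) {σ : ℝ} (hσ : 1 < σ) :
    (1 - (σ : ℂ)) ^ β = exp (β * (Real.pi * I)) * ((σ - 1 : ℝ) : ℂ) ^ β := by
  have hp : ((σ - 1 : ℝ) : ℂ) ≠ 0 := by exact_mod_cast (by linarith : σ - 1 ≠ 0)
  have hl : log (-((σ - 1 : ℝ) : ℂ)) = log ((σ - 1 : ℝ) : ℂ) + Real.pi * I := by
    rw [← ofReal_neg, ← ofReal_log (by linarith : (0 : ℝ) ≤ σ - 1), Complex.log,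
      norm_real, arg_ofReal_of_neg (by linarith)]
    rw [norm_neg, Real.norm_of_nonneg (by linarith)]
  have : (1 - (σ : ℂ)) = -((σ - 1 : ℝ) : ℂ) := by push_cast; ring
  rw [this, cpow_def_of_ne_zero (neg_ne_zero.2 hp), cpow_def_of_ne_zero hp, ← Complex.exp_add, hl]
  congr 1
  ring

/-- Pfaff's transformation moves the argument `-1/(σ-1)` to `1/σ`, Euler's replaces `F(s+κ-1,
s-κ-1)` by `(1 - 1/σ) F(s-κ, s+κ)`, and the powers of `σ` and `σ - 1` collect to `σ^(-s)`. The
exponential is the principal value of `(-1)^(|k| - s)`. -/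
theorem radialKernel_eq (hc : ∀ n : ℕ, 2 * s - 1 + n ≠ 0) (k : ℝ) {σ : ℝ} (hσ : 1 < σ) :
    radialKernel s k σ = exp ((|k| - s) * (Real.pi * I)) * radialSol s |k| σ := by
  set κ := |k|
  have hσ0 : (0 : ℝ) < σ := by linarith
  have hσc : (σ : ℂ) ≠ 0 := by exact_mod_cast hσ0.ne'
  have hσ1 : (σ : ℂ) - 1 ≠ 0 := by
    rw [← ofReal_one, ← ofReal_sub]; exact_mod_cast (by linarith : σ - 1 ≠ 0)
  have hw := norm_inv_ofReal_lt_one hσ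
  set z : ℂ := -1 / ((σ : ℂ) - 1) with hz
  have hzr : z = ((-1 / (σ - 1) : ℝ) : ℂ) := by rw [hz]; push_cast; ring
  have hzre : z.re < 1 / 2 := by
    rw [hzr, ofReal_re]
    have : -1 / (σ - 1) < 0 := div_neg_of_neg_of_pos (by norm_num) (by linarith)
    linarith
  have hF : gaussF (s - κ) (s - 1 - κ) (2 * s - 1) z = (1 - z) ^ (-(s - 1 - κ)) *
      ₂F₁ (2 * s - 1 - (s - κ)) (s - 1 - κ) (2 * s - 1) (z / (z - 1)) := by
    rw [gaussF]
    -- In the unit disc this is Pfaff's transformation; outside it is how `gaussF` is defined.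
    split_ifs with h
    · exact hypergeometric_pfaff _ _ hc h hzre
    · rfl
  have hz1 : 1 - z = ((σ / (σ - 1) : ℝ) : ℂ) := by
    rw [hz]; push_cast; field_simp; ring
  have hzz : z / (z - 1) = (σ : ℂ)⁻¹ := by
    have : z - 1 = -((σ / (σ - 1) : ℝ) : ℂ) := by rw [← hz1]; ring
    rw [this, hz]; push_cast; field_simp
  have hE : ₂F₁ (2 * s - 1 - (s - κ)) (s - 1 - κ) (2 * s - 1) (σ : ℂ)⁻¹
      = (1 - (σ : ℂ)⁻¹) * powerSum (radialCoeff s κ) (σ : ℂ)⁻¹ := by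
    rw [radialCoeff, one_sub_mul_hypergeometric (by ring) hc hw, ordinaryHypergeometric_eq_powerSum]
    congr 1
    ext n
    rw [show s - 1 - (κ : ℂ) = s - κ - 1 by ring, show 2 * s - 1 - (s - κ) = s + κ - 1 by ring]
    simp only [ordinaryHypergeometricCoefficient]
    ring
  have hneg := one_sub_cpow (κ - s) hσ
  rw [radialKernel, radialSol]
  change (σ : ℂ) ^ (-(κ : ℝ) : ℂ) * (1 - (σ : ℂ)) ^ ((κ : ℝ) - s) *
    gaussF (s - (κ : ℝ)) (s - 1 - (κ : ℝ)) (2 * s - 1) z = _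
  rw [hF, hz1, hzz, hE, hneg]
  have hd : ((σ / (σ - 1) : ℝ) : ℂ) ^ (-(s - 1 - κ)) = (σ : ℂ) ^ (κ - s) * σ * (((σ - 1 : ℝ) : ℂ) ^ (κ - s))⁻¹ * ((σ - 1 : ℝ) : ℂ)⁻¹ := by
    have hp : (0 : ℝ) < σ - 1 := by linarith
    have hpc : ((σ - 1 : ℝ) : ℂ) ≠ 0 := by exact_mod_cast hp.ne'
    rw [ofReal_div, div_cpow_ofReal_nonneg hσ0.le hp.le, show -(s - 1 - κ) = (κ - s) + 1 by ring,
      cpow_add _ _ hσc, cpow_add _ _ hpc, cpow_one, cpow_one, div_eq_mul_inv, mul_inv]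
    ring
  have hx : ((σ - 1 : ℝ) : ℂ) ^ (κ - s) ≠ 0 := by
    rw [cpow_def_of_ne_zero (by simpa using hσ1)]; exact exp_ne_zero _
  have hy : (σ : ℂ) ^ (-(κ : ℂ)) * (σ : ℂ) ^ (κ - s) = (σ : ℂ) ^ (-s) := by
    rw [← cpow_add _ _ hσc]; congr 1; ring
  rw [hd, ← hy]
  push_cast at hx ⊢
  field_simp

end RadialSolution

/-! ### Radial functions on the domain and integrals over shells. -/

theorem contDiff_rho (A : ℂ × ℂ) {n : WithTop ℕ∞} : ContDiff ℝ n (rho A) := by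
  unfold rho
  exact (contDiff_const.add contDiff_fst).sub (contDiff_const.mul contDiff_snd)

theorem contDiff_rhoDiag_real {n : WithTop ℕ∞} : ContDiff ℝ n rhoDiag :=
  reCLM.contDiff.comp contDiff_rhoDiag

theorem contDiffOn_phaseH (m : ℤ) {A : ℂ × ℂ} (hA : A ∈ siegelDomain) {n : WithTop ℕ∞} :
    ContDiffOn ℝ n (phaseH m A) siegelDomain := by
  have hl : ContDiffOn ℝ n (fun Z => log (rho A Z)) siegelDomain := fun Z hZ =>
    (((contDiffAt_log (Or.inl (re_rho_pos hA hZ))).restrict_scalars ℝ).comp Z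
      (contDiff_rho A).contDiffAt).contDiffWithinAt
  have hc : ContDiffOn ℝ n (fun Z => conjCLE (log (rho A Z))) siegelDomain :=
    conjCLE.contDiff.comp_contDiffOn hl
  have he : ContDiff ℝ n (exp : ℂ → ℂ) := (contDiff_exp (𝕜 := ℂ)).restrict_scalars ℝ
  exact (he.comp_contDiffOn (contDiffOn_const.mul (hl.sub hc))).congr fun Z hZ =>
    phaseH_eq_exp m (rho_ne_zero hA hZ)

theorem contDiffOn_sigmaInv {A : ℂ × ℂ} (hA : A ∈ siegelDomain) {n : WithTop ℕ∞} :
    ContDiffOn ℝ n (sigmaInv A) siegelDomain := by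
  unfold sigmaInv
  refine ContDiffOn.div ((contDiff_rho A).norm_sq ℝ).contDiffOn
    (contDiff_const.mul contDiff_rhoDiag_real).contDiffOn fun Z hZ => ?_
  exact (mul_pos (show 0 < rhoDiag A from hA) (show 0 < rhoDiag Z from hZ)).ne'

section RadialFunctions

variable {Ψ : ℝ → ℂ} {a b : ℝ}

theorem tsupport_radial (m : ℤ) {A : ℂ × ℂ} (hA : A ∈ siegelDomain) (ha : 0 < a)
    (hΨ : ∀ t, t < a ∨ b < t → Ψ t = 0) :
    tsupport (fun Z => phaseH m A Z * Ψ (sigmaInv A Z)) ⊆ {Z | Z ∈ siegelDomain ∧ sigmaInv A Z ≤ b} := by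
  refine closure_minimal (fun Z hZ => ?_) (isCompact_sigmaInv_le hA b).isClosed
  rw [Function.mem_support] at hZ
  have hne : Ψ (sigmaInv A Z) ≠ 0 := right_ne_zero_of_mul hZ
  refine ⟨?_, ?_⟩
  · by_contra h
    exact hne (hΨ _ (Or.inl ((sigmaInv_nonpos_of_notMem hA h).trans_lt ha)))
  · by_contra h
    exact hne (hΨ _ (Or.inr (not_le.1 h)))

theorem hasCompactSupport_radial (m : ℤ) {A : ℂ × ℂ} (hA : A ∈ siegelDomain) (ha : 0 < a)
    (hΨ : ∀ t, t < a ∨ b < t → Ψ t = 0) :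
    HasCompactSupport (fun Z => phaseH m A Z * Ψ (sigmaInv A Z)) :=
  (isCompact_sigmaInv_le hA b).of_isClosed_subset (isClosed_tsupport _) (tsupport_radial m hA ha hΨ)

theorem tsupport_radial_subset (m : ℤ) {A : ℂ × ℂ} (hA : A ∈ siegelDomain) (ha : 0 < a)
    (hΨ : ∀ t, t < a ∨ b < t → Ψ t = 0) :
    tsupport (fun Z => phaseH m A Z * Ψ (sigmaInv A Z)) ⊆ siegelDomain :=
  (tsupport_radial m hA ha hΨ).trans fun _ h => h.1

theorem contDiff_radial (m : ℤ) {A : ℂ × ℂ} (hA : A ∈ siegelDomain) (ha : 0 < a)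
    (hΨ : ∀ t, t < a ∨ b < t → Ψ t = 0) {n : WithTop ℕ∞} (h : ContDiff ℝ n Ψ) :
    ContDiff ℝ n (fun Z => phaseH m A Z * Ψ (sigmaInv A Z)) := by
  rw [contDiff_iff_contDiffAt]
  intro Z
  by_cases hZ : Z ∈ siegelDomain
  · exact ((contDiffOn_phaseH m hA).mul (h.comp_contDiffOn (contDiffOn_sigmaInv hA))).contDiffAt
      (isOpen_siegelDomain.mem_nhds hZ)
  · have := notMem_tsupport_iff_eventuallyEq.1 fun h => hZ (tsupport_radial_subset m hA ha hΨ h)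
    exact contDiffAt_const.congr_of_eventuallyEq this

theorem integrable_radial_mul (m : ℤ) (A : siegelDomain) (ha : 0 < a)
    (hΨ : ∀ t, t < a ∨ b < t → Ψ t = 0) (h : Continuous Ψ) {g : ℂ × ℂ → ℂ}
    (hg : ContinuousOn g siegelDomain) :
    Integrable (fun Z : siegelDomain => phaseH m A Z * Ψ (sigmaInv A Z) * g Z) siegelMeasure :=
  integrable_siegelMeasure_of_compact_left
    (f := fun Z => phaseH m A Z * Ψ (sigmaInv A Z)) (contDiff_zero.1 (contDiff_radial m A.2 ha hΨ (contDiff_zero.2 h)))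
    (hasCompactSupport_radial m A.2 ha hΨ) (tsupport_radial_subset m A.2 ha hΨ) hg

/-- The constant relating the volume of shells to `(σ - 1) dσ`. -/
noncomputable def shellConst : ℝ := (8 * ballVolume).toReal

theorem shellConst_pos : 0 < shellConst :=
  ENNReal.toReal_pos (mul_ne_zero (by norm_num) ballVolume_ne_zero)
    (ENNReal.mul_ne_top (by norm_num) ballVolume_ne_top)

theorem lintegral_radial (A : siegelDomain) {F : ℝ → ENNReal} (hF : Measurable F) :
    ∫⁻ Z : siegelDomain, F (sigmaInv A Z) ∂siegelMeasure
      = 8 * ballVolume * ∫⁻ t in Set.Ioi (1 : ℝ), ENNReal.ofReal (t - 1) * F t := by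
  rw [← lintegral_map hF (continuous_sigmaInv A).measurable, map_sigmaInv_siegelMeasure,
    lintegral_smul_measure, radialMeasure, lintegral_withDensity_eq_lintegral_mul _ (by fun_prop) hF]
  rfl

theorem integral_radial (A : siegelDomain) {F : ℝ → ℂ} (hF : Continuous F) :
    ∫ Z : siegelDomain, F (sigmaInv A Z) ∂siegelMeasure
      = shellConst * ∫ t in Set.Ioi (1 : ℝ), ((t - 1 : ℝ) : ℂ) * F t := by
  rw [← integral_map (continuous_sigmaInv A).measurable.aemeasurable hF.aestronglyMeasurable,
    map_sigmaInv_siegelMeasure, integral_smul_measure, radialMeasure,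
    integral_withDensity_eq_integral_toReal_smul (by fun_prop) (by simp)]
  rw [shellConst, real_smul]
  congr 1
  refine setIntegral_congr_fun measurableSet_Ioi fun t ht => ?_
  have : 0 ≤ t - 1 := by linarith [Set.mem_Ioi.1 ht]
  simp only [ENNReal.toReal_ofReal this, real_smul]

theorem integral_Ioi_eq_of_shell {F : ℝ → ℂ} {δ : ℝ} (hδ : 0 < δ)
    (hF : ∀ t, t < 1 + δ ∨ 1 + 2 * δ < t → F t = 0) :
    ∫ t in Set.Ioi (1 : ℝ), ((t - 1 : ℝ) : ℂ) * F t
      = ∫ x in (1 : ℝ)..2, (δ ^ 2 * x : ℂ) * F (1 + δ * x) := by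
  have h1 : ∫ t in Set.Ioi (1 : ℝ), ((t - 1 : ℝ) : ℂ) * F t
      = ∫ t in (1 + δ * 1)..(1 + δ * 2), ((t - 1 : ℝ) : ℂ) * F t := by
    rw [intervalIntegral.integral_of_le (by linarith), ← integral_Icc_eq_integral_Ioc]
    refine setIntegral_eq_of_subset_of_forall_sdiff_eq_zero measurableSet_Ioi (fun t ht => ?_)
      fun t ht => ?_
    · exact Set.mem_Ioi.2 (by linarith [(Set.mem_Icc.1 ht).1])
    · rw [hF t, mul_zero]
      by_contra hcon
      push Not at hcon
      exact ht.2 ⟨by linarith [hcon.1], by linarith [hcon.2]⟩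
  rw [h1, ← intervalIntegral.smul_integral_comp_add_mul, ← intervalIntegral.integral_smul]
  congr 1
  ext x
  rw [real_smul]
  push_cast
  ring

theorem integral_radial_shell (A : siegelDomain) {F : ℝ → ℂ} (hFc : Continuous F) {δ : ℝ} (hδ : 0 < δ)
    (hF : ∀ t, t < 1 + δ ∨ 1 + 2 * δ < t → F t = 0) :
    ∫ Z : siegelDomain, F (sigmaInv A Z) ∂siegelMeasure
      = shellConst * ∫ x in (1 : ℝ)..2, (δ ^ 2 * x : ℂ) * F (1 + δ * x) := by
  rw [integral_radial A hFc, integral_Ioi_eq_of_shell hδ hF]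

/-- Integrals over shells are bounded by the rescaled supremum of the radial function. -/
theorem norm_integral_radial_shell_le (A : siegelDomain) {F : ℝ → ℂ} (hFc : Continuous F) {δ : ℝ}
    (hδ : 0 < δ) (hF : ∀ t, t < 1 + δ ∨ 1 + 2 * δ < t → F t = 0) {M : ℝ}
    (hM : ∀ x ∈ Set.Icc (1 : ℝ) 2, ‖(δ ^ 2 * x : ℂ) * F (1 + δ * x)‖ ≤ M)
    {G : siegelDomain → ℂ} {B : ℝ}
    (hG : ∀ Z : siegelDomain, sigmaInv A Z ≤ 1 + 2 * δ → ‖G Z‖ ≤ B) :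
    ‖∫ Z : siegelDomain, F (sigmaInv A Z) * G Z ∂siegelMeasure‖ ≤ shellConst * M * B := by
  have hB : 0 ≤ B := (norm_nonneg _).trans (hG A (by rw [sigmaInv_self A.2]; linarith))
  have hFn : ∀ t, t < 1 + δ ∨ 1 + 2 * δ < t → ((‖F t‖ : ℝ) : ℂ) = 0 := fun t ht => by simp [hF t ht]
  have hint : Integrable (fun Z : siegelDomain => ‖F (sigmaInv A Z)‖) siegelMeasure := by
    have := (integrable_radial_mul 0 A (a := 1 + δ) (by linarith) hF hFc (g := fun _ => 1)
      continuousOn_const).norm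
    simpa [phaseH] using this
  have h1 : ‖∫ Z : siegelDomain, F (sigmaInv A Z) * G Z ∂siegelMeasure‖
      ≤ ∫ Z : siegelDomain, B * ‖F (sigmaInv A Z)‖ ∂siegelMeasure := by
    refine norm_integral_le_of_norm_le (hint.const_mul B) (ae_of_all _ fun Z => ?_)
    rw [norm_mul, mul_comm]
    rcases le_or_gt (sigmaInv A Z) (1 + 2 * δ) with h | h
    · exact mul_le_mul_of_nonneg_right (hG Z h) (norm_nonneg _)
    · rw [hF _ (Or.inr h)]; simp
  have h2 := integral_radial_shell A (F := fun t => ((‖F t‖ : ℝ) : ℂ)) (by fun_prop) hδ hFn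
  have h3 : ∫ Z : siegelDomain, ‖F (sigmaInv A Z)‖ ∂siegelMeasure ≤ shellConst * M := by
    have h4 : ‖∫ x in (1 : ℝ)..2, (δ ^ 2 * x : ℂ) * ((‖F (1 + δ * x)‖ : ℝ) : ℂ)‖ ≤ M * |2 - 1| := by
      refine intervalIntegral.norm_integral_le_of_norm_le_const fun x hx => ?_
      rw [Set.uIoc_of_le (by norm_num)] at hx
      have := hM x ⟨hx.1.le, hx.2⟩
      rw [norm_mul] at this ⊢
      simpa using this
    rw [integral_complex_ofReal] at h2
    have h5 := congrArg norm h2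
    rw [norm_mul, norm_real, norm_real, Real.norm_of_nonneg (integral_nonneg fun _ => norm_nonneg _),
      Real.norm_of_nonneg shellConst_pos.le] at h5
    rw [h5]
    have := shellConst_pos
    gcongr
    simpa using h4.trans (by norm_num)
  rw [integral_const_mul] at h1
  calc _ ≤ _ := h1
    _ ≤ B * (shellConst * M) := by gcongr
    _ = _ := by ring

end RadialFunctions

/-! ### The cutoff and its commutator with the radial operator. -/

/-- A smooth transition from `0` on `x ≤ 1` to `1` on `2 ≤ x`. -/
noncomputable def cut (x : ℝ) : ℝ := Real.smoothTransition (x - 1)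

theorem contDiff_cut {n : ℕ∞} : ContDiff ℝ n cut :=
  Real.smoothTransition.contDiff.comp (contDiff_id.sub contDiff_const)

theorem cut_of_le_one {x : ℝ} (h : x ≤ 1) : cut x = 0 :=
  Real.smoothTransition.zero_of_nonpos (by linarith)

theorem cut_of_two_le {x : ℝ} (h : 2 ≤ x) : cut x = 1 :=
  Real.smoothTransition.one_of_one_le (by linarith)

theorem cut_nonneg (x : ℝ) : 0 ≤ cut x := Real.smoothTransition.nonneg _

theorem cut_le_one (x : ℝ) : cut x ≤ 1 := Real.smoothTransition.le_one _

/-- The derivative of `cut`. -/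
noncomputable def cutDeriv : ℝ → ℝ := deriv cut

/-- The second derivative of `cut`. -/
noncomputable def cutDeriv₂ : ℝ → ℝ := deriv cutDeriv

theorem contDiff_cutDeriv : ContDiff ℝ 1 cutDeriv :=
  (contDiff_succ_iff_deriv.1 (contDiff_cut (n := 2))).2.2

theorem hasDerivAt_cut (x : ℝ) : HasDerivAt cut (cutDeriv x) x :=
  ((contDiff_cut (n := 1)).differentiable (by norm_num) x).hasDerivAt

theorem hasDerivAt_cutDeriv (x : ℝ) : HasDerivAt cutDeriv (cutDeriv₂ x) x :=
  (contDiff_cutDeriv.differentiable (by norm_num) x).hasDerivAt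

theorem continuous_cutDeriv : Continuous cutDeriv := contDiff_cutDeriv.continuous

theorem continuous_cutDeriv₂ : Continuous cutDeriv₂ :=
  contDiff_cutDeriv.continuous_deriv (by norm_num)

theorem cutDeriv_one : cutDeriv 1 = 0 :=
  IsLocalMin.deriv_eq_zero (Eventually.of_forall fun x => by
    rw [cut_of_le_one le_rfl]; exact cut_nonneg x)

theorem cutDeriv_two : cutDeriv 2 = 0 :=
  IsLocalMax.deriv_eq_zero (Eventually.of_forall fun x => by
    rw [cut_of_two_le le_rfl]; exact cut_le_one x)

theorem cutDeriv_of_lt_or_lt {x : ℝ} (h : x < 1 ∨ 2 < x) : cutDeriv x = 0 := by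
  rcases h with h | h
  · have : cut =ᶠ[𝓝 x] fun _ => 0 := by
      filter_upwards [Iio_mem_nhds h] with y hy using cut_of_le_one (Set.mem_Iio.1 hy).le
    rw [cutDeriv, this.deriv_eq, deriv_const]
  · have : cut =ᶠ[𝓝 x] fun _ => 1 := by
      filter_upwards [Ioi_mem_nhds h] with y hy using cut_of_two_le (Set.mem_Ioi.1 hy).le
    rw [cutDeriv, this.deriv_eq, deriv_const]

theorem cutDeriv₂_of_lt_or_lt {x : ℝ} (h : x < 1 ∨ 2 < x) : cutDeriv₂ x = 0 := by
  have : cutDeriv =ᶠ[𝓝 x] fun _ => 0 := by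
    rcases h with h | h
    · filter_upwards [Iio_mem_nhds h] with y hy using cutDeriv_of_lt_or_lt (Or.inl hy)
    · filter_upwards [Ioi_mem_nhds h] with y hy using cutDeriv_of_lt_or_lt (Or.inr hy)
  rw [cutDeriv₂, this.deriv_eq, deriv_const]

/-- Integrating by parts, the boundary terms vanish and `-(cut 2 - cut 1)` remains. This is why the
mass of the limiting point measure does not depend on the choice of cutoff. -/
theorem integral_mul_cutDeriv₂ : ∫ x in (1 : ℝ)..2, x * cutDeriv₂ x = -1 := by
  rw [intervalIntegral.integral_mul_deriv_eq_deriv_mul (u' := fun _ => 1)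
    (fun x _ => hasDerivAt_id' x) (fun x _ => hasDerivAt_cutDeriv x)
    (by simp) (continuous_cutDeriv₂.intervalIntegrable _ _), cutDeriv_one, cutDeriv_two]
  simp only [one_mul]
  rw [intervalIntegral.integral_eq_sub_of_hasDerivAt (fun x _ => hasDerivAt_cut x)
    (continuous_cutDeriv.intervalIntegrable _ _), cut_of_two_le le_rfl, cut_of_le_one le_rfl]
  norm_num

theorem exists_cutDeriv_bound : ∃ M : ℝ, 0 < M ∧ ∀ x ∈ Set.Icc (1 : ℝ) 2,
    |cutDeriv x| ≤ M ∧ |cutDeriv₂ x| ≤ M := by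
  obtain ⟨a, ha⟩ := isCompact_Icc.exists_bound_of_continuousOn (s := Set.Icc (1 : ℝ) 2)
    continuous_cutDeriv.continuousOn
  obtain ⟨b, hb⟩ := isCompact_Icc.exists_bound_of_continuousOn (s := Set.Icc (1 : ℝ) 2)
    continuous_cutDeriv₂.continuousOn
  exact ⟨max (max a b) 1, by positivity, fun x hx =>
    ⟨(ha x hx).trans (le_max_of_le_left (le_max_left _ _)),
      (hb x hx).trans (le_max_of_le_left (le_max_right _ _))⟩⟩

section Commutator

variable {s : ℂ} {κ : ℝ}

theorem continuousOn_radialSol (s : ℂ) (κ : ℝ) : ContinuousOn (radialSol s κ) (Set.Ioi 1) :=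
  fun _ hσ => (hasDerivAt_radialSol s κ hσ).continuousAt.continuousWithinAt

theorem continuousOn_radialSolDeriv (s : ℂ) (κ : ℝ) :
    ContinuousOn (radialSolDeriv s κ) (Set.Ioi 1) :=
  fun _ hσ => (hasDerivAt_radialSolDeriv s κ hσ).continuousAt.continuousWithinAt

theorem continuousOn_radialSolDeriv₂ (s : ℂ) (κ : ℝ) :
    ContinuousOn (radialSolDeriv₂ s κ) (Set.Ioi 1) := fun _ hσ =>
  (hasDerivAt_cpow_mul_powerSum (((((unitDiscSummable_radialCoeff s κ).add_nat_mul s).const_mul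
    (-1)).add_nat_mul (s + 1)).const_mul (-1)) (s + 1 + 1) hσ).continuousAt.continuousWithinAt

theorem continuous_of_eq_zero_of_lt {F : ℝ → ℂ} {a : ℝ} (ha : 1 < a)
    (hF : ContinuousOn F (Set.Ioi 1)) (h0 : ∀ t < a, F t = 0) : Continuous F := by
  rw [continuous_iff_continuousAt]
  intro t
  rcases lt_or_ge t a with h | h
  · refine (continuousAt_const (y := (0 : ℂ))).congr ?_
    filter_upwards [Iio_mem_nhds h] with x hx using (h0 x hx).symm
  · exact hF.continuousAt (Ioi_mem_nhds (by linarith))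

/-- The commutator of the radial operator with multiplication by `cut ((σ - 1) / δ)`, applied to
`radialSol`. -/
noncomputable def cutErr (s : ℂ) (κ δ σ : ℝ) : ℂ :=
  σ * (σ - 1) * ((cutDeriv₂ ((σ - 1) / δ) / δ ^ 2 : ℝ) * radialSol s κ σ
    + 2 * ((cutDeriv ((σ - 1) / δ) / δ : ℝ) * radialSolDeriv s κ σ))
    + (3 * σ - 1) * ((cutDeriv ((σ - 1) / δ) / δ : ℝ) * radialSol s κ σ)

theorem shell_iff {δ t : ℝ} (hδ : 0 < δ) (h : t < 1 + δ ∨ 1 + 2 * δ < t) :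
    (t - 1) / δ < 1 ∨ 2 < (t - 1) / δ := by
  rw [div_lt_iff₀ hδ, lt_div_iff₀ hδ]
  rcases h with h | h
  · left; linarith
  · right; linarith

theorem cutErr_eq_zero {δ t : ℝ} (hδ : 0 < δ) (h : t < 1 + δ ∨ 1 + 2 * δ < t) :
    cutErr s κ δ t = 0 := by
  have := shell_iff hδ h
  rw [cutErr, cutDeriv_of_lt_or_lt this, cutDeriv₂_of_lt_or_lt this]
  simp

theorem continuous_cutErr (s : ℂ) (κ : ℝ) {δ : ℝ} (hδ : 0 < δ) : Continuous (cutErr s κ δ) := by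
  refine continuous_of_eq_zero_of_lt (a := 1 + δ) (by linarith) ?_ fun t ht =>
    cutErr_eq_zero hδ (Or.inl ht)
  have h0 := continuousOn_radialSol s κ
  have h1 := continuousOn_radialSolDeriv s κ
  have c1 := continuous_cutDeriv
  have c2 := continuous_cutDeriv₂
  have d1 : ContinuousOn (fun σ : ℝ => ((cutDeriv ((σ - 1) / δ) / δ : ℝ) : ℂ)) (Set.Ioi 1) := by
    fun_prop
  have d2 : ContinuousOn (fun σ : ℝ => ((cutDeriv₂ ((σ - 1) / δ) / δ ^ 2 : ℝ) : ℂ)) (Set.Ioi 1) := by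
    fun_prop
  have d3 : ContinuousOn (fun σ : ℝ => (σ : ℂ)) (Set.Ioi 1) := continuous_ofReal.continuousOn
  exact ((d3.mul (d3.sub continuousOn_const)).mul ((d2.mul h0).add
    (continuousOn_const.mul (d1.mul h1)))).add
    (((continuousOn_const.mul d3).sub continuousOn_const).mul (d1.mul h0))

/-- A normal form in which the solution enters only through `δ φ` and `δ² φ'`. These converge to
`r/x` and `-r/x²` as `δ → 0`; the same form gives the estimate for large `δ`. -/
theorem cutErr_rescaled {δ : ℝ} (hδ : 0 < δ) (x : ℝ) :
    (δ ^ 2 * x : ℂ) * cutErr s κ δ (1 + δ * x) =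
      x * ((1 + δ * x) * x * (cutDeriv₂ x * (δ * radialSol s κ (1 + δ * x))
        + 2 * (cutDeriv x * (δ ^ 2 * radialSolDeriv s κ (1 + δ * x))))
        + (3 * δ * x + 2) * (cutDeriv x * (δ * radialSol s κ (1 + δ * x)))) := by
  have h : (1 + δ * x - 1) / δ = x := by field_simp; ring
  have hδ' : (δ : ℂ) ≠ 0 := by exact_mod_cast hδ.ne'
  rw [cutErr, h]
  push_cast
  field_simp
  ring

theorem norm_cutErr_rescaled_le {δ M P Q : ℝ} (hδ : 0 < δ) {x : ℝ} (hx : x ∈ Set.Icc (1 : ℝ) 2)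
    (hM : |cutDeriv x| ≤ M ∧ |cutDeriv₂ x| ≤ M) (hP : ‖(δ : ℂ) * radialSol s κ (1 + δ * x)‖ ≤ P)
    (hQ : ‖(δ : ℂ) ^ 2 * radialSolDeriv s κ (1 + δ * x)‖ ≤ Q) :
    ‖(δ ^ 2 * x : ℂ) * cutErr s κ δ (1 + δ * x)‖ ≤ (1 + 3 * δ) * (8 * M * (P + Q)) := by
  rw [cutErr_rescaled hδ]
  generalize (δ : ℂ) * radialSol s κ (1 + δ * x) = p at *
  generalize (δ : ℂ) ^ 2 * radialSolDeriv s κ (1 + δ * x) = q at *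
  have hM0 : 0 ≤ M := (abs_nonneg _).trans hM.1
  have hP0 : 0 ≤ P := (norm_nonneg _).trans hP
  have hQ0 : 0 ≤ Q := (norm_nonneg _).trans hQ
  have hx1 : ‖(x : ℂ)‖ ≤ 2 := by
    rw [norm_real, Real.norm_of_nonneg (by linarith [hx.1])]; exact hx.2
  have e1 : ‖1 + (δ : ℂ) * x‖ ≤ 1 + 2 * δ := by
    have : 1 + (δ : ℂ) * x = ((1 + δ * x : ℝ) : ℂ) := by push_cast; ring
    rw [this, norm_real, Real.norm_of_nonneg (by nlinarith [hx.1])]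
    nlinarith [hx.2]
  have e2 : ‖3 * (δ : ℂ) * x + 2‖ ≤ 6 * δ + 2 := by
    have : 3 * (δ : ℂ) * x + 2 = ((3 * δ * x + 2 : ℝ) : ℂ) := by push_cast; ring
    rw [this, norm_real, Real.norm_of_nonneg (by nlinarith [hx.1])]
    nlinarith [hx.2]
  have f1 : ‖(cutDeriv x : ℂ)‖ ≤ M := by rw [norm_real]; exact hM.1
  have f2 : ‖(cutDeriv₂ x : ℂ)‖ ≤ M := by rw [norm_real]; exact hM.2
  calc _ ≤ ‖(x : ℂ)‖ * (‖1 + (δ : ℂ) * x‖ * ‖(x : ℂ)‖ * (‖(cutDeriv₂ x : ℂ)‖ * ‖p‖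
        + 2 * (‖(cutDeriv x : ℂ)‖ * ‖q‖)) + ‖3 * (δ : ℂ) * x + 2‖ * (‖(cutDeriv x : ℂ)‖ * ‖p‖)) := by
        rw [norm_mul]
        gcongr
        refine (norm_add_le _ _).trans ?_
        rw [norm_mul, norm_mul, norm_mul, norm_mul]
        gcongr
        refine (norm_add_le _ _).trans ?_
        rw [norm_mul, norm_mul, norm_mul]
        norm_num
    _ ≤ 2 * ((1 + 2 * δ) * 2 * (M * P + 2 * (M * Q)) + (6 * δ + 2) * (M * P)) := by gcongr
    _ ≤ _ := by
        have := mul_nonneg hM0 hP0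
        have := mul_nonneg hM0 hQ0
        have := mul_nonneg hδ.le (mul_nonneg hM0 hP0)
        have := mul_nonneg hδ.le (mul_nonneg hM0 hQ0)
        nlinarith

theorem eventually_shell_nhdsGT_one {p : ℝ → Prop} (h : ∀ᶠ σ in 𝓝[>] (1 : ℝ), p σ) :
    ∀ᶠ δ in 𝓝[>] (0 : ℝ), ∀ x ∈ Set.Icc (1 : ℝ) 2, p (1 + δ * x) := by
  obtain ⟨b, hb, hbp⟩ := (mem_nhdsGT_iff_exists_Ioo_subset' (one_lt_two)).1 h
  have hb' : 1 < b := hb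
  filter_upwards [Ioo_mem_nhdsGT (show (0 : ℝ) < (b - 1) / 2 by linarith)] with δ hδ x hx
  refine hbp ⟨?_, ?_⟩
  · nlinarith [hx.1, hδ.1]
  · nlinarith [hx.2, hδ.1, hδ.2]

/-- Uniform bound of the rescaled commutator near the singularity. -/
theorem exists_norm_cutErr_rescaled_le (hc : ∀ n : ℕ, 2 * s - 1 + n ≠ 0) :
    ∃ K : ℝ, ∀ᶠ δ : ℝ in 𝓝[>] 0, ∀ x ∈ Set.Icc (1 : ℝ) 2,
      ‖((δ : ℂ) ^ 2 * x) * cutErr s κ δ (1 + δ * x)‖ ≤ K := by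
  obtain ⟨M, hM0, hM⟩ := exists_cutDeriv_bound
  have h0 := eventually_shell_nhdsGT_one
    ((tendsto_sub_one_mul_radialSol (κ := κ) hc).norm.eventually_le_const (lt_add_one _))
  have h1 := eventually_shell_nhdsGT_one
    ((tendsto_sub_one_sq_mul_radialSolDeriv (κ := κ) hc).norm.eventually_le_const (lt_add_one _))
  refine ⟨4 * (8 * M * ((‖radialResidue s κ‖ + 1) + (‖-radialResidue s κ‖ + 1))), ?_⟩
  filter_upwards [h0, h1, Ioo_mem_nhdsGT (zero_lt_one)] with δ p0 p1 hδ x hx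
  have hδ0 : 0 < δ := hδ.1
  have hx1 : 1 ≤ ‖(x : ℂ)‖ := by
    rw [norm_real]; exact hx.1.trans (le_abs_self _)
  refine (norm_cutErr_rescaled_le hδ0 hx (hM x hx) (P := ‖radialResidue s κ‖ + 1)
    (Q := ‖-radialResidue s κ‖ + 1) ?_ ?_).trans ?_
  · refine le_trans ?_ (p0 x hx)
    rw [norm_mul, norm_mul]
    have : ((1 + δ * x : ℝ) : ℂ) - 1 = δ * x := by push_cast; ring
    rw [this, norm_mul]
    gcongr
    exact le_mul_of_one_le_right (norm_nonneg _) hx1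
  · refine le_trans ?_ (p1 x hx)
    rw [norm_mul, norm_mul]
    have : ((1 + δ * x : ℝ) : ℂ) - 1 = δ * x := by push_cast; ring
    rw [this, mul_pow, norm_mul, norm_pow (x : ℂ)]
    gcongr
    exact le_mul_of_one_le_right (norm_nonneg _) (one_le_pow₀ hx1)
  · have : 1 + 3 * δ ≤ 4 := by linarith [hδ.2]
    gcongr

/-- With the limits `r/x` and `-r/x²` inserted, the terms with the first derivative of the cutoff
cancel and the integrand tends to `r x` times its second derivative. Dominated convergence then
reduces to `integral_mul_cutDeriv₂`. -/
theorem tendsto_integral_cutErr_rescaled (hc : ∀ n : ℕ, 2 * s - 1 + n ≠ 0) :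
    Tendsto (fun δ : ℝ => ∫ x in (1 : ℝ)..2, (δ ^ 2 * x : ℂ) * cutErr s κ δ (1 + δ * x)) (𝓝[>] 0)
      (𝓝 (-radialResidue s κ)) := by
  obtain ⟨K, hK⟩ := exists_norm_cutErr_rescaled_le (κ := κ) hc
  have hlim : ∫ x in (1 : ℝ)..2, radialResidue s κ * ((x * cutDeriv₂ x : ℝ) : ℂ)
      = -radialResidue s κ := by
    rw [intervalIntegral.integral_const_mul, intervalIntegral.integral_ofReal,
      integral_mul_cutDeriv₂]
    simp
  rw [← hlim]
  refine intervalIntegral.tendsto_integral_filter_of_dominated_convergence (fun _ => K) ?_ ?_ ?_ ?_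
  · filter_upwards [self_mem_nhdsWithin] with δ hδ
    have := continuous_cutErr s κ (Set.mem_Ioi.1 hδ)
    exact (by fun_prop : Continuous fun x : ℝ => (δ ^ 2 * x : ℂ) * cutErr s κ δ (1 + δ * x)).aestronglyMeasurable
  · filter_upwards [hK] with δ h
    refine ae_of_all _ fun x hx => ?_
    rw [Set.uIoc_of_le (by norm_num)] at hx
    exact h x ⟨hx.1.le, hx.2⟩
  · simp
  · refine ae_of_all _ fun x hx => ?_
    rw [Set.uIoc_of_le (by norm_num)] at hx
    have hx0 : 0 < x := by linarith [hx.1]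
    have hxc : (x : ℂ) ≠ 0 := by exact_mod_cast hx0.ne'
    have ht : Tendsto (fun δ : ℝ => 1 + δ * x) (𝓝[>] 0) (𝓝[>] 1) := by
      refine tendsto_nhdsWithin_iff.2 ⟨?_, ?_⟩
      · have : Continuous fun δ : ℝ => 1 + δ * x := by fun_prop
        simpa using (this.tendsto 0).mono_left nhdsWithin_le_nhds
      · filter_upwards [self_mem_nhdsWithin] with δ hδ
        have := Set.mem_Ioi.1 hδ
        exact Set.mem_Ioi.2 (by nlinarith)
    have t0 := ((tendsto_sub_one_mul_radialSol (κ := κ) hc).comp ht).const_mul ((x : ℂ)⁻¹)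
    have t1 := ((tendsto_sub_one_sq_mul_radialSolDeriv (κ := κ) hc).comp ht).const_mul ((x : ℂ)⁻¹ ^ 2)
    have tδ : Tendsto (fun δ : ℝ => (δ : ℂ)) (𝓝[>] 0) (𝓝 0) := by
      simpa using (continuous_ofReal.tendsto 0).mono_left nhdsWithin_le_nhds
    have t2 : Tendsto (fun δ : ℝ => (1 + (δ : ℂ) * x)) (𝓝[>] 0) (𝓝 1) := by
      simpa using (tδ.mul_const (x : ℂ)).const_add 1
    have t3 : Tendsto (fun δ : ℝ => (3 * (δ : ℂ) * x + 2)) (𝓝[>] 0) (𝓝 2) := by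
      simpa using ((tδ.const_mul 3).mul_const (x : ℂ)).add_const 2
    have key := (((t2.mul_const (x : ℂ)).mul ((t0.const_mul (cutDeriv₂ x : ℂ)).add
      ((t1.const_mul (cutDeriv x : ℂ)).const_mul 2))).add
      (t3.mul (t0.const_mul (cutDeriv x : ℂ)))).const_mul (x : ℂ)
    have hval : (x : ℂ) * (1 * x * (cutDeriv₂ x * ((x : ℂ)⁻¹ * radialResidue s κ)
        + 2 * (cutDeriv x * ((x : ℂ)⁻¹ ^ 2 * -radialResidue s κ)))
        + 2 * (cutDeriv x * ((x : ℂ)⁻¹ * radialResidue s κ)))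
        = radialResidue s κ * ((x * cutDeriv₂ x : ℝ) : ℂ) := by
      push_cast
      field_simp
      ring
    rw [hval] at key
    refine key.congr' ?_
    filter_upwards [self_mem_nhdsWithin] with δ hδ
    rw [cutErr_rescaled (Set.mem_Ioi.1 hδ)]
    simp only [Function.comp_apply]
    push_cast
    field_simp
    ring

end Commutator

/-! ### Cutting off the kernel near its singularity and at infinity. -/

theorem ae_one_lt_sigmaInv (A : siegelDomain) : ∀ᵐ Z : siegelDomain ∂siegelMeasure, 1 < sigmaInv A Z := by
  have h := lintegral_radial A (F := (Set.Iic 1).indicator 1) (measurable_one.indicator measurableSet_Iic)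
  have h0 : ∫⁻ t in Set.Ioi (1 : ℝ), ENNReal.ofReal (t - 1) * (Set.Iic 1).indicator 1 t = 0 := by
    rw [setLIntegral_congr_fun (g := fun _ => 0) measurableSet_Ioi, lintegral_zero]
    intro t ht
    have : t ∉ Set.Iic (1 : ℝ) := fun h => not_le.2 (Set.mem_Ioi.1 ht) (Set.mem_Iic.1 h)
    simp only [Set.indicator_of_notMem this, mul_zero]
  rw [h0, mul_zero] at h
  have hm : Measurable fun Z : siegelDomain => (Set.Iic (1 : ℝ)).indicator (1 : ℝ → ENNReal) (sigmaInv A Z) :=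
    (measurable_one.indicator measurableSet_Iic).comp (continuous_sigmaInv A).measurable
  filter_upwards [(lintegral_eq_zero_iff hm).1 h] with Z hZ
  by_contra hcon
  have : sigmaInv A Z ∈ Set.Iic (1 : ℝ) := not_lt.1 hcon
  simp [Set.indicator_of_mem this] at hZ

theorem contDiff_two_of_hasDerivAt {f f₁ f₂ : ℝ → ℂ} (h1 : ∀ t, HasDerivAt f (f₁ t) t)
    (h2 : ∀ t, HasDerivAt f₁ (f₂ t) t) (hc : Continuous f₂) : ContDiff ℝ 2 f := by
  have e1 : deriv f = f₁ := funext fun t => (h1 t).deriv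
  have e2 : deriv f₁ = f₂ := funext fun t => (h2 t).deriv
  have c1 : ContDiff ℝ 1 f₁ := contDiff_one_iff_deriv.2
    ⟨fun t => (h2 t).differentiableAt, e2 ▸ hc⟩
  have : ContDiff ℝ (1 + 1) f := contDiff_succ_iff_deriv.2
    ⟨fun t => (h1 t).differentiableAt, by simp, e1 ▸ c1⟩
  exact this.of_le (by norm_num)

/-- A cutoff function which is `1` for `1 + 2δ ≤ σ ≤ 1 + R`, and `0` for `σ ≤ 1 + δ` and
`1 + 2R ≤ σ`. -/
noncomputable def cutDiff (δ R σ : ℝ) : ℝ := cut ((σ - 1) / δ) - cut ((σ - 1) / R)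

/-- The derivative of `cutDiff`. -/
noncomputable def cutDiffDeriv (δ R σ : ℝ) : ℝ :=
  cutDeriv ((σ - 1) / δ) / δ - cutDeriv ((σ - 1) / R) / R

/-- The second derivative of `cutDiff`. -/
noncomputable def cutDiffDeriv₂ (δ R σ : ℝ) : ℝ :=
  cutDeriv₂ ((σ - 1) / δ) / δ ^ 2 - cutDeriv₂ ((σ - 1) / R) / R ^ 2

section Cutoff

variable {δ R : ℝ}

theorem hasDerivAt_cutDiff (δ R t : ℝ) : HasDerivAt (cutDiff δ R) (cutDiffDeriv δ R t) t := by
  have h (c : ℝ) : HasDerivAt (fun t => cut ((t - 1) / c)) (cutDeriv ((t - 1) / c) * (1 / c)) t :=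
    (hasDerivAt_cut _).comp t (((hasDerivAt_id t).sub_const 1).div_const c)
  convert! (h δ).sub (h R) using 1
  rw [cutDiffDeriv]; ring

theorem hasDerivAt_cutDiffDeriv (δ R t : ℝ) :
    HasDerivAt (cutDiffDeriv δ R) (cutDiffDeriv₂ δ R t) t := by
  have h (c : ℝ) : HasDerivAt (fun t => cutDeriv ((t - 1) / c) / c)
      (cutDeriv₂ ((t - 1) / c) * (1 / c) / c) t :=
    ((hasDerivAt_cutDeriv _).comp t (((hasDerivAt_id t).sub_const 1).div_const c)).div_const c
  convert! (h δ).sub (h R) using 1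
  rw [cutDiffDeriv₂]; ring

theorem abs_cutDiff_le (δ R t : ℝ) : |cutDiff δ R t| ≤ 1 := by
  rw [cutDiff, abs_le]
  have := cut_nonneg ((t - 1) / δ)
  have := cut_nonneg ((t - 1) / R)
  have := cut_le_one ((t - 1) / δ)
  have := cut_le_one ((t - 1) / R)
  constructor <;> linarith

theorem cutDiff_eq_zero (hδ : 0 < δ) (hR : δ < R) {t : ℝ} (h : t < 1 + δ ∨ 1 + 2 * R < t) :
    cutDiff δ R t = 0 := by
  have hR0 := hδ.trans hR
  rcases h with h | h
  · rw [cutDiff, cut_of_le_one (by rw [div_le_iff₀ hδ]; linarith),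
      cut_of_le_one (by rw [div_le_iff₀ hR0]; linarith), sub_zero]
  · rw [cutDiff, cut_of_two_le (by rw [le_div_iff₀ hδ]; linarith),
      cut_of_two_le (by rw [le_div_iff₀ hR0]; linarith), sub_self]

theorem cutDiffDeriv_eq_zero (hδ : 0 < δ) (hR : δ < R) {t : ℝ} (h : t < 1 + δ) :
    cutDiffDeriv δ R t = 0 ∧ cutDiffDeriv₂ δ R t = 0 := by
  have h1 := shell_iff hδ (Or.inl h)
  have h2 := shell_iff (hδ.trans hR) (Or.inl (h.trans (by linarith : 1 + δ < 1 + R)))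
  simp [cutDiffDeriv, cutDiffDeriv₂, cutDeriv_of_lt_or_lt, cutDeriv₂_of_lt_or_lt, h1, h2]

theorem tendsto_cutDiff {t : ℝ} (ht : 1 < t) :
    Tendsto (fun n : ℕ => cutDiff ((n : ℝ) + 2)⁻¹ (n + 2) t) atTop (𝓝 1) := by
  refine tendsto_const_nhds.congr' ?_
  filter_upwards [(tendsto_natCast_atTop_atTop (R := ℝ)).eventually_ge_atTop (2 / (t - 1)),
    (tendsto_natCast_atTop_atTop (R := ℝ)).eventually_ge_atTop (t - 1)] with n h1 h2
  have ht' : 0 < t - 1 := by linarith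
  rw [div_le_iff₀ ht'] at h1
  rw [cutDiff, cut_of_two_le (by rw [div_inv_eq_mul]; nlinarith),
    cut_of_le_one (by rw [div_le_iff₀ (by positivity)]; linarith), sub_zero]

variable (s : ℂ) (κ : ℝ)

/-- The solution is under control only for `t > 1`; this does no harm, as the cutoff vanishes
identically for `t < 1 + δ`. -/
theorem hasDerivAt_cutDiff_mul (hδ : 0 < δ) (hR : δ < R) (t : ℝ) :
    HasDerivAt (fun t => (cutDiff δ R t : ℂ) * radialSol s κ t)
      (cutDiffDeriv δ R t * radialSol s κ t + cutDiff δ R t * radialSolDeriv s κ t) t := by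
  rcases lt_or_ge t (1 + δ) with h | h
  · rw [(cutDiffDeriv_eq_zero hδ hR h).1, cutDiff_eq_zero hδ hR (Or.inl h)]
    simp only [ofReal_zero, zero_mul, add_zero]
    refine (hasDerivAt_const t (0 : ℂ)).congr_of_eventuallyEq ?_
    filter_upwards [Iio_mem_nhds h] with x hx
    simp [cutDiff_eq_zero hδ hR (Or.inl hx)]
  · exact (hasDerivAt_cutDiff δ R t).ofReal_comp.mul (hasDerivAt_radialSol s κ (by linarith))

theorem hasDerivAt_cutDiff_mul_deriv (hδ : 0 < δ) (hR : δ < R) (t : ℝ) :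
    HasDerivAt (fun t => (cutDiffDeriv δ R t : ℂ) * radialSol s κ t
        + cutDiff δ R t * radialSolDeriv s κ t)
      (cutDiffDeriv₂ δ R t * radialSol s κ t + 2 * (cutDiffDeriv δ R t * radialSolDeriv s κ t)
        + cutDiff δ R t * radialSolDeriv₂ s κ t) t := by
  rcases lt_or_ge t (1 + δ) with h | h
  · rw [(cutDiffDeriv_eq_zero hδ hR h).1, (cutDiffDeriv_eq_zero hδ hR h).2,
      cutDiff_eq_zero hδ hR (Or.inl h)]
    simp only [ofReal_zero, zero_mul, add_zero, mul_zero]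
    refine (hasDerivAt_const t (0 : ℂ)).congr_of_eventuallyEq ?_
    filter_upwards [Iio_mem_nhds h] with x hx
    simp [cutDiff_eq_zero hδ hR (Or.inl hx), (cutDiffDeriv_eq_zero hδ hR hx).1]
  · have h1 : 1 < t := by linarith
    convert! ((hasDerivAt_cutDiffDeriv δ R t).ofReal_comp.mul (hasDerivAt_radialSol s κ h1)).add
      ((hasDerivAt_cutDiff δ R t).ofReal_comp.mul (hasDerivAt_radialSolDeriv s κ h1)) using 1
    ring

theorem contDiff_cutDiff_mul (hδ : 0 < δ) (hR : δ < R) :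
    ContDiff ℝ 2 (fun t => (cutDiff δ R t : ℂ) * radialSol s κ t) := by
  refine contDiff_two_of_hasDerivAt (hasDerivAt_cutDiff_mul s κ hδ hR)
    (hasDerivAt_cutDiff_mul_deriv s κ hδ hR) ?_
  refine continuous_of_eq_zero_of_lt (a := 1 + δ) (by linarith) ?_ fun t ht => ?_
  · have c0 : Continuous (cutDiff δ R) :=
      continuous_iff_continuousAt.2 fun t => (hasDerivAt_cutDiff δ R t).continuousAt
    have c1 : Continuous (cutDiffDeriv δ R) :=
      continuous_iff_continuousAt.2 fun t => (hasDerivAt_cutDiffDeriv δ R t).continuousAt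
    have c2 : Continuous (cutDiffDeriv₂ δ R) := by
      have := continuous_cutDeriv₂
      unfold cutDiffDeriv₂
      fun_prop
    exact (((continuous_ofReal.comp c2).continuousOn.mul (continuousOn_radialSol s κ)).add
      (continuousOn_const.mul ((continuous_ofReal.comp c1).continuousOn.mul
        (continuousOn_radialSolDeriv s κ)))).add
      ((continuous_ofReal.comp c0).continuousOn.mul (continuousOn_radialSolDeriv₂ s κ))
  · simp [(cutDiffDeriv_eq_zero hδ hR ht).1, (cutDiffDeriv_eq_zero hδ hR ht).2,
      cutDiff_eq_zero hδ hR (Or.inl ht)]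

variable {s κ}

theorem radial_operator_cutDiff_mul (hc : ∀ n : ℕ, 2 * s - 1 + n ≠ 0) (hδ : 0 < δ) (hR : δ < R)
    (t : ℝ) :
    (t : ℂ) * (t - 1) * (cutDiffDeriv₂ δ R t * radialSol s κ t
        + 2 * (cutDiffDeriv δ R t * radialSolDeriv s κ t) + cutDiff δ R t * radialSolDeriv₂ s κ t)
      + (3 * t - 1) * (cutDiffDeriv δ R t * radialSol s κ t + cutDiff δ R t * radialSolDeriv s κ t)
      + (κ : ℂ) ^ 2 / t * (cutDiff δ R t * radialSol s κ t)
    = s * (s - 2) * (cutDiff δ R t * radialSol s κ t) + (cutErr s κ δ t - cutErr s κ R t) := by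
  rcases lt_or_ge t (1 + δ) with h | h
  · rw [(cutDiffDeriv_eq_zero hδ hR h).1, (cutDiffDeriv_eq_zero hδ hR h).2,
      cutDiff_eq_zero hδ hR (Or.inl h), cutErr_eq_zero hδ (Or.inl h),
      cutErr_eq_zero (hδ.trans hR) (Or.inl (h.trans (by linarith)))]
    simp
  · have he := radialSol_equation (κ := κ) hc (σ := t) (by linarith)
    simp only [cutErr, cutDiffDeriv, cutDiffDeriv₂]
    push_cast
    linear_combination (cutDiff δ R t : ℂ) * he

end Cutoff

section Kernel

variable {s : ℂ} (m : ℤ) (A : siegelDomain) {g : ℂ × ℂ → ℂ}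

/-- Green's formula moves the operator onto the truncated kernel. Where no derivative hits the
cutoff, the radial equation cancels `λ = s(s-2)`; only the commutators on the two shells are left.
-/
theorem integral_cutoff_kernel (hc : ∀ n : ℕ, 2 * s - 1 + n ≠ 0)
    (hg : ContDiffOn ℝ 2 g siegelDomain) {δ R : ℝ} (hδ : 0 < δ) (hR : δ < R) :
    ∫ Z : siegelDomain, phaseH m A Z *
        (cutDiff δ R (sigmaInv A Z) * radialSol s |(m : ℝ) / 2| (sigmaInv A Z)) *
        (-weightLaplacian ((m : ℝ) / 2) g Z + s * (s - 2) * g Z) ∂siegelMeasure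
      = (∫ Z : siegelDomain, phaseH m A Z * cutErr s |(m : ℝ) / 2| R (sigmaInv A Z) * g Z ∂siegelMeasure)
        - ∫ Z : siegelDomain, phaseH m A Z * cutErr s |(m : ℝ) / 2| δ (sigmaInv A Z) * g Z
          ∂siegelMeasure := by
  set κ := |(m : ℝ) / 2| with hκ
  set Ψ : ℝ → ℂ := fun t => cutDiff δ R t * radialSol s κ t with hΨ
  have ha : (0 : ℝ) < 1 + δ := by linarith
  have hR0 := hδ.trans hR
  have hs : ∀ t, t < 1 + δ ∨ 1 + 2 * R < t → Ψ t = 0 := fun t ht => by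
    simp [hΨ, cutDiff_eq_zero hδ hR ht]
  have hΨd : ContDiff ℝ 2 Ψ := contDiff_cutDiff_mul s κ hδ hR
  have hW := continuousOn_weightLaplacian ((m : ℝ) / 2) hg
  have i1 := integrable_radial_mul m A ha hs hΨd.continuous hW
  have i2 := integrable_radial_mul m A ha hs hΨd.continuous hg.continuousOn
  have i3 := integrable_radial_mul m A ha (fun t ht => cutErr_eq_zero (s := s) (κ := κ) hδ ht)
    (continuous_cutErr s κ hδ) hg.continuousOn
  have i4 := integrable_radial_mul m A (a := 1 + R) (by linarith)
    (fun t ht => cutErr_eq_zero (s := s) (κ := κ) hR0 ht)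
    (continuous_cutErr s κ hR0) hg.continuousOn
  have hG := integral_mul_weightLaplacian ((m : ℝ) / 2) (contDiff_radial m A.2 ha hs hΨd)
    (hasCompactSupport_radial m A.2 ha hs) (tsupport_radial_subset m A.2 ha hs) hg
  have hadj : ∀ Z : siegelDomain, adjLaplacian ((m : ℝ) / 2)
      (fun Z => phaseH m A Z * Ψ (sigmaInv A Z)) Z * g Z
      = s * (s - 2) * (phaseH m A Z * Ψ (sigmaInv A Z) * g Z)
        + (phaseH m A Z * cutErr s κ δ (sigmaInv A Z) * g Z
        - phaseH m A Z * cutErr s κ R (sigmaInv A Z) * g Z) := by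
    intro Z
    rw [adjLaplacian_radial m A.2 Z.2 (fun t _ => hasDerivAt_cutDiff_mul s κ hδ hR t)
      (fun t _ => hasDerivAt_cutDiff_mul_deriv s κ hδ hR t)]
    have he := radial_operator_cutDiff_mul (κ := κ) hc hδ hR (sigmaInv A Z)
    -- The weight enters the radial equation only through `k²`, so `|k|` may replace `k`.
    have hk : ((m / 2 : ℝ) : ℂ) ^ 2 = (κ : ℂ) ^ 2 := by
      rw [hκ, ← ofReal_pow, ← ofReal_pow, sq_abs]
    rw [hk, he]
    ring
  simp only [hadj] at hG
  have i34 : Integrable (fun Z : siegelDomain => phaseH m A Z * cutErr s κ δ (sigmaInv A Z) * g Z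
      - phaseH m A Z * cutErr s κ R (sigmaInv A Z) * g Z) siegelMeasure := i3.sub i4
  rw [integral_add (i2.const_mul _) i34, integral_sub i3 i4, integral_const_mul] at hG
  have : ∀ Z : siegelDomain, phaseH m A Z * Ψ (sigmaInv A Z) *
        (-weightLaplacian ((m : ℝ) / 2) g Z + s * (s - 2) * g Z)
      = s * (s - 2) * (phaseH m A Z * Ψ (sigmaInv A Z) * g Z)
        - phaseH m A Z * Ψ (sigmaInv A Z) * weightLaplacian ((m : ℝ) / 2) g Z := fun Z => by ring
  change ∫ Z : siegelDomain, phaseH m A Z * Ψ (sigmaInv A Z) *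
        (-weightLaplacian ((m : ℝ) / 2) g Z + s * (s - 2) * g Z) ∂siegelMeasure = _
  simp only [this]
  rw [integral_sub (i2.const_mul _) i1, integral_const_mul, hG]
  ring

/-- Radial functions concentrating at `σ = 1` act as approximate identities. -/
theorem tendsto_integral_shell {F : ℝ → ℝ → ℂ} (hFc : ∀ δ > 0, Continuous (F δ))
    (hFs : ∀ δ > 0, ∀ t, t < 1 + δ ∨ 1 + 2 * δ < t → F δ t = 0) {K : ℝ}
    (hK : ∀ᶠ δ : ℝ in 𝓝[>] 0, ∀ x ∈ Set.Icc (1 : ℝ) 2, ‖((δ : ℂ) ^ 2 * x) * F δ (1 + δ * x)‖ ≤ K)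
    {L : ℂ} (hL : Tendsto (fun δ : ℝ => ∫ x in (1 : ℝ)..2, ((δ : ℂ) ^ 2 * x) * F δ (1 + δ * x)) (𝓝[>] 0)
      (𝓝 L)) (hg : ContinuousOn g siegelDomain) :
    Tendsto (fun δ : ℝ => ∫ Z : siegelDomain, phaseH m A Z * F δ (sigmaInv A Z) * g Z
      ∂siegelMeasure) (𝓝[>] 0) (𝓝 (L * shellConst * g A)) := by
  have hmain : Tendsto (fun δ : ℝ => ∫ Z : siegelDomain, F δ (sigmaInv A Z) * g A
      ∂siegelMeasure) (𝓝[>] 0) (𝓝 (L * shellConst * g A)) := by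
    have h := (hL.const_mul (shellConst : ℂ)).mul_const (g A)
    rw [mul_comm L]
    refine h.congr' ?_
    filter_upwards [self_mem_nhdsWithin] with δ hδ
    rw [integral_mul_const, integral_radial_shell A (hFc δ hδ) hδ (hFs δ hδ)]
  have hHg : Continuous fun Z : siegelDomain => phaseH m A Z * g Z :=
    continuousOn_iff_continuous_domRestrict.1 ((continuousOn_phaseH m A.2).mul hg)
  -- The phase is `1` at `A`, so replacing phase times `g` by `g A` costs little on a small shell,
  -- while the mass of `F δ` stays bounded.
  have hrest : Tendsto (fun δ : ℝ => ∫ Z : siegelDomain, F δ (sigmaInv A Z) *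
      (phaseH m A Z * g Z - g A) ∂siegelMeasure) (𝓝[>] 0) (𝓝 0) := by
    rw [Metric.tendsto_nhds]
    intro ε hε
    have hV := shellConst_pos
    set K' := max K 1
    have hK' : 0 < K' := lt_max_of_lt_right one_pos
    set η := ε / (2 * (shellConst * K')) with hη
    have hη0 : 0 < η := by positivity
    have hU : {Z : siegelDomain | ‖phaseH m A Z * g Z - g A‖ < η} ∈ 𝓝 A := by
      have : ContinuousAt (fun Z : siegelDomain => ‖phaseH m A Z * g Z - g A‖) A :=
        (hHg.sub continuous_const).norm.continuousAt
      refine this.eventually_lt_const ?_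
      simpa [phaseH_self m A.2] using hη0
    obtain ⟨δ₀, hδ₀, hsub⟩ := exists_sigmaInv_lt_subset A hU
    filter_upwards [hK, Ioo_mem_nhdsGT (show (0 : ℝ) < δ₀ / 2 by linarith)] with δ h1 h2
    rw [dist_zero_right]
    have := norm_integral_radial_shell_le A (hFc δ h2.1) h2.1 (hFs δ h2.1) (M := K') (fun x hx => (h1 x hx).trans (le_max_left _ _))
      (G := fun Z => phaseH m A Z * g Z - g A) (B := η)
      (fun Z hZ => (hsub Z (by linarith [h2.2])).le)
    refine this.trans_lt ?_
    rw [hη]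
    field_simp
    linarith
  have := hrest.add hmain
  rw [zero_add] at this
  refine this.congr' ?_
  filter_upwards [self_mem_nhdsWithin] with δ hδ
  have hδ' : 0 < δ := hδ
  have i1 := integrable_radial_mul m A (a := 1 + δ) (by linarith)
    (hFs δ hδ') (hFc δ hδ') hg
  have i2 : Integrable (fun Z : siegelDomain => F δ (sigmaInv A Z) * g A) siegelMeasure := by
    have := integrable_radial_mul 0 A (a := 1 + δ) (by linarith)
      (hFs δ hδ') (hFc δ hδ')
      (g := fun _ => g A) continuousOn_const
    simpa [phaseH] using this
  have e : ∀ Z : siegelDomain, F δ (sigmaInv A Z) * (phaseH m A Z * g Z - g A)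
      = phaseH m A Z * F δ (sigmaInv A Z) * g Z - F δ (sigmaInv A Z) * g A :=
    fun Z => by ring
  simp only [e]
  rw [integral_sub i1 i2, sub_add_cancel]

theorem tendsto_integral_cutErr (hc : ∀ n : ℕ, 2 * s - 1 + n ≠ 0) (κ : ℝ)
    (hg : ContinuousOn g siegelDomain) :
    Tendsto (fun δ : ℝ => ∫ Z : siegelDomain, phaseH m A Z * cutErr s κ δ (sigmaInv A Z) * g Z
      ∂siegelMeasure) (𝓝[>] 0) (𝓝 (-(radialResidue s κ * shellConst * g A))) := by
  obtain ⟨K, hK⟩ := exists_norm_cutErr_rescaled_le (κ := κ) hc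
  have := tendsto_integral_shell m A (fun δ hδ => continuous_cutErr s κ hδ)
    (fun δ hδ t ht => cutErr_eq_zero hδ ht) hK (tendsto_integral_cutErr_rescaled (κ := κ) hc) hg
  rwa [neg_mul, neg_mul] at this

/-- The reproducing formula, under the assumption that the boundary terms at infinity vanish. -/
theorem integral_kernel_of_tendsto (hc : ∀ n : ℕ, 2 * s - 1 + n ≠ 0)
    (hg : ContDiffOn ℝ 2 g siegelDomain)
    (hint : Integrable (fun Z : siegelDomain => phaseH m A Z *
      radialSol s |(m : ℝ) / 2| (sigmaInv A Z) *
      (-weightLaplacian ((m : ℝ) / 2) g Z + s * (s - 2) * g Z)) siegelMeasure)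
    (hup : Tendsto (fun R : ℝ => ∫ Z : siegelDomain, phaseH m A Z *
      cutErr s |(m : ℝ) / 2| R (sigmaInv A Z) * g Z ∂siegelMeasure) atTop (𝓝 0)) :
    ∫ Z : siegelDomain, phaseH m A Z * radialSol s |(m : ℝ) / 2| (sigmaInv A Z) *
      (-weightLaplacian ((m : ℝ) / 2) g Z + s * (s - 2) * g Z) ∂siegelMeasure
      = radialResidue s |(m : ℝ) / 2| * shellConst * g A := by
  set κ := |(m : ℝ) / 2|
  set h : siegelDomain → ℂ := fun Z => -weightLaplacian ((m : ℝ) / 2) g Z + s * (s - 2) * g Z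
  -- Inner radius `1/(n+2)` and outer radius `n+2`; the shift by `2` gives `δ < R` for every `n`.
  have hδ (n : ℕ) : (0 : ℝ) < ((n : ℝ) + 2)⁻¹ := by positivity
  have hR (n : ℕ) : ((n : ℝ) + 2)⁻¹ < n + 2 := by
    have : (1 : ℝ) < n + 2 := by
      have := n.cast_nonneg (α := ℝ)
      linarith
    exact (inv_lt_one_of_one_lt₀ this).trans this
  have t1 : Tendsto (fun n : ℕ => ((n : ℝ) + 2)) atTop atTop :=
    tendsto_atTop_add_const_right _ _ tendsto_natCast_atTop_atTop
  have t2 : Tendsto (fun n : ℕ => ((n : ℝ) + 2)⁻¹) atTop (𝓝[>] 0) :=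
    tendsto_inv_atTop_nhdsGT_zero.comp t1
  have lim1 := (hup.comp t1).sub ((tendsto_integral_cutErr m A hc κ hg.continuousOn).comp t2)
  rw [zero_sub, neg_neg] at lim1
  have lim2 : Tendsto (fun n : ℕ => ∫ Z : siegelDomain, phaseH m A Z *
      (cutDiff ((n : ℝ) + 2)⁻¹ (n + 2) (sigmaInv A Z) * radialSol s κ (sigmaInv A Z)) * h Z
      ∂siegelMeasure) atTop (𝓝 (∫ Z : siegelDomain, phaseH m A Z * radialSol s κ (sigmaInv A Z) * h Z
      ∂siegelMeasure)) := by
    refine tendsto_integral_of_dominated_convergence _ (fun n => ?_) hint.norm (fun n => ?_) ?_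
    · exact (integrable_radial_mul m A (a := 1 + ((n : ℝ) + 2)⁻¹) (b := 1 + 2 * (n + 2))
        (Ψ := fun t => cutDiff ((n : ℝ) + 2)⁻¹ (n + 2) t * radialSol s κ t)
        (by have := hδ n; linarith)
        (fun t ht => by simp [cutDiff_eq_zero (hδ n) (hR n) ht])
        (contDiff_cutDiff_mul s κ (hδ n) (hR n)).continuous
        (g := fun Z => -weightLaplacian ((m : ℝ) / 2) g Z + s * (s - 2) * g Z)
        ((continuousOn_weightLaplacian _ hg).neg.add
          (continuousOn_const.mul hg.continuousOn))).aestronglyMeasurable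
    · refine ae_of_all _ fun Z => ?_
      have := abs_cutDiff_le ((n : ℝ) + 2)⁻¹ (n + 2) (sigmaInv A Z)
      simp only [norm_mul, norm_real, Real.norm_eq_abs]
      gcongr
      exact mul_le_of_le_one_left (norm_nonneg _) this
    · filter_upwards [ae_one_lt_sigmaInv A] with Z hZ
      have := ((((continuous_ofReal.tendsto 1).comp (tendsto_cutDiff hZ)).mul_const
        (radialSol s κ (sigmaInv A Z))).const_mul (phaseH m A Z)).mul_const (h Z)
      simpa using this
  refine tendsto_nhds_unique lim2 (lim1.congr fun n => ?_)
  exact (integral_cutoff_kernel m A hc hg (hδ n) (hR n)).symm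

end Kernel

theorem weightLaplacian_eq_zero_of_notMem_tsupport (k : ℝ) {g : ℂ × ℂ → ℂ} {Z : ℂ × ℂ}
    (hZ : Z ∉ tsupport g) : weightLaplacian k g Z = 0 := by
  have s1 : tsupport (wirt1bar g) ⊆ tsupport g := closure_minimal (fun Z hZ => by
    by_contra h
    exact hZ (wirt_eq_zero_of_notMem_tsupport h).2.1) (isClosed_tsupport g)
  have s2 : tsupport (wirt2bar g) ⊆ tsupport g := closure_minimal (fun Z hZ => by
    by_contra h
    exact hZ (wirt_eq_zero_of_notMem_tsupport h).2.2.2) (isClosed_tsupport g)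
  have e := wirt_eq_zero_of_notMem_tsupport hZ
  have e1 := wirt_eq_zero_of_notMem_tsupport fun h => hZ (s1 h)
  have e2 := wirt_eq_zero_of_notMem_tsupport fun h => hZ (s2 h)
  simp [weightLaplacian, e.1, e.2.1, e1.1, e1.2.2.1, e2.1, e2.2.2.1]

/-! ### Integrability, decay at infinity, and the reproducing formula. -/

section Reproducing

variable {s : ℂ}

/-- The set `T` confines the values of `σ` on the support of `h`. It treats two cases at once:
everything, when `Re s > 2` ensures decay, and a bounded interval, when `h` has compact support and
`Re s` is arbitrary. -/
theorem integrable_radialSol_mul (hc : ∀ n : ℕ, 2 * s - 1 + n ≠ 0) (m : ℤ) (κ : ℝ) (A : siegelDomain)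
    {T : Set ℝ} (hT : MeasurableSet T)
    (hTi : IntegrableOn (fun t : ℝ => t ^ (1 - s.re)) (Set.Ioi 1 ∩ T))
    {h : siegelDomain → ℂ} (hm : AEStronglyMeasurable h siegelMeasure) {B : ℝ} (hB : ∀ Z, ‖h Z‖ ≤ B)
    (h0 : ∀ Z : siegelDomain, sigmaInv A Z ∉ T → h Z = 0) :
    Integrable (fun Z : siegelDomain => phaseH m A Z * radialSol s κ (sigmaInv A Z) * h Z)
      siegelMeasure := by
  obtain ⟨K, hK0, hK⟩ := exists_norm_radialSol_le (κ := κ) hc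
  have hB0 : 0 ≤ B := (norm_nonneg _).trans (hB A)
  have hσ := (continuous_sigmaInv A).measurable
  set F : ℝ → ℝ := T.indicator fun t => K * t ^ (1 - s.re) / (t - 1) with hF
  have hFm : Measurable F := Measurable.indicator (by fun_prop) hT
  have hFi : Integrable (fun Z : siegelDomain => F (sigmaInv A Z)) siegelMeasure := by
    refine ⟨(hFm.comp hσ).aestronglyMeasurable, ?_⟩
    have e := lintegral_radial A (F := fun t => ‖F t‖ₑ) hFm.enorm
    rw [HasFiniteIntegral, e]
    refine ENNReal.mul_lt_top
      (ENNReal.mul_lt_top (by norm_num) (lt_top_iff_ne_top.2 ballVolume_ne_top)) ?_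
    have h1 : ∫⁻ t in Set.Ioi (1 : ℝ), ENNReal.ofReal (t - 1) * ‖F t‖ₑ
        = ∫⁻ t in Set.Ioi (1 : ℝ), T.indicator (fun t => ‖K * t ^ (1 - s.re)‖ₑ) t := by
      refine setLIntegral_congr_fun measurableSet_Ioi fun t ht => ?_
      have ht1 : 0 < t - 1 := by linarith [Set.mem_Ioi.1 ht]
      by_cases htT : t ∈ T
      · simp only [hF, Set.indicator_of_mem htT]
        rw [← Real.enorm_eq_ofReal ht1.le, ← enorm_mul]
        congr 1
        field_simp
      · simp [hF, Set.indicator_of_notMem htT]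
    rw [h1, lintegral_indicator hT, Measure.restrict_restrict hT, Set.inter_comm]
    exact (hTi.const_mul K).2
  have hmeas : AEStronglyMeasurable
      (fun Z : siegelDomain => phaseH m A Z * radialSol s κ (sigmaInv A Z) * h Z) siegelMeasure := by
    have hp : Measurable ((Set.Ioi (1 : ℝ)).piecewise (radialSol s κ) 0) :=
      (continuousOn_radialSol s κ).measurable_piecewise continuousOn_const measurableSet_Ioi
    have hH : Continuous fun Z : siegelDomain => phaseH m A Z :=
      continuousOn_iff_continuous_domRestrict.1 (continuousOn_phaseH m A.2)
    refine ((hH.aestronglyMeasurable.mul (hp.comp hσ).aestronglyMeasurable).mul hm).congr ?_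
    filter_upwards [ae_one_lt_sigmaInv A] with Z hZ
    have : sigmaInv A Z ∈ Set.Ioi (1 : ℝ) := hZ
    simp only [Pi.mul_apply, Function.comp_apply, Set.piecewise_eq_of_mem _ _ _ this]
  refine (hFi.const_mul B).mono' hmeas ?_
  filter_upwards [ae_one_lt_sigmaInv A] with Z hZ
  by_cases htT : sigmaInv A Z ∈ T
  · simp only [hF, Set.indicator_of_mem htT]
    rw [norm_mul, norm_mul, norm_phaseH m A.2 Z.2, one_mul, mul_comm]
    gcongr
    · exact hB Z
    · exact hK _ hZ
  · rw [h0 Z htT]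
    simp [hF, Set.indicator_of_notMem htT]

/-- On the shell at distance `R` the solution is `O(R^(-Re s))`, its derivative `O(R^(-Re s - 1))`
and the volume `O(R²)`. The commutator has the homogeneity of the operator, so the integral is
`O(R^(2 - Re s))`. -/
theorem tendsto_integral_cutErr_atTop (hc : ∀ n : ℕ, 2 * s - 1 + n ≠ 0) (hs : 2 < s.re) (m : ℤ)
    (κ : ℝ) (A : siegelDomain) {g : ℂ × ℂ → ℂ} {B : ℝ} (hB : ∀ Z : siegelDomain, ‖g Z‖ ≤ B) :
    Tendsto (fun R : ℝ => ∫ Z : siegelDomain, phaseH m A Z * cutErr s κ R (sigmaInv A Z) * g Z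
      ∂siegelMeasure) atTop (𝓝 0) := by
  obtain ⟨K, hK0, hK⟩ := exists_norm_radialSol_le (κ := κ) hc
  obtain ⟨K', hK'0, hK'⟩ := exists_norm_radialSolDeriv_le s κ
  obtain ⟨M, hM0, hM⟩ := exists_cutDeriv_bound
  have hlim : Tendsto (fun R : ℝ => shellConst * (4 * (8 * M * (K + K')) * R ^ (-(s.re - 2))) * B)
      atTop (𝓝 0) := by
    have := (((tendsto_rpow_neg_atTop (show 0 < s.re - 2 by linarith)).const_mul
      (4 * (8 * M * (K + K')))).const_mul shellConst).mul_const B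
    simpa using this
  refine squeeze_zero_norm' ?_ hlim
  filter_upwards [eventually_ge_atTop (1 : ℝ)] with R hR
  have hR0 : 0 < R := by linarith
  have e : ∀ Z : siegelDomain, phaseH m A Z * cutErr s κ R (sigmaInv A Z) * g Z
      = cutErr s κ R (sigmaInv A Z) * (phaseH m A Z * g Z) := fun Z => by ring
  simp only [e]
  refine norm_integral_radial_shell_le A (continuous_cutErr s κ hR0) hR0
    (fun t ht => cutErr_eq_zero hR0 ht) (fun x hx => ?_) fun Z _ => ?_
  · have hσ : R ≤ 1 + R * x := by nlinarith [hx.1]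
    have hσ2 : 2 ≤ 1 + R * x := by nlinarith [hx.1]
    have hp : R * R ^ (-s.re) = R ^ (1 - s.re) := by
      rw [sub_eq_add_neg, Real.rpow_add hR0, Real.rpow_one]
    have hq : R ^ 2 * R ^ (-s.re - 1) = R ^ (1 - s.re) := by
      rw [← Real.rpow_natCast, ← Real.rpow_add hR0]; congr 1; push_cast; ring
    refine (norm_cutErr_rescaled_le hR0 hx (hM x hx) (P := K * R ^ (1 - s.re))
      (Q := K' * R ^ (1 - s.re)) ?_ ?_).trans ?_
    · have h1 := hK (1 + R * x) (by linarith)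
      rw [norm_mul, norm_real, Real.norm_of_nonneg hR0.le]
      have h2 : (1 + R * x) ^ (1 - s.re) ≤ R ^ (1 - s.re) :=
        Real.rpow_le_rpow_of_nonpos hR0 hσ (by linarith)
      calc R * ‖radialSol s κ (1 + R * x)‖ ≤ R * (K * R ^ (1 - s.re) / R) := by
            refine mul_le_mul_of_nonneg_left (h1.trans ?_) hR0.le
            gcongr
            nlinarith [hx.1]
        _ = _ := by field_simp
    · have h1 := hK' (1 + R * x) hσ2
      rw [norm_mul, norm_pow, norm_real, Real.norm_of_nonneg hR0.le]
      have h2 : (1 + R * x) ^ (-s.re - 1) ≤ R ^ (-s.re - 1) :=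
        Real.rpow_le_rpow_of_nonpos hR0 hσ (by linarith)
      calc R ^ 2 * ‖radialSolDeriv s κ (1 + R * x)‖ ≤ R ^ 2 * (K' * R ^ (-s.re - 1)) := by
            refine mul_le_mul_of_nonneg_left (h1.trans ?_) (by positivity)
            gcongr
        _ = K' * (R ^ 2 * R ^ (-s.re - 1)) := by ring
        _ = _ := by rw [hq]
    · have h3 : R * R ^ (1 - s.re) = R ^ (-(s.re - 2)) := by
        rw [show -(s.re - 2) = 1 + (1 - s.re) by ring, Real.rpow_add hR0, Real.rpow_one]
      have h4 : 0 ≤ 8 * M * (K * R ^ (1 - s.re) + K' * R ^ (1 - s.re)) := by positivity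
      calc _ ≤ (4 * R) * (8 * M * (K * R ^ (1 - s.re) + K' * R ^ (1 - s.re))) := by
            gcongr
            linarith
        _ = 4 * (8 * M * (K + K')) * (R * R ^ (1 - s.re)) := by ring
        _ = _ := by rw [h3]
  · rw [norm_mul, norm_phaseH m A.2 Z.2, one_mul]
    exact hB Z

/-- The constant of the reproducing formula. -/
noncomputable def reproducingConst (m : ℤ) (s : ℂ) : ℂ :=
  exp ((|(m : ℝ) / 2| - s) * (Real.pi * I)) * radialResidue s |(m : ℝ) / 2| * shellConst
    / (4 * (Real.pi : ℂ) ^ 2)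

theorem reproducingConst_eq_zero_iff (hc : ∀ n : ℕ, 2 * s - 1 + n ≠ 0) (m : ℤ) :
    reproducingConst m s = 0 ↔ ∃ n : ℕ, s = ((|(m : ℝ) / 2| : ℝ) : ℂ) - n := by
  have hκ : ∃ n : ℕ, 2 * |(m : ℝ) / 2| = n := by
    refine ⟨m.natAbs, ?_⟩
    rw [abs_div, abs_two, Nat.cast_natAbs, Int.cast_abs]
    ring
  rw [← radialResidue_eq_zero_iff hc hκ, reproducingConst]
  have h1 : (shellConst : ℂ) ≠ 0 := by exact_mod_cast shellConst_pos.ne'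
  have h2 : (Real.pi : ℂ) ≠ 0 := by exact_mod_cast Real.pi_ne_zero
  simp [exp_ne_zero, h1, h2]

theorem pointPairKernel_eq (hc : ∀ n : ℕ, 2 * s - 1 + n ≠ 0) (m : ℤ) {A Z : ℂ × ℂ}
    (h : 1 < sigmaInv A Z) :
    pointPairKernel s m A Z = exp ((|(m : ℝ) / 2| - s) * (Real.pi * I)) *
      (phaseH m A Z * radialSol s |(m : ℝ) / 2| (sigmaInv A Z)) := by
  rw [pointPairKernel, radialKernel_eq hc _ h]
  ring

theorem integral_pointPairKernel_of_tendsto (hc : ∀ n : ℕ, 2 * s - 1 + n ≠ 0) (m : ℤ)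
    (A : siegelDomain) {g : ℂ × ℂ → ℂ} (hg : ContDiffOn ℝ 2 g siegelDomain)
    (hint : Integrable (fun Z : siegelDomain => phaseH m A Z *
      radialSol s |(m : ℝ) / 2| (sigmaInv A Z) *
      (-weightLaplacian ((m : ℝ) / 2) g Z + s * (s - 2) * g Z)) siegelMeasure)
    (hup : Tendsto (fun R : ℝ => ∫ Z : siegelDomain, phaseH m A Z *
      cutErr s |(m : ℝ) / 2| R (sigmaInv A Z) * g Z ∂siegelMeasure) atTop (𝓝 0)) :
    Integrable (fun Z : siegelDomain => pointPairKernel s m A Z *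
        (-weightLaplacian ((m : ℝ) / 2) g Z + s * (s - 2) * g Z)) siegelMeasure ∧
      reproducingConst m s * (4 * (Real.pi : ℂ) ^ 2 * g A)
        = ∫ Z : siegelDomain, pointPairKernel s m A Z *
          (-weightLaplacian ((m : ℝ) / 2) g Z + s * (s - 2) * g Z) ∂siegelMeasure := by
  have hae : (fun Z : siegelDomain => exp ((|(m : ℝ) / 2| - s) * (Real.pi * I)) *
      (phaseH m A Z * radialSol s |(m : ℝ) / 2| (sigmaInv A Z) *
      (-weightLaplacian ((m : ℝ) / 2) g Z + s * (s - 2) * g Z))) =ᵐ[siegelMeasure]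
      fun Z : siegelDomain => pointPairKernel s m A Z *
        (-weightLaplacian ((m : ℝ) / 2) g Z + s * (s - 2) * g Z) := by
    filter_upwards [ae_one_lt_sigmaInv A] with Z hZ
    rw [pointPairKernel_eq hc m hZ]
    ring
  refine ⟨(hint.const_mul _).congr hae, ?_⟩
  rw [← integral_congr_ae hae, integral_const_mul, integral_kernel_of_tendsto m A hc hg hint hup,
    reproducingConst]
  have h2 : (Real.pi : ℂ) ≠ 0 := by exact_mod_cast Real.pi_ne_zero
  field_simp

theorem aestronglyMeasurable_operator (s : ℂ) (k : ℝ) {g : ℂ × ℂ → ℂ}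
    (hg : ContDiffOn ℝ 2 g siegelDomain) :
    AEStronglyMeasurable (fun Z : siegelDomain => -weightLaplacian k g Z + s * (s - 2) * g Z)
      siegelMeasure := by
  have h : ContinuousOn (fun Z => -weightLaplacian k g Z + s * (s - 2) * g Z) siegelDomain :=
    (continuousOn_weightLaplacian _ hg).neg.add (continuousOn_const.mul hg.continuousOn)
  exact (continuousOn_iff_continuous_domRestrict.1 h).aestronglyMeasurable

/-- The reproducing formula for bounded functions. -/
theorem integral_pointPairKernel_of_bounded (hc : ∀ n : ℕ, 2 * s - 1 + n ≠ 0) (hs : 2 < s.re) (m : ℤ)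
    (A : siegelDomain) {g : ℂ × ℂ → ℂ} (hg : ContDiffOn ℝ 2 g siegelDomain) {B B' : ℝ}
    (hB : ∀ Z : siegelDomain, ‖g Z‖ ≤ B)
    (hB' : ∀ Z : siegelDomain, ‖-weightLaplacian ((m : ℝ) / 2) g Z + s * (s - 2) * g Z‖ ≤ B') :
    Integrable (fun Z : siegelDomain => pointPairKernel s m A Z *
        (-weightLaplacian ((m : ℝ) / 2) g Z + s * (s - 2) * g Z)) siegelMeasure ∧
      reproducingConst m s * (4 * (Real.pi : ℂ) ^ 2 * g A)
        = ∫ Z : siegelDomain, pointPairKernel s m A Z *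
          (-weightLaplacian ((m : ℝ) / 2) g Z + s * (s - 2) * g Z) ∂siegelMeasure := by
  refine integral_pointPairKernel_of_tendsto hc m A hg ?_
    (tendsto_integral_cutErr_atTop hc hs m _ A hB)
  refine integrable_radialSol_mul hc m _ A MeasurableSet.univ ?_
    (aestronglyMeasurable_operator s _ hg) hB' (by simp)
  rw [Set.inter_univ]
  exact integrableOn_Ioi_rpow_of_lt (by linarith) one_pos

/-- The reproducing formula for compactly supported functions. -/
theorem integral_pointPairKernel_of_compact (hc : ∀ n : ℕ, 2 * s - 1 + n ≠ 0) (m : ℤ)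
    (A : siegelDomain) {g : ℂ × ℂ → ℂ} (hg : IsCc2 g) :
    Integrable (fun Z : siegelDomain => pointPairKernel s m A Z *
        (-weightLaplacian ((m : ℝ) / 2) g Z + s * (s - 2) * g Z)) siegelMeasure ∧
      reproducingConst m s * (4 * (Real.pi : ℂ) ^ 2 * g A)
        = ∫ Z : siegelDomain, pointPairKernel s m A Z *
          (-weightLaplacian ((m : ℝ) / 2) g Z + s * (s - 2) * g Z) ∂siegelMeasure := by
  obtain ⟨hg2, hgc, hgs⟩ := hg
  have hgo : ContDiffOn ℝ 2 g siegelDomain := hg2.contDiffOn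
  obtain ⟨b, hb⟩ := hgc.isCompact.exists_bound_of_continuousOn
    ((continuousOn_sigmaInv A.2).mono hgs)
  set h : ℂ × ℂ → ℂ := fun Z => -weightLaplacian ((m : ℝ) / 2) g Z + s * (s - 2) * g Z with hh
  have hcont : ContinuousOn h siegelDomain :=
    (continuousOn_weightLaplacian _ hgo).neg.add (continuousOn_const.mul hgo.continuousOn)
  have hg0 : ∀ Z, Z ∉ tsupport g → g Z = 0 := fun Z hZ => image_eq_zero_of_notMem_tsupport hZ
  have hh0 : ∀ Z, Z ∉ tsupport g → h Z = 0 := by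
    intro Z hZ
    simp only [hh]
    rw [hg0 Z hZ, weightLaplacian_eq_zero_of_notMem_tsupport _ hZ]
    simp
  obtain ⟨B, hB⟩ := hgc.isCompact.exists_bound_of_continuousOn (hcont.mono hgs)
  have hσ : ∀ Z : siegelDomain, sigmaInv A Z ∉ Set.Iic b → (Z : ℂ × ℂ) ∉ tsupport g := fun Z hZ hmem =>
    hZ (Set.mem_Iic.2 ((le_abs_self _).trans (hb Z hmem)))
  refine integral_pointPairKernel_of_tendsto hc m A hgo ?_ ?_
  · refine integrable_radialSol_mul hc m _ A (T := Set.Iic b) measurableSet_Iic ?_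
      (aestronglyMeasurable_operator s _ hgo) (B := max B 0) (fun Z => ?_) fun Z hZ => hh0 Z (hσ Z hZ)
    · rw [Set.Ioi_inter_Iic]
      refine IntegrableOn.mono_set (t := Set.Icc 1 b) ?_ Set.Ioc_subset_Icc_self
      refine ContinuousOn.integrableOn_Icc fun t ht => ?_
      exact (Real.continuousAt_rpow_const _ _ (Or.inl (by linarith [ht.1]))).continuousWithinAt
    · by_cases hZ : (Z : ℂ × ℂ) ∈ tsupport g
      · exact (hB Z hZ).trans (le_max_left _ _)
      · have := hh0 Z hZ
        simp only [hh] at this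
        rw [this, norm_zero]
        exact le_max_right _ _
  -- As soon as `R` exceeds the bound of `σ` on the support of `g`, the outer shell misses that
  -- support.
  · refine tendsto_const_nhds.congr' ?_
    filter_upwards [eventually_ge_atTop b, eventually_gt_atTop 0] with R hR hR0
    symm
    refine integral_eq_zero_of_ae (ae_of_all _ fun Z => ?_)
    by_cases hZ : (Z : ℂ × ℂ) ∈ tsupport g
    · have h1 : sigmaInv A Z ≤ R := ((le_abs_self _).trans (hb Z hZ)).trans hR
      simp [cutErr_eq_zero (s := s) (κ := |(m : ℝ) / 2|) hR0 (t := sigmaInv A Z) (Or.inl (by linarith))]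
    · simp [hg0 Z hZ]

end Reproducing

/-! ### Equivariance of `Δ_k`. -/

section Equivariance

/-- A smooth bump supported in `[1, 2]`. -/
noncomputable def shellBump (x : ℝ) : ℝ :=
  Real.smoothTransition (x - 1) * Real.smoothTransition (2 - x)

theorem contDiff_shellBump {n : ℕ∞} : ContDiff ℝ n shellBump :=
  (Real.smoothTransition.contDiff.comp (contDiff_id.sub contDiff_const)).mul
    (Real.smoothTransition.contDiff.comp (contDiff_const.sub contDiff_id))

theorem shellBump_eq_zero {x : ℝ} (h : x < 1 ∨ 2 < x) : shellBump x = 0 := by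
  rcases h with h | h
  · rw [shellBump, Real.smoothTransition.zero_of_nonpos (by linarith), zero_mul]
  · rw [shellBump, Real.smoothTransition.zero_of_nonpos (x := 2 - x) (by linarith), mul_zero]

theorem shellBump_nonneg (x : ℝ) : 0 ≤ shellBump x :=
  mul_nonneg (Real.smoothTransition.nonneg _) (Real.smoothTransition.nonneg _)

theorem shellBump_le_one (x : ℝ) : shellBump x ≤ 1 :=
  mul_le_one₀ (Real.smoothTransition.le_one _) (Real.smoothTransition.nonneg _)
    (Real.smoothTransition.le_one _)

theorem integral_mul_shellBump_pos : 0 < ∫ x in (1 : ℝ)..2, x * shellBump x := by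
  have hc : Continuous shellBump := (contDiff_shellBump (n := 0)).continuous
  refine intervalIntegral.intervalIntegral_pos_of_pos_on
    ((continuous_id.mul hc).intervalIntegrable _ _) (fun x hx => ?_) (by norm_num)
  exact mul_pos (by linarith [hx.1]) (mul_pos
    (Real.smoothTransition.pos_of_pos (by linarith [hx.1]))
    (Real.smoothTransition.pos_of_pos (by linarith [hx.2])))

/-- The rescaled bump, concentrating at `σ = 1`. -/
noncomputable def shellTest (δ σ : ℝ) : ℂ := ((shellBump ((σ - 1) / δ) / δ ^ 2 : ℝ) : ℂ)

theorem contDiff_shellTest (δ : ℝ) {n : ℕ∞} : ContDiff ℝ n (shellTest δ) :=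
  ofRealCLM.contDiff.comp ((contDiff_shellBump.comp
    ((contDiff_id.sub contDiff_const).div_const δ)).div_const _)

theorem shellTest_eq_zero {δ t : ℝ} (hδ : 0 < δ) (h : t < 1 + δ ∨ 1 + 2 * δ < t) :
    shellTest δ t = 0 := by
  rw [shellTest, shellBump_eq_zero (shell_iff hδ h)]
  simp

theorem tendsto_integral_shellTest (m : ℤ) (A : siegelDomain) {g : ℂ × ℂ → ℂ}
    (hg : ContinuousOn g siegelDomain) :
    Tendsto (fun δ : ℝ => ∫ Z : siegelDomain, phaseH m A Z * shellTest δ (sigmaInv A Z) * g Z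
      ∂siegelMeasure) (𝓝[>] 0)
      (𝓝 (((∫ x in (1 : ℝ)..2, x * shellBump x : ℝ) : ℂ) * shellConst * g A)) := by
  have hr : ∀ δ : ℝ, 0 < δ → ∀ x : ℝ, (δ : ℂ) ^ 2 * x * shellTest δ (1 + δ * x)
      = ((x * shellBump x : ℝ) : ℂ) := by
    intro δ hδ x
    have h : (1 + δ * x - 1) / δ = x := by field_simp; ring
    have hδ' : (δ : ℂ) ≠ 0 := by exact_mod_cast hδ.ne'
    rw [shellTest, h]
    push_cast
    field_simp
  refine tendsto_integral_shell m A (fun δ _ => (contDiff_shellTest δ (n := 0)).continuous)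
    (fun δ hδ t ht => shellTest_eq_zero hδ ht) (K := 2) ?_ ?_ hg
  · filter_upwards [self_mem_nhdsWithin] with δ hδ x hx
    rw [hr δ hδ, norm_real, Real.norm_of_nonneg (mul_nonneg (by linarith [hx.1]) (shellBump_nonneg x))]
    nlinarith [hx.1, hx.2, shellBump_le_one x, shellBump_nonneg x]
  · refine tendsto_const_nhds.congr' ?_
    filter_upwards [self_mem_nhdsWithin] with δ hδ
    rw [← intervalIntegral.integral_ofReal]
    exact intervalIntegral.integral_congr fun x _ => (hr δ hδ x).symm

/-- Change of variables in integrals against radial kernels. -/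
theorem integral_radial_smul (m : ℤ) (γ : SU21) (A : siegelDomain) (Φ : ℝ → ℂ) {g : ℂ × ℂ → ℂ}
    (hγ : ∀ Z : siegelDomain, g (γ • Z : siegelDomain) = autPhase γ Z ^ m * g Z) :
    ∫ Z : siegelDomain, phaseH m (γ • A : siegelDomain) Z * Φ (sigmaInv (γ • A : siegelDomain) Z) * g Z
        ∂siegelMeasure
      = autPhase γ A ^ m * ∫ Z : siegelDomain, phaseH m A Z * Φ (sigmaInv A Z) * g Z ∂siegelMeasure := by
  rw [← integral_smul_eq_self _ (g := γ), ← integral_const_mul]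
  congr 1
  ext Z
  rw [phaseH_smul, sigmaInv_smul, hγ]
  have := zpow_ne_zero m (autPhase_ne_zero γ Z.2)
  field_simp

/-- No derivative of `γ` is computed. The value of `Δ_k g` at a point is a limit of averages against
phase times bump. Green's formula turns these into averages of `g` against another radial kernel,
and such averages transform correctly by invariance of `σ` and of the measure. -/
theorem weightLaplacian_smul (m : ℤ) {γ : SU21} {g : ℂ × ℂ → ℂ}
    (hg : ContDiffOn ℝ 2 g siegelDomain)
    (hγ : ∀ Z : siegelDomain, g (γ • Z : siegelDomain) = autPhase γ Z ^ m * g Z) (A : siegelDomain) :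
    weightLaplacian ((m : ℝ) / 2) g (γ • A : siegelDomain)
      = autPhase γ A ^ m * weightLaplacian ((m : ℝ) / 2) g A := by
  have hW := continuousOn_weightLaplacian ((m : ℝ) / 2) hg
  -- The radial operator applied to the bump; it does not involve the centre, so the same `D` serves
  -- at `A` and at `γ • A`.
  obtain ⟨D, hD⟩ : ∃ D : ℝ → ℝ → ℂ, D = fun δ (t : ℝ) => (t : ℂ) * (t - 1) * deriv (deriv (shellTest δ)) t
      + (3 * t - 1) * deriv (shellTest δ) t + ((m / 2 : ℝ) : ℂ) ^ 2 / t * shellTest δ t := ⟨_, rfl⟩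
  have key (δ : ℝ) (hδ : 0 < δ) (B : siegelDomain) :
      ∫ Z : siegelDomain, phaseH m B Z * shellTest δ (sigmaInv B Z) *
        weightLaplacian ((m : ℝ) / 2) g Z ∂siegelMeasure
      = ∫ Z : siegelDomain, phaseH m B Z * D δ (sigmaInv B Z) * g Z ∂siegelMeasure := by
    have ha : (0 : ℝ) < 1 + δ := by linarith
    have hs : ∀ t, t < 1 + δ ∨ 1 + 2 * δ < t → shellTest δ t = 0 := fun t ht =>
      shellTest_eq_zero hδ ht
    have hd := contDiff_shellTest δ (n := 2)
    have hd1 : ContDiff ℝ 1 (deriv (shellTest δ)) := (contDiff_succ_iff_deriv.1 hd).2.2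
    rw [integral_mul_weightLaplacian ((m : ℝ) / 2) (contDiff_radial m B.2 ha hs hd)
      (hasCompactSupport_radial m B.2 ha hs) (tsupport_radial_subset m B.2 ha hs) hg]
    congr 1
    ext Z
    rw [adjLaplacian_radial m B.2 Z.2
      (fun t _ => (hd.differentiable (by norm_num) t).hasDerivAt)
      (fun t _ => (hd1.differentiable (by norm_num) t).hasDerivAt), hD]
  have l1 := tendsto_integral_shellTest m (γ • A) hW
  have l2 := (tendsto_integral_shellTest m A hW).const_mul (autPhase γ A ^ m)
  have heq : _ = _ := tendsto_nhds_unique l1 (l2.congr' (by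
    filter_upwards [self_mem_nhdsWithin] with δ hδ
    rw [key δ hδ, key δ hδ]
    exact (integral_radial_smul m γ A (D δ) hγ).symm))
  have h1 : ((∫ x in (1 : ℝ)..2, x * shellBump x : ℝ) : ℂ) ≠ 0 := by
    exact_mod_cast integral_mul_shellBump_pos.ne'
  have h2 : (shellConst : ℂ) ≠ 0 := by exact_mod_cast shellConst_pos.ne'
  refine mul_left_cancel₀ (mul_ne_zero h1 h2) ?_
  rw [heq]; ring

end Equivariance

/-! ### Discrete groups: convergence of the series and unfolding. -/

section DiscreteGroups

variable (Γ : Subgroup SU21)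

/-- The compact sets `σ ≤ n` exhaust the domain, and each contains only finitely many of the points
`γ • A`, counted with `γ`. -/
theorem countable_of_properlyDiscontinuous [ProperlyDiscontinuousSMul Γ siegelDomain] : Countable Γ := by
  rw [← Set.countable_univ_iff]
  set A : siegelDomain := siegelBase
  refine Set.Countable.mono (s₂ := ⋃ n : ℕ, {γ : Γ | ((γ • ·) '' {A} ∩
    {Z : siegelDomain | sigmaInv A Z ≤ n}).Nonempty}) (fun γ _ => ?_)
    (Set.countable_iUnion fun n => (ProperlyDiscontinuousSMul.finite_disjoint_inter_image
      isCompact_singleton (isCompact_sigmaInv_le_subtype A n)).countable)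
  obtain ⟨n, hn⟩ := exists_nat_ge (sigmaInv A (γ • A : siegelDomain))
  exact Set.mem_iUnion.2 ⟨n, γ • A, ⟨A, rfl, rfl⟩, hn⟩

theorem exists_bound_of_invariant [CompactSpace (MulAction.orbitRel.Quotient Γ siegelDomain)]
    {f : siegelDomain → ℝ} (hf : Continuous f) (hi : ∀ γ : Γ, ∀ Z, f (γ • Z) = f Z) :
    ∃ B, ∀ Z, f Z ≤ B := by
  have hl : ∀ a b : siegelDomain, MulAction.orbitRel Γ siegelDomain a b → f a = f b := by
    rintro a b ⟨γ, rfl⟩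
    exact hi γ b
  have hc : Continuous (Quotient.lift f hl : MulAction.orbitRel.Quotient Γ siegelDomain → ℝ) :=
    hf.quotient_lift hl
  obtain ⟨B, hB⟩ := (isCompact_range hc).bddAbove
  exact ⟨B, fun Z => hB ⟨Quotient.mk _ Z, rfl⟩⟩

/-- The constant `8` is the `4` of the triangle inequality times the radius `2`. It allows a term of
the orbit sum to be replaced by an average over a translated ball. -/
theorem sigmaInv_smul_rpow_le {Z' Z W : siegelDomain} (γ : SU21) {p : ℝ} (hp : 0 ≤ p)
    (hW : sigmaInv Z W ≤ 2) :
    sigmaInv Z' (γ • Z : siegelDomain) ^ (-p) ≤ 8 ^ p * sigmaInv Z' (γ • W : siegelDomain) ^ (-p) := by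
  have h := sigmaInv_triangle Z'.2 (γ • Z).2 (γ • W).2
  rw [sigmaInv_smul] at h
  have h1 := one_le_sigmaInv Z'.2 (γ • W).2
  have h2 := one_le_sigmaInv Z'.2 (γ • Z).2
  have h3 : sigmaInv Z' (γ • W : siegelDomain) / 8 ≤ sigmaInv Z' (γ • Z : siegelDomain) := by
    have := mul_le_mul_of_nonneg_left hW (zero_le_one.trans h2)
    linarith
  have h0 : 0 < sigmaInv Z' (γ • W : siegelDomain) := zero_lt_one.trans_le h1
  calc _ ≤ (sigmaInv Z' (γ • W : siegelDomain) / 8) ^ (-p) :=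
        Real.rpow_le_rpow_of_nonpos (by positivity) h3 (by linarith)
    _ = _ := by
        rw [Real.div_rpow h0.le (by norm_num), Real.rpow_neg (by norm_num : (0 : ℝ) ≤ 8), div_inv_eq_mul,
          mul_comm]

theorem lintegral_sigmaInv_rpow_lt_top (A : siegelDomain) {p : ℝ} (hp : 2 < p) :
    ∫⁻ Z : siegelDomain, ENNReal.ofReal (sigmaInv A Z ^ (-p)) ∂siegelMeasure < ⊤ := by
  rw [lintegral_radial A (F := fun t => ENNReal.ofReal (t ^ (-p))) (by fun_prop)]
  refine ENNReal.mul_lt_top (ENNReal.mul_lt_top (by norm_num)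
    (lt_top_iff_ne_top.2 ballVolume_ne_top)) ?_
  have hi : IntegrableOn (fun t : ℝ => t ^ (1 - p)) (Set.Ioi 1) :=
    integrableOn_Ioi_rpow_of_lt (by linarith) one_pos
  refine lt_of_le_of_lt (setLIntegral_mono' measurableSet_Ioi fun t ht => ?_) hi.2
  have ht0 : (0 : ℝ) < t := zero_lt_one.trans (Set.mem_Ioi.1 ht)
  have ht1 : 0 ≤ t - 1 := by linarith [Set.mem_Ioi.1 ht]
  rw [← ENNReal.ofReal_mul ht1, Real.enorm_eq_ofReal (by positivity)]
  refine ENNReal.ofReal_le_ofReal ?_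
  change _ ≤ t ^ (1 - p)
  rw [sub_eq_add_neg 1 p, Real.rpow_add ht0, Real.rpow_one]
  gcongr
  linarith

theorem measure_sigmaInv_le_two_ne_zero (A : siegelDomain) :
    siegelMeasure {Z : siegelDomain | sigmaInv A Z ≤ 2} ≠ 0 := by
  have hm : MeasurableSet {Z : siegelDomain | sigmaInv A Z ≤ 2} :=
    (isCompact_sigmaInv_le_subtype A 2).measurableSet
  rw [← lintegral_indicator_one hm]
  have h := lintegral_radial A (F := (Set.Iic 2).indicator 1) (measurable_one.indicator measurableSet_Iic)
  change ∫⁻ Z : siegelDomain, (Set.Iic (2 : ℝ)).indicator (1 : ℝ → ENNReal) (sigmaInv A Z)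
    ∂siegelMeasure ≠ 0
  rw [h]
  refine mul_ne_zero (mul_ne_zero (by norm_num) ballVolume_ne_zero) (ne_of_gt ?_)
  have hle : ∫⁻ _ in Set.Ioc (3 / 2 : ℝ) 2, ENNReal.ofReal (1 / 2)
      ≤ ∫⁻ t in Set.Ioi (1 : ℝ), ENNReal.ofReal (t - 1) * (Set.Iic 2).indicator 1 t := by
    refine (setLIntegral_mono' measurableSet_Ioc fun t ht => ?_).trans
      (lintegral_mono_set fun t ht => ?_)
    · have : t ∈ Set.Iic (2 : ℝ) := ht.2
      rw [Set.indicator_of_mem this, Pi.one_apply, mul_one]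
      exact ENNReal.ofReal_le_ofReal (by linarith [ht.1])
    · exact Set.mem_Ioi.2 (by linarith [ht.1])
  refine lt_of_lt_of_le ?_ hle
  rw [setLIntegral_const, Real.volume_Ioc]
  norm_num

/-- If `γ` and `γ₀` both contribute, then `γ⁻¹ γ₀` moves a point of `B` into `B`, and there are
finitely many such elements. The bound on the overlap is therefore uniform in `W`. -/
theorem tsum_indicator_smul_le [ProperlyDiscontinuousSMul Γ siegelDomain] {B : Set siegelDomain}
    (hB : IsCompact B) (W : siegelDomain) :
    ∑' γ : Γ, B.indicator (1 : siegelDomain → ENNReal) (γ⁻¹ • W)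
      ≤ ({γ : Γ | ((γ • ·) '' B ∩ B).Nonempty}.ncard : ENNReal) := by
  have hfin := ProperlyDiscontinuousSMul.finite_disjoint_inter_image (Γ := Γ) hB hB
  set S₀ : Set Γ := {γ : Γ | ((γ • ·) '' B ∩ B).Nonempty}
  set T : Set Γ := {γ | γ⁻¹ • W ∈ B} with hT
  have hT0 : ∀ γ : Γ, γ ∉ T → B.indicator (1 : siegelDomain → ENNReal) (γ⁻¹ • W) = 0 := fun γ hγ =>
    Set.indicator_of_notMem (s := B) (a := γ⁻¹ • W) hγ _
  rcases T.eq_empty_or_nonempty with h | ⟨γ₀, hγ₀⟩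
  · rw [ENNReal.tsum_eq_zero.2 fun γ => hT0 γ (by rw [h]; exact Set.notMem_empty γ)]
    exact zero_le
  · have hsub : T ⊆ (fun δ => γ₀ * δ⁻¹) '' S₀ := by
      intro γ hγ
      refine ⟨γ⁻¹ * γ₀, ⟨γ⁻¹ • W, ⟨γ₀⁻¹ • W, hγ₀, ?_⟩, hγ⟩, by group⟩
      simp only [smul_smul]
      congr 1
      group
    have hTf : T.Finite := (hfin.image _).subset hsub
    rw [tsum_eq_sum (s := hTf.toFinset) fun γ hγ => hT0 γ (by simpa using hγ)]
    calc _ ≤ ∑ _γ ∈ hTf.toFinset, (1 : ENNReal) :=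
          Finset.sum_le_sum fun γ _ => Set.indicator_le_self' (s := B) (f := 1)
            (fun _ _ => zero_le) (γ⁻¹ • W)
      _ = (T.ncard : ENNReal) := by
          rw [Finset.sum_const, nsmul_one, Set.ncard_eq_toFinset_card _ hTf]
      _ ≤ (S₀.ncard : ENNReal) := by
          exact_mod_cast (Set.ncard_le_ncard hsub (hfin.image _)).trans (Set.ncard_image_le hfin)

/-- Integral comparison: each term is at most a constant times the mean over the translate by `γ` of
a ball around `Z`. These translates overlap a bounded number of times, so the sum is dominated by
the integral of `σ^(-p)` over the domain, finite for `p > 2`. -/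
theorem tsum_sigmaInv_rpow_lt_top [ProperlyDiscontinuousSMul Γ siegelDomain] (Z' Z : siegelDomain)
    {p : ℝ} (hp : 2 < p) :
    ∑' γ : Γ, ENNReal.ofReal (sigmaInv Z' (γ • Z : siegelDomain) ^ (-p)) < ⊤ := by
  have := countable_of_properlyDiscontinuous Γ
  set B : Set siegelDomain := {W | sigmaInv Z W ≤ 2} with hB
  have hBc : IsCompact B := isCompact_sigmaInv_le_subtype Z 2
  have hBm : MeasurableSet B := hBc.measurableSet
  set f : siegelDomain → ENNReal := fun W => ENNReal.ofReal (sigmaInv Z' W ^ (-p)) with hf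
  have hfm : Measurable f := ((continuous_sigmaInv Z').measurable.pow_const _).ennreal_ofReal
  set N : ENNReal := ({γ : Γ | ((γ • ·) '' B ∩ B).Nonempty}.ncard : ENNReal)
  have h1 (γ : Γ) : f (γ • Z) * siegelMeasure B
      ≤ ENNReal.ofReal (8 ^ p) * ∫⁻ W, B.indicator 1 (γ⁻¹ • W) * f W ∂siegelMeasure := by
    have e : ∫⁻ W, B.indicator 1 (γ⁻¹ • W) * f W ∂siegelMeasure
        = ∫⁻ W in B, f (γ • W) ∂siegelMeasure := by
      rw [← (measurePreserving_smul γ siegelMeasure).lintegral_comp_emb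
        (measurableEmbedding_const_smul γ), ← lintegral_indicator hBm]
      refine lintegral_congr fun W => ?_
      by_cases hW : W ∈ B <;> simp [hW]
    rw [e, ← setLIntegral_const, ← lintegral_const_mul' _ _ ENNReal.ofReal_ne_top]
    refine setLIntegral_mono' hBm fun W hW => ?_
    rw [hf, ← ENNReal.ofReal_mul (by positivity)]
    exact ENNReal.ofReal_le_ofReal (sigmaInv_smul_rpow_le (γ : SU21) (by linarith) hW)
  have h2 : (∑' γ : Γ, f (γ • Z)) * siegelMeasure B
      ≤ ENNReal.ofReal (8 ^ p) * (N * ∫⁻ W, f W ∂siegelMeasure) := by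
    rw [← ENNReal.tsum_mul_right]
    refine (ENNReal.tsum_le_tsum h1).trans ?_
    rw [ENNReal.tsum_mul_left, ← lintegral_tsum fun γ => ?_]
    · gcongr
      rw [← lintegral_const_mul _ hfm]
      refine lintegral_mono fun W => ?_
      rw [ENNReal.tsum_mul_right]
      gcongr
      exact tsum_indicator_smul_le Γ hBc W
    · exact (((measurable_one.indicator hBm).comp (measurable_const_smul γ⁻¹)).mul hfm).aemeasurable
  have h3 : ENNReal.ofReal (8 ^ p) * (N * ∫⁻ W, f W ∂siegelMeasure) < ⊤ :=
    ENNReal.mul_lt_top ENNReal.ofReal_lt_top (ENNReal.mul_lt_top (by simp [N])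
      (lintegral_sigmaInv_rpow_lt_top Z' hp))
  exact ENNReal.lt_top_of_mul_ne_top_left (h2.trans_lt h3).ne (measure_sigmaInv_le_two_ne_zero Z)

variable {s : ℂ}

theorem summable_autKernelTerm (hc : ∀ n : ℕ, 2 * s - 1 + n ≠ 0) (hs : 2 < s.re) (m : ℤ)
    [ProperlyDiscontinuousSMul Γ siegelDomain] (Z' Z : siegelDomain) :
    Summable fun γ : Γ => autKernelTerm s m Z' Z γ := by
  obtain ⟨K, hK0, hK⟩ := exists_norm_radialSol_le (κ := |(m : ℝ) / 2|) hc
  have hsum : Summable fun γ : Γ => sigmaInv Z' (γ • Z : siegelDomain) ^ (-s.re) := by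
    have h := ENNReal.summable_toReal (tsum_sigmaInv_rpow_lt_top Γ Z' Z hs).ne
    refine h.congr fun γ => ENNReal.toReal_ofReal ?_
    have := one_le_sigmaInv Z'.2 (γ • Z).2
    positivity
  set E := ‖exp ((|(m : ℝ) / 2| - s) * (Real.pi * I))‖
  -- The finitely many terms with `σ ≤ 2` do not affect convergence. For the others `σ ≤ 2(σ-1)`
  -- absorbs the factor `1/(σ-1)`, whence the `2`.
  refine Summable.of_norm_bounded_eventually (hsum.mul_left (E * (2 * K))) ?_
  have hfin := ProperlyDiscontinuousSMul.finite_disjoint_inter_image (Γ := Γ)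
    (isCompact_singleton (x := Z)) (isCompact_sigmaInv_le_subtype Z' 2)
  filter_upwards [hfin.compl_mem_cofinite] with γ hγ
  have hσ : 2 < sigmaInv Z' (γ • Z : siegelDomain) := by
    by_contra hcon
    exact hγ ⟨γ • Z, ⟨Z, rfl, rfl⟩, not_lt.1 hcon⟩
  have hZ : sigmaInv Z' ((γ : SU21) • Z : siegelDomain) = sigmaInv Z' (γ • Z : siegelDomain) := rfl
  have hσ0 : 0 < sigmaInv Z' (γ • Z : siegelDomain) := by linarith
  rw [autKernelTerm, norm_mul, norm_zpow, norm_autPhase _ Z.2, one_zpow, mul_one,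
    pointPairKernel_eq hc m (by rw [hZ]; linarith), norm_mul, norm_mul,
    norm_phaseH m Z'.2 ((γ : SU21) • Z).2, one_mul, hZ, mul_assoc]
  refine mul_le_mul_of_nonneg_left ((hK _ (by linarith)).trans ?_) (norm_nonneg _)
  rw [div_le_iff₀ (by linarith), sub_eq_add_neg, Real.rpow_add hσ0, Real.rpow_one]
  have : 0 ≤ K * sigmaInv Z' (γ • Z : siegelDomain) ^ (-s.re) := by positivity
  nlinarith

/-- Unfolding of the integral over a fundamental domain. -/
theorem integral_autKernel [ProperlyDiscontinuousSMul Γ siegelDomain]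
    (hc : ∀ n : ℕ, 2 * s - 1 + n ≠ 0) (hs : 2 < s.re) (m : ℤ) {F : Set siegelDomain}
    (hF : IsFundamentalDomain Γ F siegelMeasure) (Z' : siegelDomain) {h : siegelDomain → ℂ}
    (hh : ∀ γ : Γ, ∀ Z, h (γ • Z) = autPhase γ Z ^ m * h Z)
    (hint : Integrable (fun Z : siegelDomain => pointPairKernel s m Z' Z * h Z) siegelMeasure) :
    IntegrableOn (fun Z : siegelDomain => autKernel Γ s m Z' Z * h Z) F siegelMeasure ∧
      ∫ Z in F, autKernel Γ s m Z' Z * h Z ∂siegelMeasure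
        = ∫ Z : siegelDomain, pointPairKernel s m Z' Z * h Z ∂siegelMeasure := by
  have := countable_of_properlyDiscontinuous Γ
  set Φ : siegelDomain → ℂ := fun Z => pointPairKernel s m Z' Z * h Z with hΦ
  have hterm : ∀ (γ : Γ) (Z : siegelDomain), autKernelTerm s m Z' Z γ * h Z = Φ (γ • Z) := by
    intro γ Z
    rw [hΦ]
    simp only [hh, autKernelTerm]
    rw [mul_assoc]
    rfl
  have hsumm : ∀ Z, HasSum (fun γ : Γ => Φ (γ • Z)) (autKernel Γ s m Z' Z * h Z) := by
    intro Z
    simp only [← hterm]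
    exact (summable_autKernelTerm Γ hc hs m Z' Z).hasSum.mul_right _
  have hG : ∀ Z, autKernel Γ s m Z' Z * h Z = ∑' γ : Γ, Φ (γ • Z) := fun Z => (hsumm Z).tsum_eq.symm
  have hmeas : ∀ γ : Γ, AEStronglyMeasurable (fun Z => Φ (γ • Z)) (siegelMeasure.restrict F) :=
    fun γ => (hint.aestronglyMeasurable.comp_measurePreserving
      (measurePreserving_smul γ siegelMeasure)).restrict
  -- Unfolding is carried out for the norms first; this justifies interchanging sum and integral
  -- below.
  have hfin : ∑' γ : Γ, ∫⁻ Z in F, ‖Φ (γ • Z)‖ₑ ∂siegelMeasure ≠ ⊤ := by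
    rw [← hF.lintegral_eq_tsum'' fun Z => ‖Φ Z‖ₑ]
    exact hint.2.ne
  simp only [hG]
  refine ⟨⟨?_, ?_⟩, ?_⟩
  · refine aestronglyMeasurable_of_tendsto_ae (atTop : Filter (Finset Γ))
      (f := fun S Z => ∑ γ ∈ S, Φ (γ • Z)) (fun S => ?_) (ae_of_all _ fun Z => ?_)
    · exact Finset.aestronglyMeasurable_fun_sum S fun γ _ => hmeas γ
    · rw [← hG]
      exact hsumm Z
  · refine lt_of_le_of_lt (lintegral_mono fun Z => enorm_tsum_le_tsum_enorm) ?_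
    rw [lintegral_tsum fun γ => (hmeas γ).enorm]
    exact lt_top_iff_ne_top.2 hfin
  · rw [integral_tsum hmeas hfin, hF.integral_eq_tsum'' Φ hint]

end DiscreteGroups

/-! ### Weight zero, automorphic functions, and the main theorem. -/

/-- The constant is the principal value of `(-1)^(-s)`, split off from `(1 - σ)^(-s)`. -/
theorem pointPairKernel_weight_zero (s : ℂ) {Z' Z : siegelDomain} (h : Z' ≠ Z) :
    pointPairKernel s 0 Z' Z = exp (-s * (Real.pi * I)) * (((sigmaInv Z' Z - 1 : ℝ) : ℂ) ^ (-s) *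
      gaussF s (s - 1) (2 * s - 1) (-((sigmaInv Z' Z - 1 : ℝ) : ℂ)⁻¹)) := by
  have hσ : 1 < sigmaInv Z' Z := one_lt_sigmaInv Z'.2 Z.2 fun e => h (Subtype.ext e)
  rw [pointPairKernel, radialKernel]
  generalize sigmaInv (Z' : ℂ × ℂ) Z = σ at hσ ⊢
  have h1 : phaseH 0 Z' Z = 1 := by simp [phaseH]
  have h2 : -1 / ((σ : ℂ) - 1) = -((σ - 1 : ℝ) : ℂ)⁻¹ := by
    push_cast
    rw [neg_div, one_div]
  rw [h1, h2, one_sub_cpow _ hσ]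
  simp only [Int.cast_zero, zero_div, abs_zero, ofReal_zero, neg_zero, cpow_zero, zero_sub, sub_zero,
    one_mul]
  ring

/-- The reproducing formula for automorphic functions on a compact quotient. -/
theorem integral_autKernel_of_automorphic {s : ℂ} (hc : ∀ n : ℕ, 2 * s - 1 + n ≠ 0) (hs : 2 < s.re)
    (m : ℤ) (Γ : Subgroup SU21) [ProperlyDiscontinuousSMul Γ siegelDomain]
    [CompactSpace (MulAction.orbitRel.Quotient Γ siegelDomain)] {F : Set siegelDomain}
    (hF : IsFundamentalDomain Γ F siegelMeasure) {g : ℂ × ℂ → ℂ} (hg : IsC2Automorphic Γ m g)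
    (Z' : siegelDomain) :
    IntegrableOn (fun Z : siegelDomain => autKernel Γ s m Z' Z *
        (-weightLaplacian ((m : ℝ) / 2) g Z + s * (s - 2) * g Z)) F siegelMeasure ∧
      reproducingConst m s * (4 * (Real.pi : ℂ) ^ 2 * g Z') =
        ∫ Z in F, autKernel Γ s m Z' Z *
          (-weightLaplacian ((m : ℝ) / 2) g Z + s * (s - 2) * g Z) ∂siegelMeasure := by
  obtain ⟨hg2, hgΓ⟩ := hg
  set h : siegelDomain → ℂ := fun Z => -weightLaplacian ((m : ℝ) / 2) g Z + s * (s - 2) * g Z with hh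
  have hhΓ : ∀ γ : Γ, ∀ Z : siegelDomain, h (γ • Z) = autPhase γ Z ^ m * h Z := by
    intro γ Z
    have e1 := weightLaplacian_smul m hg2 (hgΓ γ γ.2) Z
    have e2 := hgΓ γ γ.2 Z
    change -weightLaplacian ((m : ℝ) / 2) g ((γ : SU21) • Z : siegelDomain)
      + s * (s - 2) * g ((γ : SU21) • Z : siegelDomain) = _
    rw [e1, e2, hh]
    ring
  have hgc : Continuous fun Z : siegelDomain => g Z :=
    continuousOn_iff_continuous_domRestrict.1 hg2.continuousOn
  have hhc : Continuous h := (continuousOn_iff_continuous_domRestrict.1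
    (continuousOn_weightLaplacian ((m : ℝ) / 2) hg2)).neg.add (continuous_const.mul hgc)
  have hphase : ∀ (γ : Γ) (Z : siegelDomain), ‖autPhase γ Z ^ m‖ = 1 := fun γ Z => by
    rw [norm_zpow, norm_autPhase _ Z.2, one_zpow]
  -- The automorphy factor has modulus `1`, so `‖g‖`, and likewise `‖h‖`, descends to a continuous
  -- function on the compact quotient.
  obtain ⟨B, hB⟩ := exists_bound_of_invariant Γ hgc.norm fun γ Z => by
    have := hgΓ γ γ.2 Z
    change ‖g ((γ : SU21) • Z : siegelDomain)‖ = _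
    rw [this, norm_mul, hphase, one_mul]
  obtain ⟨B', hB'⟩ := exists_bound_of_invariant Γ hhc.norm fun γ Z => by
    rw [hhΓ, norm_mul, hphase, one_mul]
  obtain ⟨hint, heq⟩ := integral_pointPairKernel_of_bounded hc hs m Z' hg2 hB hB'
  obtain ⟨h1, h2⟩ := integral_autKernel Γ hc hs m hF Z' hhΓ hint
  exact ⟨h1, heq.trans h2.symm⟩

theorem theorem2p11 (m : ℤ) (s : ℂ) (hs : ∀ n : ℕ, 2 * s - 1 ≠ -(n : ℂ)) :
    -- for `k = 0` the kernel is, up to a constant, `u^(-s) F(s, s - 1; 2s - 1; -1/u)`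
    (∃ d : ℂ, d ≠ 0 ∧ ∀ Z' Z : siegelDomain, Z' ≠ Z →
      pointPairKernel s 0 Z' Z =
        d * (((sigmaInv Z' Z - 1 : ℝ) : ℂ) ^ (-s) *
          gaussF s (s - 1) (2 * s - 1) (-((sigmaInv Z' Z - 1 : ℝ) : ℂ)⁻¹))) ∧
    ∃ C : ℂ, (C = 0 ↔ ∃ n : ℕ, s = ((|(m : ℝ) / 2| : ℝ) : ℂ) - n) ∧
      -- compactly supported functions on the Siegel domain
      (∀ g : ℂ × ℂ → ℂ, IsCc2 g → ∀ Z' : siegelDomain,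
        Integrable (fun Z : siegelDomain => pointPairKernel s m Z' Z *
          (-weightLaplacian ((m : ℝ) / 2) g Z + s * (s - 2) * g Z)) siegelMeasure ∧
        C * (4 * (Real.pi : ℂ) ^ 2 * g Z') =
          ∫ Z : siegelDomain, pointPairKernel s m Z' Z *
            (-weightLaplacian ((m : ℝ) / 2) g Z + s * (s - 2) * g Z) ∂siegelMeasure) ∧
      -- automorphic functions
      (2 < s.re → ∀ Γ : Subgroup SU21,
        ProperlyDiscontinuousSMul Γ siegelDomain →
        (∀ γ ∈ Γ, ∀ Z : siegelDomain, γ • Z = Z → γ = 1) →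
        CompactSpace (MulAction.orbitRel.Quotient Γ siegelDomain) →
        (∀ Z' Z : siegelDomain, (∀ γ ∈ Γ, γ • Z ≠ Z') →
          Summable (fun γ : Γ => autKernelTerm s m Z' Z γ)) ∧
        ∀ F : Set siegelDomain, IsFundamentalDomain Γ F siegelMeasure →
        ∀ g : ℂ × ℂ → ℂ, IsC2Automorphic Γ m g → ∀ Z' : siegelDomain,
          IntegrableOn (fun Z : siegelDomain => autKernel Γ s m Z' Z *
            (-weightLaplacian ((m : ℝ) / 2) g Z + s * (s - 2) * g Z)) F siegelMeasure ∧
          C * (4 * (Real.pi : ℂ) ^ 2 * g Z') =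
            ∫ Z in F, autKernel Γ s m Z' Z *
              (-weightLaplacian ((m : ℝ) / 2) g Z + s * (s - 2) * g Z) ∂siegelMeasure) := by
  have hc : ∀ n : ℕ, 2 * s - 1 + n ≠ 0 := fun n hn => hs n (eq_neg_of_add_eq_zero_left hn)
  refine ⟨⟨exp (-s * (Real.pi * I)), exp_ne_zero _, fun Z' Z h => pointPairKernel_weight_zero s h⟩,
    reproducingConst m s, reproducingConst_eq_zero_iff hc m,
    fun g hg Z' => integral_pointPairKernel_of_compact hc m Z' hg, ?_⟩
  intro hs2 Γ hΓ _ hcomp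
  exact ⟨fun Z' Z _ => summable_autKernelTerm Γ hc hs2 m Z' Z,
    fun F hF g hg Z' => integral_autKernel_of_automorphic hc hs2 m Γ hF hg Z'⟩
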